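/- **Theorem 5.28 (A metric Brenier–McCann theorem).** *Conventions.* On $\bar{\mathbf R}=[-\infty,+\infty]$ put $\pm\infty+z:=\pm\infty$ for all $z$, $+\infty-(+\infty):=+\infty$, $-\infty-(-\infty):=+\infty$, $0\cdot(\pm\infty):=0$. Powers of $0$ and $+\infty$ are the usual ones in $[0,+\infty]$ (so $0^r=+\infty$ and $(+\infty)^r=0$ for $r<0$). *Spacetimes.* Let $\ell:M\times M\to\{-\infty\}\cup[0,+\infty]$ satisfy $\ell(x,y)\le\ell(x,z)-\ell(y,z)$ and $\ell(x,x)\ge 0$ for all $x,y,z\in M$. Write $x\ll y$ if $\ell(x,y)>0$ and $x\le y$ if $\ell(x,y)\ge0$; let $I^\pm(x)$, $J^\pm(x)$ be the chronological and causal future/past of $x$, and $\ell_+=\max\{\ell,0\}$. $M$ carries the coarsest topology in which all $I^\pm(x)$ are open; it is assumed to be Polish. $(M,\ell)$ is *forward* if $\{\ell\ge 0\}$ is closed and every sequence $(y_i)_{i\in\mathbf Z}$ with $x\le y_i\le y_{i+1}\le z$ for some $x,z\in M$ and all $i$ converges as $i\to+\infty$. An *emerald* is a set $J^+(C_0)\cap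 J^-(C_1)$ with $C_0,C_1$ compact. Let $\mathbf m$ be a Radon measure on $M$. *Admissibility.* Let $0\ne q<1$. For $\mu,\nu\in\mathcal P(M)$ let $\ell_q(\mu,\nu)=\sup_\pi[\int\ell^q\,d\pi]^{1/q}$ over all couplings $\pi$ of $\mu,\nu$ concentrated on $\{\ell\ge0\}$ ($\sup\emptyset=-\infty$); maximizers are called *$\ell_q$-optimal*. A pair $(\mu,\nu)$, each vanishing outside some emerald, is *strictly timelike $q$-dualizable* if $\ell_q(\mu,\nu)\in(0,+\infty)$, an $\ell_q$-optimal coupling exists, and every $\ell_q$-optimal coupling is concentrated on $\{\ell>0\}$. $(M,\ell,\mathbf m)$ is *$q$-essentially left-regular* if, for every such pair with $\mu,\nu\le C\mathbf m$ for some finite $C$, the only $\xi\in\mathcal P(M)$ with $\ell_q(\mu,\xi)=\ell_q(\mu,\nu)$ and $\ell_q(\xi,\nu)=0$ is $\xi=\nu$, and this $\xi=\nu$ has these two properties; it is *$q$-essentially right-regular* if its time-reversal ($\ell(x,y)$ replaced by $\ell(y,x)$) is $q$-essentially left-regular. $(M,\ell,\mathbf m)$ is *$q$-admissible* if it is forward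 and $q$-essentially left- and right-regular, $\ell$ is finite on $\{\ell\ge 0\}$, the restriction of $\ell$ to $\mathcal E\times \mathcal E$ is upper semicontinuous for every emerald $\mathcal E$, and $\mathbf m$ is finite on every emerald. *Paths and plans.* $\mathrm{LCC}([0,1];M)$ is the set of $\gamma:[0,1]\to M$ with $\gamma_s\le\gamma_t$ for $s\le t$ that are left-continuous on $(0,1]$, with the topology of the distance $D(\gamma,\eta)=d(\gamma_0,\eta_0)+\int_0^1 d(\gamma_t,\eta_t)\,dt$, where $d\le 1$ is any metric inducing the topology of $M$. Let $\mathbf e_t(\gamma)=\gamma_t$ and $\mathrm{restr}_0^T(\gamma)_r=\gamma_{rT}$. $\mathrm{TGeo}(M)$ is the set of $\gamma\in\mathrm{LCC}([0,1];M)$ with $0<\ell(\gamma_s,\gamma_t)=(t-s)\,\ell(\gamma_0,\gamma_1)<\infty$ for all $s<t$. For $\gamma\in\mathrm{LCC}([0,1];M)$, $|\dot\gamma_t|$ is the Lebesgue density of the largest Borel measure $\nu$ on $\mathbf R$ with $\nu((a,b))\le\ell(\gamma_a,\gamma_b)$ for all $a\le b$, where $\gamma_a:=\gamma_0$ for $a<0$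 and $\gamma_a:=\gamma_1$ for $a>1$. A *test plan* is a Borel probability measure $\pi$ on $\mathrm{LCC}([0,1];M)$ with $(\mathbf e_t)_\#\pi\le C\mathbf m$ for all $t\in[0,1]$ and some constant $C$. An *initial test plan* is a Borel probability measure $\pi$ on $\mathrm{LCC}([0,1];M)$ such that $(\mathrm{restr}_0^T)_\#\pi$ is a test plan for some $T\in(0,1]$ and $(\mathbf e_t)_\#\pi\to(\mathbf e_0)_\#\pi$ narrowly as $t\downarrow 0$. It *stays initially in* $E\subseteq M$ if for some $T\in(0,1]$, $(\mathbf e_t)_\#\pi$ is concentrated on $E$ for all $t\in[0,T]$. *Causal functions and slopes.* Let $f:M\to\bar{\mathbf R}$ be $\mathbf m$-measurable and causal, i.e. $f(x)\le f(y)$ whenever $x\le y$. An $\mathbf m$-measurable $G:M\to[0,+\infty]$ is a *weak subslope* of $f$ if $\int[f(\gamma_1)-f(\gamma_0)]\,d\pi(\gamma)\ge\iint_0^1G(\gamma_t)|\dot\gamma_t|\,dt\,d\pi(\gamma)$ for every test plan $\pi$; $|df|$ denotes the $\mathbf m$-a.e. unique weak subslope that is $\mathbf m$-a.e. no smaller than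 any other. With $f^+(x)=\inf_{I^+(x)}f$ and $f^-(x)=\sup_{I^-(x)}f$, the *backward slope* is $$|\partial^bf|(x)=\sup_{U}\ \inf_{z\in U\cap J^-(x)}\frac{f^+(x)-f^-(z)}{\ell(z,x)},$$ the supremum being over all neighbourhoods $U$ of $x$, and where $a/0:=+\infty$ for all $a\in[0,+\infty]$. For $p^{-1}+q^{-1}=1$ and an $\mathbf m$-measurable set $E\subseteq M$, an initial test plan $\pi$ *represents the initial $p$-gradient of $f$ on $E$* if it stays initially in $E$, $|df|^p\in L^1(E,\mathbf m\llcorner E)$, $\liminf_{t\downarrow0}\frac1{tq}\iint_0^t|\dot\gamma_r|^q\,dr\,d\pi(\gamma)<+\infty$, and $$\limsup_{t\downarrow0}\int\frac{f(\gamma_t)-f(\gamma_0)}t\,d\pi(\gamma)\le\frac1p\int|df|^p(\gamma_0)\,d\pi(\gamma)+\liminf_{t\downarrow0}\frac1{tq}\iint_0^t|\dot\gamma_r|^q\,dr\,d\pi(\gamma).$$ *Concavity.* $f:M\to\bar{\mathbf R}$ is *$\ell^q/q$-concave* if there is $\psi:M\to\bar{\mathbf R}$ with $f(x)=\inf_{z\in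 J^+(x)}[\psi(z)-\frac1q\ell(x,z)^q]$ for all $x\in M$ (such $f$ is causal). Put $f^{(\ell^q/q)}(y)=\sup_{x\in J^-(y)}[f(x)+\frac1q\ell(x,y)^q]$. The *$\ell^q/q$-superdifferential* of $f$ is the set of pairs $(x,y)$ with $x\le y$ such that $f^{(\ell^q/q)}(y)=f(x)+\frac1q\ell(x,y)^q$, both sides being finite. **Statement.** Let $0\neq q<1$ and $p^{-1}+q^{-1}=1$. Let $(M,\ell,\mathbf m)$ be a $q$-admissible metric measure spacetime such that $\ell_+$ is lower semicontinuous on $M\times M$, and let $f:M\to\bar{\mathbf R}$ be $\mathbf m$-measurable and $\ell^q/q$-concave. Let $\pi$ be an initial test plan concentrated on $\mathrm{TGeo}(M)$ such that $(\mathbf e_0,\mathbf e_1)_\#\pi$ is concentrated on the $\ell^q/q$-superdifferential of $f$. Assume that $\pi$ stays initially in some $\mathbf m$-measurable set $E\subseteq M$, that $q^{-1}\int\ell(\gamma_0,\gamma_1)^q\,d\pi(\gamma)<+\infty$ and $|df|^p\in L^1(E,\mathbf m\llcorner E)$, and that $f(\gamma_0)\in\mathbf R$ and $\ell(\gamma_0,\gamma_1)\in(0,+\infty)$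 for $\pi$-a.e. $\gamma$. Then $\pi$ represents the initial $p$-gradient of $f$ on $E$, and $\pi$-a.e. $\gamma$ satisfies $$|\partial^bf|(\gamma_0)=|df|(\gamma_0)=\ell(\gamma_0,\gamma_1)^{q-1}.$$ -/

import Mathlib

open Set Filter Topology MeasureTheory
open scoped ENNReal NNReal unitInterval BoundedContinuousFunction

noncomputable section

namespace LorentzSobolev

/-! ### Arithmetic conventions on `[-∞, +∞]` -/

/-- Addition with `±∞ + z = ±∞` for every `z` (the left summand decides). -/
def addConv (a b : EReal) : EReal := if a = ⊤ then ⊤ else a + b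

/-- Subtraction with `(+∞) - (+∞) = +∞` and `(-∞) - (-∞) = +∞`. -/
def subConv (a b : EReal) : EReal := if a = ⊤ ∨ b = ⊥ then ⊤ else a - b

/-! ### Rough spacetimes and metric spacetimes -/

section Spacetime

variable {M : Type*}

/-- `x ≪ y`. -/
def Chron (ℓ : M → M → EReal) (x y : M) : Prop := 0 < ℓ x y

/-- `x ≤ y`. -/
def Causal (ℓ : M → M → EReal) (x y : M) : Prop := 0 ≤ ℓ x y

/-- Chronological future and past, causal future and past of a point. -/
def IPlus (ℓ : M → M → EReal) (x : M) : Set M := {y | Chron ℓ x y}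
def IMinus (ℓ : M → M → EReal) (x : M) : Set M := {y | Chron ℓ y x}
def JPlus (ℓ : M → M → EReal) (x : M) : Set M := {y | Causal ℓ x y}
def JMinus (ℓ : M → M → EReal) (x : M) : Set M := {y | Causal ℓ y x}

/-- The coarsest topology in which all chronological futures and pasts are open. -/
@[reducible] def chronologicalTopology (ℓ : M → M → EReal) : TopologicalSpace M :=
  TopologicalSpace.generateFrom {U | ∃ x, U = IPlus ℓ x ∨ U = IMinus ℓ x}

/-- `(M, ℓ)` is a rough spacetime: `ℓ` takes values in `{-∞} ∪ [0, +∞]`, satisfies the reverse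
triangle inequality, and is nonnegative on the diagonal. -/
structure IsRoughSpacetime (ℓ : M → M → EReal) : Prop where
  range : ∀ x y, ℓ x y = ⊥ ∨ 0 ≤ ℓ x y
  revTriangle : ∀ x y z, ℓ x y ≤ subConv (ℓ x z) (ℓ y z)
  diag : ∀ x, 0 ≤ ℓ x x

/-- `(M, ℓ)` is a metric spacetime: the given topology of `M` is the chronological one, and it is
Polish. -/
structure IsMetricSpacetime [τ : TopologicalSpace M] (ℓ : M → M → EReal) : Prop
    extends IsRoughSpacetime ℓ where
  topology_eq : τ = chronologicalTopology ℓ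
  polish : PolishSpace M

/-- Order-bounded monotone two-sided sequences have a forward limit. -/
def IsForwardComplete [TopologicalSpace M] (ℓ : M → M → EReal) : Prop :=
  ∀ (x z : M) (y : ℤ → M),
    (∀ i, Causal ℓ x (y i) ∧ Causal ℓ (y i) (y (i + 1)) ∧ Causal ℓ (y (i + 1)) z) →
      ∃ y' : M, Tendsto y atTop (𝓝 y')

/-- Forward metric spacetimes. -/
structure IsForwardMetricSpacetime [TopologicalSpace M] (ℓ : M → M → EReal) : Prop
    extends IsMetricSpacetime ℓ where
  forwardComplete : IsForwardComplete ℓ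
  isClosed_causal : IsClosed {z : M × M | Causal ℓ z.1 z.2}

/-- Causal emeralds `J(C₀, C₁) = J⁺(C₀) ∩ J⁻(C₁)` with `C₀`, `C₁` compact. -/
def IsEmerald [TopologicalSpace M] (ℓ : M → M → EReal) (E : Set M) : Prop :=
  ∃ C₀ C₁ : Set M, IsCompact C₀ ∧ IsCompact C₁ ∧
    E = (⋃ x ∈ C₀, JPlus ℓ x) ∩ (⋃ y ∈ C₁, JMinus ℓ y)

/-- `ℓ(x,y)^q` for `x ≤ y`, as an element of `[0, +∞]`. For negative `q` one has `0^q = +∞` and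
`(+∞)^q = 0`. -/
def lpow (ℓ : M → M → EReal) (q : ℝ) (x y : M) : ℝ≥0∞ := (ℓ x y).toENNReal ^ q

/-- `ℓ(x,y)^q / q` for `x ≤ y`. -/
def lpowDiv (ℓ : M → M → EReal) (q : ℝ) (x y : M) : EReal :=
  ((q⁻¹ : ℝ) : EReal) * (lpow ℓ q x y : EReal)

/-! ### Causal functions, their slopes, and `ℓ^q/q`-concavity -/

/-- The upper representative `f⁺(y) = inf_{z ≫ y} f(z)`. -/
def upperRep (ℓ : M → M → EReal) (f : M → EReal) (y : M) : EReal := ⨅ z ∈ IPlus ℓ y, f z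

/-- The lower representative `f⁻(y) = sup_{x ≪ y} f(x)`. -/
def lowerRep (ℓ : M → M → EReal) (f : M → EReal) (y : M) : EReal := ⨆ x ∈ IMinus ℓ y, f x

/-- Quotient in `[0, +∞]` with `a / 0 = +∞` for every `a`, including `0 / 0 = +∞`. -/
def slopeDiv (a b : ℝ≥0∞) : ℝ≥0∞ := if b = 0 then ⊤ else a / b

/-- The backward slope `|∂ᵇf|(x)`: the supremum over all neighbourhoods `U` of `x` of
the infimum of `(f⁺(x) - f⁻(z)) / ℓ(z,x)` over `z ∈ U ∩ J⁻(x)`. -/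
def backwardSlope [TopologicalSpace M] (ℓ : M → M → EReal) (f : M → EReal) (x : M) : ℝ≥0∞ :=
  ⨆ U ∈ 𝓝 x, ⨅ z ∈ U ∩ JMinus ℓ x,
    slopeDiv (subConv (upperRep ℓ f x) (lowerRep ℓ f z)).toENNReal (ℓ z x).toENNReal

/-- `ℓ^q/q`-concave functions. -/
def IsLqConcave (ℓ : M → M → EReal) (q : ℝ) (f : M → EReal) : Prop :=
  ∃ ψ : M → EReal, ∀ x, f x = ⨅ z ∈ JPlus ℓ x, subConv (ψ z) (lpowDiv ℓ q x z)

/-- The `ℓ^q/q`-transform of `f`. -/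
def lqTransform (ℓ : M → M → EReal) (q : ℝ) (f : M → EReal) (y : M) : EReal :=
  ⨆ x ∈ JMinus ℓ y, addConv (f x) (lpowDiv ℓ q x y)

/-- The `ℓ^q/q`-superdifferential of `f`: the pairs `x ≤ y` for which
`f^{(ℓ^q/q)}(y) = f(x) + ℓ(x,y)^q/q`, both sides being finite. -/
def superdifferential (ℓ : M → M → EReal) (q : ℝ) (f : M → EReal) : Set (M × M) :=
  {z | Causal ℓ z.1 z.2 ∧
    lqTransform ℓ q f z.2 = addConv (f z.1) (lpowDiv ℓ q z.1 z.2) ∧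
    lqTransform ℓ q f z.2 ≠ ⊤ ∧ lqTransform ℓ q f z.2 ≠ ⊥}

end Spacetime

/-! ### The Lorentz–Wasserstein distance and admissibility -/

section Transport

variable {M : Type*} [TopologicalSpace M] [MeasurableSpace M] [BorelSpace M]

/-- `π` is a causal coupling of `μ` and `ν`. -/
def IsCausalCoupling (ℓ : M → M → EReal) (μ ν : ProbabilityMeasure M) (π : Measure (M × M)) :
    Prop :=
  π.map Prod.fst = (μ : Measure M) ∧ π.map Prod.snd = (ν : Measure M) ∧
    ∀ᵐ z ∂π, Causal ℓ z.1 z.2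

/-- The transport cost `(∫ ℓ^q dπ)^{1/q}`. -/
def couplingCost (ℓ : M → M → EReal) (q : ℝ) (π : Measure (M × M)) : ℝ≥0∞ :=
  (∫⁻ z, lpow ℓ q z.1 z.2 ∂π) ^ q⁻¹

/-- The `q`-Lorentz–Wasserstein distance `ℓ_q(μ,ν)`; it equals `-∞` if there is no causal
coupling. -/
def lorentzWasserstein (ℓ : M → M → EReal) (q : ℝ) (μ ν : ProbabilityMeasure M) : EReal :=
  ⨆ (π : Measure (M × M)) (_ : IsCausalCoupling ℓ μ ν π), (couplingCost ℓ q π : EReal)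

/-- `ℓ_q`-optimal couplings. -/
def IsOptimalCoupling (ℓ : M → M → EReal) (q : ℝ) (μ ν : ProbabilityMeasure M)
    (π : Measure (M × M)) : Prop :=
  IsCausalCoupling ℓ μ ν π ∧ (couplingCost ℓ q π : EReal) = lorentzWasserstein ℓ q μ ν

/-- `μ` vanishes outside some emerald. -/
def IsEmeraldSupported (ℓ : M → M → EReal) (μ : ProbabilityMeasure M) : Prop :=
  ∃ E : Set M, IsEmerald ℓ E ∧ (μ : Measure M) Eᶜ = 0

/-- Timelike `q`-dualizable pairs. -/
def IsTimelikeDualizable (ℓ : M → M → EReal) (q : ℝ) (μ ν : ProbabilityMeasure M) : Prop :=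
  IsEmeraldSupported ℓ μ ∧ IsEmeraldSupported ℓ ν ∧
    0 < lorentzWasserstein ℓ q μ ν ∧ lorentzWasserstein ℓ q μ ν < ⊤ ∧
    ∃ π : Measure (M × M), IsOptimalCoupling ℓ q μ ν π ∧ ∀ᵐ z ∂π, Chron ℓ z.1 z.2

/-- Strictly timelike `q`-dualizable pairs. -/
def IsStrictlyTimelikeDualizable (ℓ : M → M → EReal) (q : ℝ) (μ ν : ProbabilityMeasure M) :
    Prop :=
  IsTimelikeDualizable ℓ q μ ν ∧
    ∀ π : Measure (M × M), IsOptimalCoupling ℓ q μ ν π → ∀ᵐ z ∂π, Chron ℓ z.1 z.2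

/-- The set of `t`-intermediate point measures of `μ` and `ν` with respect to `ℓ_q`. -/
def intermediateMeasures (ℓ : M → M → EReal) (q : ℝ) (t : I) (μ ν : ProbabilityMeasure M) :
    Set (ProbabilityMeasure M) :=
  {ξ | lorentzWasserstein ℓ q μ ξ = ((t : ℝ) : EReal) * lorentzWasserstein ℓ q μ ν ∧
    lorentzWasserstein ℓ q ξ ν = ((1 - (t : ℝ) : ℝ) : EReal) * lorentzWasserstein ℓ q μ ν}

/-- `μ ≤ C 𝔪` for some finite constant `C`. -/
def HasBoundedCompression (m : Measure M) (μ : ProbabilityMeasure M) : Prop :=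
  ∃ C : ℝ≥0, (μ : Measure M) ≤ C • m

/-- `q`-essential left-regularity. -/
def IsEssentiallyLeftRegular (ℓ : M → M → EReal) (m : Measure M) (q : ℝ) : Prop :=
  ∀ μ ν : ProbabilityMeasure M, IsStrictlyTimelikeDualizable ℓ q μ ν →
    HasBoundedCompression m μ → HasBoundedCompression m ν →
      intermediateMeasures ℓ q 1 μ ν = {ν}

/-- `q`-essential right-regularity: left-regularity of the time-reversal `(x, y) ↦ ℓ(y, x)`. -/
def IsEssentiallyRightRegular (ℓ : M → M → EReal) (m : Measure M) (q : ℝ) : Prop :=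
  IsEssentiallyLeftRegular (fun x y => ℓ y x) m q

/-- `(M, ℓ, 𝔪)` is a `q`-admissible metric measure spacetime. A Radon measure on a Polish space is
the same as a locally finite Borel measure. -/
structure IsAdmissible (ℓ : M → M → EReal) (m : Measure M) (q : ℝ) : Prop
    extends IsForwardMetricSpacetime ℓ where
  radon : IsLocallyFiniteMeasure m
  leftRegular : IsEssentiallyLeftRegular ℓ m q
  rightRegular : IsEssentiallyRightRegular ℓ m q
  finite_of_causal : ∀ x y, Causal ℓ x y → ℓ x y ≠ ⊤
  upperSemicontinuousOn_emerald : ∀ E : Set M, IsEmerald ℓ E →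
    UpperSemicontinuousOn (fun z : M × M => ℓ z.1 z.2) (E ×ˢ E)
  measure_emerald_lt_top : ∀ E : Set M, IsEmerald ℓ E → m E < ⊤

end Transport

/-! ### Left-continuous causal paths -/

/-- The set `LCC([0,1]; M)` of left-continuous causal paths. -/
structure LCC {M : Type*} [TopologicalSpace M] (ℓ : M → M → EReal) where
  /-- The underlying path. -/
  path : I → M
  causal : ∀ s t : I, s ≤ t → Causal ℓ (path s) (path t)
  left_cont : ∀ t : I, 0 < t → Tendsto path (𝓝[<] t) (𝓝 (path t))

section Paths

variable {M : Type*} [MetricSpace M] {ℓ : M → M → EReal}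

/-- The evaluation map `e_t`. -/
def eval (t : I) (γ : LCC ℓ) : M := γ.path t

/-- The distance `D(γ,η) = d(γ₀,η₀) + ∫₀¹ d(γ_t,η_t) dt`, where the background metric `d` has been
replaced by `min {d, 1}`, which induces the same topology on `M`. -/
def pathDist (γ η : LCC ℓ) : ℝ≥0∞ :=
  min (edist (γ.path 0) (η.path 0)) 1 + ∫⁻ t : I, min (edist (γ.path t) (η.path t)) 1

/-- The topology on `LCC([0,1]; M)` induced by `D`, given by the subbase of open `D`-balls. -/
instance : TopologicalSpace (LCC ℓ) :=
  TopologicalSpace.generateFrom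
    {B | ∃ (γ : LCC ℓ) (ε : ℝ≥0∞), B = {η : LCC ℓ | pathDist γ η < ε}}

instance : MeasurableSpace (LCC ℓ) := borel (LCC ℓ)

instance : BorelSpace (LCC ℓ) := ⟨rfl⟩

/-- The parameter `(1 - r) s + r t`. -/
def lineParam (s t r : I) : I :=
  ⟨(1 - (r : ℝ)) * s + r * t, by
    have := (convex_Icc (0 : ℝ) 1) s.2 t.2 (a := 1 - (r : ℝ)) (b := (r : ℝ))
      (by linarith [r.2.2]) r.2.1 (by ring)
    simpa using this⟩

theorem continuous_lineParam (s t : I) : Continuous (lineParam s t) := by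
  unfold lineParam
  fun_prop

/-- The restriction `restr_s^t(γ)_r = γ_{(1-r)s+rt}` of a path to `[s,t]`. -/
def restr (s t : I) (hst : s < t) (γ : LCC ℓ) : LCC ℓ where
  path r := γ.path (lineParam s t r)
  causal r r' h := γ.causal _ _ (by
    have h' : (r : ℝ) ≤ r' := h
    have hst' : (s : ℝ) < t := hst
    change (1 - (r : ℝ)) * s + r * t ≤ (1 - (r' : ℝ)) * s + r' * t
    nlinarith)
  left_cont r hr := by
    have hst' : (s : ℝ) < t := hst
    have key : ∀ a b : I, a < b → lineParam s t a < lineParam s t b := by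
      intro a b hab
      have hab' : (a : ℝ) < b := hab
      change (1 - (a : ℝ)) * s + a * t < (1 - (b : ℝ)) * s + b * t
      nlinarith
    refine (γ.left_cont (lineParam s t r) ?_).comp ?_
    · exact lt_of_le_of_lt unitInterval.nonneg' (key 0 r hr)
    · refine tendsto_nhdsWithin_iff.2 ⟨?_, ?_⟩
      · exact ((continuous_lineParam s t).tendsto r).mono_left nhdsWithin_le_nhds
      · filter_upwards [self_mem_nhdsWithin] with a ha
        exact key a r ha

/-- The causal speed measure of `γ`: the largest Borel measure `ν` on `ℝ` such that
`ν((a,b)) ≤ ℓ(γ_a,γ_b)` for all `a ≤ b`, where parameters outside `[0,1]` are moved to the nearest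
endpoint. -/
def causalSpeed (γ : LCC ℓ) : Measure ℝ :=
  sSup {ν | ∀ a b : ℝ, a ≤ b → ν (Ioo a b) ≤
    (ℓ (γ.path (projIcc 0 1 zero_le_one a)) (γ.path (projIcc 0 1 zero_le_one b))).toENNReal}

/-- The causal speed `|γ̇_t|`: the Lebesgue density of the causal speed measure. -/
def speed (γ : LCC ℓ) : ℝ → ℝ≥0∞ := (causalSpeed γ).rnDeriv volume

variable (ℓ) in
/-- The set `TGeo(M)` of `ℓ`-geodesics. -/
def TGeo : Set (LCC ℓ) :=
  {γ | ∀ s t : I, s < t → 0 < ℓ (γ.path s) (γ.path t) ∧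
    ℓ (γ.path s) (γ.path t) = (((t : ℝ) - s : ℝ) : EReal) * ℓ (γ.path 0) (γ.path 1) ∧
    ℓ (γ.path s) (γ.path t) < ⊤}

/-! ### Test plans, weak subslopes, and representation of initial gradients -/

variable [MeasurableSpace M] [BorelSpace M]

/-- Test plans. -/
def IsTestPlan (m : Measure M) (π : Measure (LCC ℓ)) : Prop :=
  IsProbabilityMeasure π ∧ ∃ C : ℝ≥0, 0 < C ∧ ∀ t : I, π.map (eval t) ≤ C • m

/-- Initial test plans; the second condition is narrow convergence `(e_t)_# π → (e_0)_# π`. -/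
def IsInitialTestPlan (m : Measure M) (π : Measure (LCC ℓ)) : Prop :=
  IsProbabilityMeasure π ∧
    (∃ (T : I) (hT : 0 < T), IsTestPlan m (π.map (restr 0 T hT))) ∧
    ∀ φ : M →ᵇ ℝ, Tendsto (fun t : I => ∫ x, φ x ∂(π.map (eval t))) (𝓝[>] 0)
      (𝓝 (∫ x, φ x ∂(π.map (eval 0))))

/-- `π` stays initially in `E`. -/
def StaysInitiallyIn (π : Measure (LCC ℓ)) (E : Set M) : Prop :=
  ∃ T : I, 0 < T ∧ ∀ t : I, t ≤ T → ∀ᵐ x ∂(π.map (eval t)), x ∈ E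

variable (ℓ) in
/-- Weak subslopes of `f`. -/
def IsWeakSubslope (m : Measure M) (f : M → EReal) (G : M → ℝ≥0∞) : Prop :=
  AEMeasurable G m ∧ ∀ π : Measure (LCC ℓ), IsTestPlan m π →
    ∫⁻ γ, ∫⁻ t : I, G (γ.path t) * speed γ t ∂volume ∂π ≤
      ∫⁻ γ, (subConv (f (γ.path 1)) (f (γ.path 0))).toENNReal ∂π

variable (ℓ) in
/-- `G` is a weak subslope of `f` which is `𝔪`-a.e. no smaller than any other weak subslope. -/
def IsMaximalWeakSubslope (m : Measure M) (f : M → EReal) (G : M → ℝ≥0∞) : Prop :=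
  IsWeakSubslope ℓ m f G ∧ ∀ G' : M → ℝ≥0∞, IsWeakSubslope ℓ m f G' → G' ≤ᵐ[m] G

variable (ℓ) in
/-- The maximal weak subslope `|df|`, i.e. a representative of the `𝔪`-a.e. unique maximal element
among the weak subslopes of `f`. -/
def maxWeakSubslope (m : Measure M) (f : M → EReal) : M → ℝ≥0∞ :=
  Classical.epsilon (IsMaximalWeakSubslope ℓ m f)

/-- `(tq)⁻¹ ∬₀ᵗ |γ̇_r|^q dr dπ(γ)`. -/
def scaledAction (π : Measure (LCC ℓ)) (q : ℝ) (t : I) : EReal :=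
  ((((t : ℝ) * q)⁻¹ : ℝ) : EReal) *
    ((∫⁻ γ, ∫⁻ r in Ioo (0 : ℝ) t, speed γ r ^ q ∂volume ∂π : ℝ≥0∞) : EReal)

/-- `∫ (f(γ_t) - f(γ₀)) / t dπ(γ)`; the integrand is nonnegative for causal `f`. -/
def differenceQuotient (π : Measure (LCC ℓ)) (f : M → EReal) (t : I) : EReal :=
  ((∫⁻ γ, (subConv (f (γ.path t)) (f (γ.path 0))).toENNReal / ENNReal.ofReal t ∂π : ℝ≥0∞) : EReal)

/-- The initial test plan `π` represents the initial `p`-gradient of the causal function `f` on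
`E`, where `p⁻¹ + q⁻¹ = 1`. -/
structure RepresentsInitialGradient (m : Measure M) (p q : ℝ) (f : M → EReal) (E : Set M)
    (π : Measure (LCC ℓ)) : Prop where
  staysInitiallyIn : StaysInitiallyIn π E
  integrable : ∫⁻ x in E, maxWeakSubslope ℓ m f x ^ p ∂m < ⊤
  action_lt_top : liminf (scaledAction π q) (𝓝[>] 0) < ⊤
  limsup_le : limsup (differenceQuotient π f) (𝓝[>] 0) ≤
    ((p⁻¹ : ℝ) : EReal) * ((∫⁻ γ, maxWeakSubslope ℓ m f (γ.path 0) ^ p ∂π : ℝ≥0∞) : EReal) +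
      liminf (scaledAction π q) (𝓝[>] 0)

end Paths

end LorentzSobolev

end

open LorentzSobolev

/-!
Write `d = max ℓ 0`, `Λ = ∫ d(γ₀, γ₁) ^ q ∂π`, and let `G = |df|` be the maximal weak subslope. The
two equalities of the theorem come from a cycle of three inequalities at the initial point of
`π`-almost every geodesic `γ`:

`d(γ₀, γ₁) ^ (q - 1) ≤ |∂ᵇf|(γ₀) ≤ G(γ₀) ≤ d(γ₀, γ₁) ^ (q - 1)`.

* The first inequality (`rpow_le_backwardSlope`) is pointwise. If `(x, y)` lies in the
  superdifferential, then `f x - f z ≥ (d(z, y) ^ q - d(x, y) ^ q) / q` for `z ≤ x`; the reverse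
  triangle inequality and the mean value bound for the concave function `s ↦ s ^ q / q` bound the
  difference quotients from below by a power of `d(z, y)`, and upper semicontinuity of `ℓ` on an
  emerald lets `z` tend to `x`.
* The second inequality holds `m`-almost everywhere: the backward slope is Borel
  (`measurable_backwardSlope`) and satisfies the subslope inequality along every causal path, by
  differentiating the monotone function `t ↦ f (γ t)` (`isWeakSubslope_backwardSlope`), so it is
  dominated by the maximal weak subslope. That the latter exists
  (`isMaximalWeakSubslope_maxWeakSubslope`) needs that the class of weak subslopes is closed under
  countable suprema. By restricting a test plan to subsets and its paths to subintervals, the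
  integrated subslope inequality localises to a domination of measures on the real line along almost
  every path; such dominations pass to suprema of densities.
* The third inequality (`ae_mul_tsep_le`) is obtained by testing the localised subslope inequality
  with `π` on `[0, t]`, dividing by `t` and letting `t → 0`. The increment of `f` along a geodesic
  is controlled from above by the superdifferential (`increment_le_of_mem_TGeo`). On the other side
  one needs a Fatou argument for `G(γ_r)` as `r → 0`, which rests on the compression bound and on
  the right-continuity at `0` of `π`-almost every path; this in turn follows from the narrow
  convergence of the initial marginals (`ae_tendsto_path_zero`).

As `(q - 1) p = q`, the equalities give `∫ |df|(γ₀) ^ p ∂π = Λ`, which is finite by the compression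
bound. Along geodesics the speed is constant, so the scaled action equals `Λ / q` for every `t`
(`scaledAction_eq`), and the difference quotients are at most `(1 - t) ^ (q - 1) Λ`
(`differenceQuotient_le`). The representation of the gradient then reduces to `p⁻¹ + q⁻¹ = 1`.
-/

noncomputable section

namespace LorentzSobolev

/-! ### Measurability of left-continuous causal paths -/

section PathMeasurability

variable {M : Type*} [MetricSpace M] {ℓ : M → M → EReal}

/-- The largest point of the grid `(n + 1)⁻¹ ℤ` strictly below `t`, and `0` if `t = 0`. -/
def gridBelow (n : ℕ) (t : I) : I :=
  projIcc 0 1 zero_le_one (((⌈((n : ℝ) + 1) * t⌉₊ - 1 : ℕ) : ℝ) / (n + 1))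

theorem gridBelow_zero (n : ℕ) : gridBelow n 0 = 0 := by
  simp [gridBelow]

theorem coe_gridBelow (n : ℕ) (t : I) :
    (gridBelow n t : ℝ) = ((⌈((n : ℝ) + 1) * t⌉₊ - 1 : ℕ) : ℝ) / (n + 1) := by
  have h1 : ⌈((n : ℝ) + 1) * t⌉₊ ≤ n + 1 := by
    apply Nat.ceil_le.2
    push_cast
    have := t.2.2
    nlinarith [Nat.cast_nonneg (α := ℝ) n]
  have h2 : ((⌈((n : ℝ) + 1) * t⌉₊ - 1 : ℕ) : ℝ) ≤ n + 1 := by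
    exact_mod_cast (Nat.sub_le _ _).trans h1
  unfold gridBelow
  rw [projIcc_of_mem zero_le_one]
  exact ⟨by positivity, div_le_one_of_le₀ h2 (by positivity)⟩

theorem gridBelow_lt (n : ℕ) {t : I} (ht : 0 < t) : gridBelow n t < t := by
  change (gridBelow n t : ℝ) < t
  have ht' : (0 : ℝ) < t := ht
  have hn : (0 : ℝ) < (n : ℝ) + 1 := by positivity
  rw [coe_gridBelow, div_lt_iff₀ hn]
  have h0 : 0 < ⌈((n : ℝ) + 1) * t⌉₊ := Nat.ceil_pos.2 (by positivity)
  have := Nat.ceil_lt_add_one (a := ((n : ℝ) + 1) * t) (by positivity)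
  rw [Nat.cast_sub h0]
  push_cast
  linarith

theorem sub_le_gridBelow (n : ℕ) (t : I) : (t : ℝ) - 1 / (n + 1) ≤ gridBelow n t := by
  have hn : (0 : ℝ) < (n : ℝ) + 1 := by positivity
  rw [coe_gridBelow, le_div_iff₀ hn, sub_mul, div_mul_cancel₀ _ hn.ne']
  have := Nat.le_ceil (((n : ℝ) + 1) * t)
  have h2 : ((⌈((n : ℝ) + 1) * t⌉₊ : ℕ) : ℝ) ≤ ((⌈((n : ℝ) + 1) * t⌉₊ - 1 : ℕ) : ℝ) + 1 := by
    norm_cast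
    omega
  linarith

theorem tendsto_gridBelow {t : I} (ht : 0 < t) :
    Tendsto (fun n => gridBelow n t) atTop (𝓝[<] t) := by
  refine tendsto_nhdsWithin_iff.2 ⟨?_, Eventually.of_forall fun n => gridBelow_lt n ht⟩
  rw [tendsto_subtype_rng]
  refine tendsto_of_tendsto_of_tendsto_of_le_of_le (g := fun n : ℕ => (t : ℝ) - 1 / (n + 1)) ?_
    tendsto_const_nhds (fun n => sub_le_gridBelow n t) (fun n => (gridBelow_lt n ht).le)
  simpa using tendsto_const_nhds.sub (tendsto_one_div_add_atTop_nhds_zero_nat (𝕜 := ℝ))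

theorem tendsto_path_gridBelow (γ : LCC ℓ) (t : I) :
    Tendsto (fun n => γ.path (gridBelow n t)) atTop (𝓝 (γ.path t)) := by
  rcases (unitInterval.nonneg' (t := t)).eq_or_lt with h | h
  · rw [← h]; simp only [gridBelow_zero]; exact tendsto_const_nhds
  · exact (γ.left_cont t h).comp (tendsto_gridBelow h)

/-- The grid point depends on the time only through a natural number. -/
theorem gridBelow_eq (n : ℕ) (t : I) : gridBelow n t =
    (fun j : ℕ => projIcc (0 : ℝ) 1 zero_le_one (((j - 1 : ℕ) : ℝ) / (n + 1)))
      ⌈((n : ℝ) + 1) * t⌉₊ := rfl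

theorem measurable_ceil_grid (n : ℕ) : Measurable fun t : I => ⌈((n : ℝ) + 1) * t⌉₊ :=
  Nat.measurable_ceil.comp (by fun_prop)

variable [MeasurableSpace M] [BorelSpace M]

theorem measurable_path (γ : LCC ℓ) : Measurable γ.path := by
  refine measurable_of_tendsto_metrizable (f := fun n t => γ.path (gridBelow n t)) (fun n => ?_)
    (tendsto_pi_nhds.2 fun t => tendsto_path_gridBelow γ t)
  simp only [gridBelow_eq]
  exact (measurable_from_nat (f := fun j : ℕ => γ.path (projIcc (0 : ℝ) 1 zero_le_one
    (((j - 1 : ℕ) : ℝ) / (n + 1))))).comp (measurable_ceil_grid n)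

/-- The distance of `LCC`, for arbitrary functions on the unit interval. -/
def timeDist (u v : I → M) : ℝ≥0∞ :=
  min (edist (u 0) (v 0)) 1 + ∫⁻ t : I, min (edist (u t) (v t)) 1

omit [MeasurableSpace M] [BorelSpace M] in
theorem timeDist_comm (u v : I → M) : timeDist u v = timeDist v u := by
  simp only [timeDist, edist_comm]

omit [MeasurableSpace M] [BorelSpace M] in
theorem timeDist_self (u : I → M) : timeDist u u = 0 := by
  simp [timeDist]

omit [MeasurableSpace M] [BorelSpace M] in
theorem timeDist_lt_top (u v : I → M) : timeDist u v < ⊤ := by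
  refine ENNReal.add_lt_top.2 ⟨(min_le_right _ _).trans_lt ENNReal.one_lt_top, ?_⟩
  refine (lintegral_mono (g := fun _ => 1) fun t => min_le_right _ _).trans_lt ?_
  simp

omit [MeasurableSpace M] [BorelSpace M] in
theorem min_edist_triangle (x y z : M) :
    min (edist x z) 1 ≤ min (edist x y) 1 + min (edist y z) 1 := by
  rcases le_total (edist x y) 1 with h1 | h1
  · rcases le_total (edist y z) 1 with h2 | h2
    · rw [min_eq_left h1, min_eq_left h2]
      exact (min_le_left _ _).trans (edist_triangle _ _ _)
    · rw [min_eq_right h2]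
      exact (min_le_right _ _).trans le_add_self
  · rw [min_eq_right h1]
    exact (min_le_right _ _).trans le_self_add

variable [SecondCountableTopology M]

theorem timeDist_triangle {u v w : I → M} (hu : Measurable u) (hv : Measurable v) :
    timeDist u w ≤ timeDist u v + timeDist v w := by
  unfold timeDist
  rw [add_add_add_comm, ← lintegral_add_left ((hu.edist hv).min measurable_const)]
  exact add_le_add (min_edist_triangle _ _ _) (lintegral_mono fun t => min_edist_triangle _ _ _)

theorem exists_ball_subset_of_isOpen {V : Set (LCC ℓ)} (hV : IsOpen V)
    {γ : LCC ℓ} (hγ : γ ∈ V) : ∃ ε > 0, ∀ η : LCC ℓ, pathDist γ η < ε → η ∈ V := by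
  induction hV with
  | basic s hs =>
    obtain ⟨ζ, r, rfl⟩ := hs
    refine ⟨r - pathDist ζ γ, tsub_pos_of_lt hγ, fun η hη => ?_⟩
    have h1 : pathDist ζ η ≤ pathDist ζ γ + pathDist γ η :=
      timeDist_triangle (measurable_path ζ) (measurable_path γ)
    refine h1.trans_lt ?_
    exact lt_tsub_iff_left.1 hη
  | univ => exact ⟨1, one_pos, fun _ _ => mem_univ _⟩
  | inter s t _ _ ihs iht =>
    obtain ⟨ε, hε, h1⟩ := ihs hγ.1
    obtain ⟨δ, hδ, h2⟩ := iht hγ.2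
    exact ⟨min ε δ, lt_min hε hδ, fun η hη =>
      ⟨h1 η (hη.trans_le (min_le_left _ _)), h2 η (hη.trans_le (min_le_right _ _))⟩⟩
  | sUnion S _ ih =>
    obtain ⟨s, hs, hγs⟩ := hγ
    obtain ⟨ε, hε, h1⟩ := ih s hs hγs
    exact ⟨ε, hε, fun η hη => ⟨s, hs, h1 η hη⟩⟩

omit [MeasurableSpace M] [BorelSpace M] [SecondCountableTopology M] in
theorem isOpen_pathDist_lt (γ : LCC ℓ) (r : ℝ≥0∞) : IsOpen {η : LCC ℓ | pathDist γ η < r} :=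
  TopologicalSpace.isOpen_generateFrom_of_mem ⟨γ, r, rfl⟩

theorem isOpen_timeDist_lt {u : I → M} (hu : Measurable u) (r : ℝ≥0∞) :
    IsOpen {η : LCC ℓ | timeDist u η.path < r} := by
  refine isOpen_iff_forall_mem_open.2 fun η hη => ?_
  refine ⟨{ξ | pathDist η ξ < r - timeDist u η.path}, fun ξ hξ => ?_, isOpen_pathDist_lt _ _, ?_⟩
  · have h1 : timeDist u ξ.path ≤ timeDist u η.path + pathDist η ξ :=
      timeDist_triangle hu (measurable_path η)
    refine h1.trans_lt ?_
    exact lt_tsub_iff_left.1 hξ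
  · change timeDist η.path η.path < _
    rw [timeDist_self]
    exact tsub_pos_of_lt hη

/-- Step functions with respect to the grid `(n + 1)⁻¹ ℤ`, with values `x (a 0), x (a 1), …`. -/
def stepPath (x : ℕ → M) (n : ℕ) (a : List ℕ) (t : I) : M :=
  x (a.getD ⌈((n : ℝ) + 1) * t⌉₊ 0)

omit [MetricSpace M] [BorelSpace M] [SecondCountableTopology M] in
theorem measurable_stepPath (x : ℕ → M) (n : ℕ) (a : List ℕ) : Measurable (stepPath x n a) :=
  (measurable_from_nat (f := fun j : ℕ => x (a.getD j 0))).comp (measurable_ceil_grid n)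

/-- Every path is approximated by step functions with values in a given dense sequence. -/
theorem exists_stepPath_timeDist_lt {x : ℕ → M} (hx : DenseRange x)
    (γ : LCC ℓ) {ε : ℝ≥0∞} (hε : 0 < ε) :
    ∃ n a, timeDist (stepPath x n a) γ.path < ε := by
  have h1 : Tendsto (fun n => ∫⁻ t : I, min (edist (γ.path (gridBelow n t)) (γ.path t)) 1) atTop
      (𝓝 (∫⁻ _ : I, 0)) := by
    refine tendsto_lintegral_of_dominated_convergence (fun _ => 1) (fun n => ?_) (fun n => ?_)
      (by simp) (Eventually.of_forall fun t => ?_)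
    · refine Measurable.min (Measurable.edist ?_ (measurable_path γ)) measurable_const
      simp only [gridBelow_eq]
      exact (measurable_from_nat (f := fun j : ℕ => γ.path (projIcc (0 : ℝ) 1 zero_le_one
        (((j - 1 : ℕ) : ℝ) / (n + 1))))).comp (measurable_ceil_grid n)
    · exact Eventually.of_forall fun t => min_le_right _ _
    · have := (tendsto_iff_edist_tendsto_0.1 (tendsto_path_gridBelow γ t))
      simpa using this.min (tendsto_const_nhds (x := (1 : ℝ≥0∞)))
  rw [lintegral_zero] at h1
  have hε3 : 0 < ε / 3 := ENNReal.div_pos hε.ne' (by norm_num)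
  obtain ⟨n, hn⟩ := (h1.eventually (gt_mem_nhds hε3)).exists
  have hc : ∀ k : ℕ, ∃ i, edist (γ.path (projIcc (0 : ℝ) 1 zero_le_one
      (((k - 1 : ℕ) : ℝ) / (n + 1)))) (x i) < ε / 3 := fun k => by
    obtain ⟨y, hy, hyε⟩ := EMetric.mem_closure_iff.1 (hx (γ.path (projIcc (0 : ℝ) 1 zero_le_one
      (((k - 1 : ℕ) : ℝ) / (n + 1))))) (ε / 3) hε3
    obtain ⟨i, rfl⟩ := hy
    exact ⟨i, hyε⟩
  choose i hi using hc
  set a : List ℕ := (List.range (n + 2)).map i with ha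
  have hget : ∀ t : I, a.getD ⌈((n : ℝ) + 1) * t⌉₊ 0 = i ⌈((n : ℝ) + 1) * t⌉₊ := fun t => by
    have h1 : ⌈((n : ℝ) + 1) * t⌉₊ < n + 2 := by
      refine Nat.lt_succ_of_le (Nat.ceil_le.2 ?_)
      push_cast
      have := t.2.2
      nlinarith [Nat.cast_nonneg (α := ℝ) n]
    simp [ha, h1]
  have hstep : ∀ t : I, edist (stepPath x n a t) (γ.path (gridBelow n t)) < ε / 3 := fun t => by
    rw [stepPath, hget, edist_comm]
    exact hi _
  refine ⟨n, a, ?_⟩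
  have h2 : timeDist (stepPath x n a) γ.path ≤ timeDist (stepPath x n a)
      (fun t => γ.path (gridBelow n t)) + timeDist (fun t => γ.path (gridBelow n t)) γ.path := by
    refine timeDist_triangle (measurable_stepPath x n a) ?_
    simp only [gridBelow_eq]
    exact (measurable_from_nat (f := fun j : ℕ => γ.path (projIcc (0 : ℝ) 1 zero_le_one
      (((j - 1 : ℕ) : ℝ) / (n + 1))))).comp (measurable_ceil_grid n)
  have h3 : timeDist (stepPath x n a) (fun t => γ.path (gridBelow n t)) ≤ ε / 3 + ε / 3 := by
    refine add_le_add ((min_le_left _ _).trans (hstep 0).le) ?_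
    refine (lintegral_mono (g := fun _ => ε / 3)
      fun t => (min_le_left _ _).trans (hstep t).le).trans ?_
    simp
  have h4 : timeDist (fun t => γ.path (gridBelow n t)) γ.path < ε / 3 := by
    simpa [timeDist, gridBelow_zero] using hn
  by_cases hεt : ε = ⊤
  · rw [hεt]; exact timeDist_lt_top _ _
  calc timeDist (stepPath x n a) γ.path ≤ _ := h2
    _ < (ε / 3 + ε / 3) + ε / 3 :=
        ENNReal.add_lt_add_of_le_of_lt (h3.trans_lt (ENNReal.add_lt_top.2
          ⟨ENNReal.div_lt_top hεt (by norm_num), ENNReal.div_lt_top hεt (by norm_num)⟩)).ne h3 h4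
    _ = ε := ENNReal.add_thirds ε

/-- The `D`-balls around countably many step functions form a basis of the topology of `LCC`, so
measurability of a map into `LCC` can be tested on the distances to measurable functions. -/
theorem measurable_lcc_of_timeDist {X : Type*} [MeasurableSpace X] {T : X → LCC ℓ}
    (hT : ∀ u : I → M, Measurable u → Measurable fun x => timeDist u (T x).path) :
    Measurable T := by
  rcases isEmpty_or_nonempty M with hM | hM
  · have : IsEmpty X := ⟨fun x => hM.false ((T x).path 0)⟩
    exact measurable_of_empty T
  set x := TopologicalSpace.denseSeq M
  have hx : DenseRange x := TopologicalSpace.denseRange_denseSeq M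
  let B : (ℕ × List ℕ) × ℕ → Set (LCC ℓ) := fun i =>
    {η | timeDist (stepPath x i.1.1 i.1.2) η.path < ((i.2 : ℝ≥0∞) + 1)⁻¹}
  have hbasis : TopologicalSpace.IsTopologicalBasis (range B) := by
    refine TopologicalSpace.isTopologicalBasis_of_isOpen_of_nhds ?_ ?_
    · rintro _ ⟨i, rfl⟩
      exact isOpen_timeDist_lt (measurable_stepPath _ _ _) _
    · intro γ V hγ hV
      obtain ⟨ε, hε, hball⟩ := exists_ball_subset_of_isOpen hV hγ
      obtain ⟨k, hk⟩ := ENNReal.exists_inv_nat_lt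
        (ENNReal.div_pos hε.ne' (by norm_num : (2 : ℝ≥0∞) ≠ ⊤)).ne'
      have hk' : ((k : ℝ≥0∞) + 1)⁻¹ < ε / 2 :=
        (ENNReal.inv_le_inv.2 le_self_add).trans_lt hk
      have hpos : (0 : ℝ≥0∞) < ((k : ℝ≥0∞) + 1)⁻¹ := by simp
      obtain ⟨n, a, hna⟩ := exists_stepPath_timeDist_lt hx γ hpos
      refine ⟨_, ⟨((n, a), k), rfl⟩, hna, fun η hη => hball η ?_⟩
      have h1 : timeDist γ.path η.path ≤ timeDist γ.path (stepPath x n a) +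
        timeDist (stepPath x n a) η.path :=
          timeDist_triangle (measurable_path γ) (measurable_stepPath _ _ _)
      rw [timeDist_comm γ.path (stepPath x n a)] at h1
      calc pathDist γ η ≤ _ := h1
        _ < ε / 2 + ε / 2 := ENNReal.add_lt_add (hna.trans hk') (lt_trans hη hk')
        _ = ε := ENNReal.add_halves ε
  have : SecondCountableTopology (LCC ℓ) := hbasis.secondCountableTopology (countable_range B)
  have hgen : borel (LCC ℓ) = MeasurableSpace.generateFrom (range B) :=
    hbasis.borel_eq_generateFrom
  change @Measurable _ _ _ (borel (LCC ℓ)) T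
  rw [hgen]
  refine measurable_generateFrom ?_
  rintro _ ⟨i, rfl⟩
  exact measurableSet_lt (hT _ (measurable_stepPath _ _ _)) measurable_const

end PathMeasurability

/-! ### Evaluation maps -/

section Evaluation

variable {M : Type*} [MetricSpace M] {ℓ : M → M → EReal}

/-- The truncated distance to the complement of `U`, which is `1`-Lipschitz. -/
def depth (U : Set M) (y : M) : ℝ≥0∞ := min (Metric.infEDist y Uᶜ) 1

theorem depth_le (U : Set M) (y z : M) : depth U y ≤ depth U z + min (edist z y) 1 := by
  have h : Metric.infEDist y Uᶜ ≤ Metric.infEDist z Uᶜ + edist z y := by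
    rw [edist_comm]
    exact Metric.infEDist_le_infEDist_add_edist
  unfold depth
  rcases le_total (Metric.infEDist z Uᶜ) 1 with h1 | h1
  · rcases le_total (edist z y) 1 with h2 | h2
    · rw [min_eq_left h1, min_eq_left h2]
      exact (min_le_left _ _).trans h
    · rw [min_eq_right h2]
      exact (min_le_right _ _).trans le_add_self
  · rw [min_eq_right h1]
    exact (min_le_right _ _).trans le_self_add

theorem continuous_depth (U : Set M) : Continuous (depth U) :=
  Metric.continuous_infEDist.min continuous_const

theorem depth_pos_iff {U : Set M} (hU : IsOpen U) {y : M} : 0 < depth U y ↔ y ∈ U := by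
  rw [depth, lt_min_iff, Metric.infEDist_pos_iff_notMem_closure, hU.isClosed_compl.closure_eq]
  simp

variable [MeasurableSpace M] [BorelSpace M] [SecondCountableTopology M]

omit [SecondCountableTopology M] in
theorem isOpen_lt_lintegral_depth (U : Set M) (S : Set I) (c : ℝ≥0∞) :
    IsOpen {γ : LCC ℓ | c < ∫⁻ s in S, depth U (γ.path s)} := by
  refine isOpen_iff_forall_mem_open.2 fun γ hγ => ?_
  refine ⟨{η | pathDist γ η < (∫⁻ s in S, depth U (γ.path s)) - c}, fun η hη => ?_,
    isOpen_pathDist_lt _ _, ?_⟩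
  · have h1 : ∫⁻ s in S, depth U (γ.path s) ≤
        (∫⁻ s in S, depth U (η.path s)) + pathDist γ η := by
      calc ∫⁻ s in S, depth U (γ.path s)
          ≤ ∫⁻ s in S, (depth U (η.path s) + min (edist (γ.path s) (η.path s)) 1) :=
            lintegral_mono fun s => by rw [edist_comm]; exact depth_le U _ _
        _ = (∫⁻ s in S, depth U (η.path s)) +
              ∫⁻ s in S, min (edist (γ.path s) (η.path s)) 1 :=
            lintegral_add_left ((continuous_depth U).measurable.comp (measurable_path η)) _
        _ ≤ _ := by
            gcongr
            exact (setLIntegral_le_lintegral _ _).trans le_add_self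
    by_contra hcon
    have h2 : ∫⁻ s in S, depth U (η.path s) ≤ c := not_lt.1 hcon
    have h3 : pathDist γ η + c < ∫⁻ s in S, depth U (γ.path s) := lt_tsub_iff_right.1 hη
    exact absurd (h1.trans (add_le_add_left h2 _)) (not_le.2 (by rwa [add_comm] at h3))
  · change timeDist γ.path γ.path < _
    rw [timeDist_self]
    exact tsub_pos_of_lt hγ

omit [SecondCountableTopology M] [MeasurableSpace M] [BorelSpace M] in
/-- By left-continuity, a statement on `γ_t` that is open can be read off from averages of the
path over short intervals to the left of `t`. -/
theorem path_mem_iff_lintegral_depth {U : Set M} (hU : IsOpen U) {t : I} (ht : 0 < t)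
    (γ : LCC ℓ) : γ.path t ∈ U ↔ ∃ k : ℕ, ∀ N ≥ k, ((k : ℝ≥0∞) + 1)⁻¹ *
      volume (Ioo (gridBelow N t) t) ≤ ∫⁻ s in Ioo (gridBelow N t) t, depth U (γ.path s) := by
  have hlim : Tendsto (fun s => depth U (γ.path s)) (𝓝[<] t) (𝓝 (depth U (γ.path t))) :=
    ((continuous_depth U).tendsto _).comp (γ.left_cont t ht)
  have hev : ∀ {P : I → Prop}, (∀ᶠ s in 𝓝[<] t, P s) →
      ∀ᶠ N in atTop, ∀ s ∈ Ioo (gridBelow N t) t, P s := fun {P} hP => by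
    obtain ⟨a, ha, hPa⟩ := (mem_nhdsLT_iff_exists_Ioo_subset' ht).1 hP
    filter_upwards [(tendsto_gridBelow ht).eventually (Ioo_mem_nhdsLT ha)] with N hN s hs
    exact hPa ⟨hN.1.trans hs.1, hs.2⟩
  have hvol : ∀ N, volume (Ioo (gridBelow N t) t) ≠ 0 := fun N => by
    rw [unitInterval.volume_Ioo]
    have : (gridBelow N t : ℝ) < t := gridBelow_lt N ht
    simpa using this
  constructor
  · intro h
    have hpos := (depth_pos_iff hU).2 h
    obtain ⟨k, hk⟩ := ENNReal.exists_inv_nat_lt hpos.ne'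
    obtain ⟨N₀, hN₀⟩ := eventually_atTop.1 (hev (hlim.eventually (lt_mem_nhds hk)))
    refine ⟨max k N₀, fun N hN => ?_⟩
    rw [← setLIntegral_const]
    refine setLIntegral_mono_ae' measurableSet_Ioo (Eventually.of_forall fun s hs => ?_)
    refine le_trans ?_ (hN₀ N ((le_max_right _ _).trans hN) s hs).le
    refine ENNReal.inv_le_inv.2 (le_trans ?_ le_self_add)
    exact_mod_cast le_max_left _ _
  · rintro ⟨k, hk⟩
    by_contra hmem
    have h0 : depth U (γ.path t) = 0 := by
      by_contra h0
      exact hmem ((depth_pos_iff hU).1 (pos_iff_ne_zero.2 h0))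
    rw [h0] at hlim
    have hε : (0 : ℝ≥0∞) < ((k : ℝ≥0∞) + 1)⁻¹ / 2 := ENNReal.div_pos (by simp) (by norm_num)
    obtain ⟨N, hN, hkN⟩ :=
      ((hev (hlim.eventually (gt_mem_nhds hε))).and (eventually_ge_atTop k)).exists
    have h1 := hk N hkN
    have h2 : ∫⁻ s in Ioo (gridBelow N t) t, depth U (γ.path s) ≤
        ((k : ℝ≥0∞) + 1)⁻¹ / 2 * volume (Ioo (gridBelow N t) t) := by
      rw [← setLIntegral_const]
      exact setLIntegral_mono_ae' measurableSet_Ioo (Eventually.of_forall fun s hs => (hN s hs).le)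
    have h3 := (ENNReal.mul_le_mul_iff_left (hvol N) (measure_ne_top _ _)).1 (h1.trans h2)
    exact absurd h3 (not_le.2 (ENNReal.half_lt_self (by simp) (by simp)))

omit [SecondCountableTopology M] in
/-- Evaluation at `0` is continuous as `D` contains the distance of initial points. Evaluation at
`t > 0` is only Borel: it is recovered from averages over intervals to the left of `t`. -/
theorem measurable_eval (t : I) : Measurable (eval t : LCC ℓ → M) := by
  refine measurable_of_isOpen fun U hU => ?_
  rcases (unitInterval.nonneg' (t := t)).eq_or_lt with h | h
  · rw [← h]
    refine IsOpen.measurableSet (isOpen_iff_forall_mem_open.2 fun γ hγ => ?_)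
    refine ⟨{η | pathDist γ η < depth U (γ.path 0)}, fun η hη => ?_, isOpen_pathDist_lt _ _, ?_⟩
    · refine (depth_pos_iff hU).1 (pos_iff_ne_zero.2 fun h0 => ?_)
      have h1 := depth_le U (γ.path 0) (η.path 0)
      rw [show depth U (η.path 0) = 0 from h0, zero_add, edist_comm] at h1
      exact absurd (h1.trans le_self_add) (not_le.2 hη)
    · change timeDist γ.path γ.path < _
      rw [timeDist_self]
      exact (depth_pos_iff hU).2 hγ
  · have : (eval t : LCC ℓ → M) ⁻¹' U = ⋃ k : ℕ, ⋂ N ≥ k, {γ : LCC ℓ | ((k : ℝ≥0∞) + 1)⁻¹ *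
        volume (Ioo (gridBelow N t) t) ≤ ∫⁻ s in Ioo (gridBelow N t) t, depth U (γ.path s)} := by
      ext γ
      simpa [eval] using path_mem_iff_lintegral_depth hU h γ
    rw [this]
    refine MeasurableSet.iUnion fun k => MeasurableSet.biInter (to_countable _) fun N _ => ?_
    refine measurableSet_le measurable_const (measurable_of_Ioi fun c => ?_)
    exact (isOpen_lt_lintegral_depth U _ c).measurableSet

omit [SecondCountableTopology M] in
theorem measurable_path_apply (t : I) : Measurable fun γ : LCC ℓ => γ.path t := measurable_eval t

omit [SecondCountableTopology M] in
theorem measurable_uncurry_path : Measurable fun z : LCC ℓ × I => z.1.path z.2 := by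
  refine measurable_of_tendsto_metrizable (f := fun n z => z.1.path (gridBelow n z.2))
    (fun n => ?_) (tendsto_pi_nhds.2 fun z => tendsto_path_gridBelow z.1 z.2)
  simp only [gridBelow_eq]
  have h : Measurable fun z : LCC ℓ × ℕ => z.1.path (projIcc (0 : ℝ) 1 zero_le_one
      (((z.2 - 1 : ℕ) : ℝ) / (n + 1))) :=
    measurable_from_prod_countable_left fun j => measurable_path_apply
      (projIcc (0 : ℝ) 1 zero_le_one (((j - 1 : ℕ) : ℝ) / (n + 1)))
  exact h.comp (measurable_fst.prodMk ((measurable_ceil_grid n).comp measurable_snd))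

theorem measurable_restr (s t : I) (hst : s < t) : Measurable (restr (ℓ := ℓ) s t hst) := by
  refine measurable_lcc_of_timeDist fun u hu => ?_
  refine Measurable.add ?_ ?_
  · exact (measurable_const.edist (measurable_path_apply _)).min measurable_const
  · refine Measurable.lintegral_prod_right'
      (f := fun z : LCC ℓ × I => min (edist (u z.2) (z.1.path (lineParam s t z.2))) 1) ?_
    refine Measurable.min (Measurable.edist (hu.comp measurable_snd) ?_) measurable_const
    exact measurable_uncurry_path.comp (measurable_fst.prodMk
      ((continuous_lineParam s t).measurable.comp measurable_snd))

/-- The path with time parameter in `ℝ`, constant outside of the unit interval. -/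
def LCC.ext (γ : LCC ℓ) (t : ℝ) : M := γ.path (projIcc 0 1 zero_le_one t)

omit [SecondCountableTopology M] [MeasurableSpace M] [BorelSpace M] in
theorem LCC.ext_coe (γ : LCC ℓ) (t : I) : γ.ext t = γ.path t := by
  simp [LCC.ext]

omit [SecondCountableTopology M] in
theorem measurable_uncurry_ext : Measurable fun z : LCC ℓ × ℝ => z.1.ext z.2 :=
  measurable_uncurry_path.comp
    (measurable_fst.prodMk ((continuous_projIcc (h := zero_le_one)).measurable.comp
      measurable_snd))

omit [SecondCountableTopology M] in
theorem measurable_ext (γ : LCC ℓ) : Measurable γ.ext :=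
  (measurable_path γ).comp continuous_projIcc.measurable

omit [SecondCountableTopology M] [MeasurableSpace M] [BorelSpace M] in
theorem LCC.causal_ext (γ : LCC ℓ) {s t : ℝ} (h : s ≤ t) : Causal ℓ (γ.ext s) (γ.ext t) :=
  γ.causal _ _ (monotone_projIcc _ h)

end Evaluation

/-- Integration over the unit interval, as a subtype and as a subset of the real line. -/
theorem lintegral_unitInterval (g : ℝ → ℝ≥0∞) :
    ∫⁻ t : I, g t = ∫⁻ t in Ioo (0 : ℝ) 1, g t := by
  have h := lintegral_subtype_comap (μ := volume) (measurableSet_Icc (a := (0 : ℝ)) (b := 1)) g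
  rw [restrict_Ioo_eq_restrict_Icc]
  exact h

theorem lintegral_path_mul_speed {M : Type*} [MetricSpace M] {ℓ : M → M → EReal} (G : M → ℝ≥0∞)
    (γ : LCC ℓ) : ∫⁻ t : I, G (γ.path t) * speed γ t =
      ∫⁻ t in Ioo (0 : ℝ) 1, G (γ.ext t) * speed γ t := by
  rw [← lintegral_unitInterval fun t => G (γ.ext t) * speed γ t]
  simp only [LCC.ext_coe]

/-! ### Monotone functions and densities of measures on the real line -/

section RealLine

/-- A measure whose values on open intervals are bounded by the increments of a monotone function
is dominated by the Stieltjes measure of this function. -/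
theorem le_stieltjes_measure {F : ℝ → ℝ} (hF : Monotone F) {ν : Measure ℝ}
    (h : ∀ a b, a < b → ν (Ioo a b) ≤ ENNReal.ofReal (F b - F a)) :
    ν ≤ hF.stieltjesFunction.measure := by
  set g := hF.stieltjesFunction
  have hIoc : ∀ a b, a < b → ν (Ioc a b) ≤ ENNReal.ofReal (g b - g a) := by
    intro a b hab
    obtain ⟨u, hu_anti, hu_mem, hu_lim⟩ := exists_seq_strictAnti_tendsto' hab
    have hU : Ioc a b = ⋃ n, Ioc (u n) b := by
      ext x
      simp only [mem_Ioc, mem_iUnion]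
      constructor
      · rintro ⟨h1, h2⟩
        obtain ⟨n, hn⟩ := (hu_lim.eventually (gt_mem_nhds h1)).exists
        exact ⟨n, hn, h2⟩
      · rintro ⟨n, h1, h2⟩
        exact ⟨(hu_mem n).1.trans h1, h2⟩
    have hmono : Monotone fun n => Ioc (u n) b :=
      fun i j hij => Ioc_subset_Ioc_left (hu_anti.antitone hij)
    rw [hU, hmono.measure_iUnion]
    refine iSup_le fun n => ?_
    have hlim : Tendsto (fun c => ENNReal.ofReal (F c - g a)) (𝓝[>] b)
        (𝓝 (ENNReal.ofReal (g b - g a))) :=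
      (ENNReal.continuous_ofReal.tendsto _).comp ((hF.tendsto_rightLim b).sub_const _)
    refine ge_of_tendsto hlim ?_
    filter_upwards [self_mem_nhdsWithin] with c hc
    have hc' : b < c := hc
    have hsub : Ioc (u n) b ⊆ Ioo (u n) c := fun x hx => ⟨hx.1, hx.2.trans_lt hc'⟩
    refine (measure_mono hsub).trans ((h _ _ ((hu_mem n).2.trans hc')).trans ?_)
    exact ENNReal.ofReal_le_ofReal (sub_le_sub_left (hF.rightLim_le (hu_mem n).1) _)
  have hout : ν.toOuterMeasure ≤ g.outer := by
    refine OuterMeasure.le_ofFunction.2 fun s => ?_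
    rw [StieltjesFunction.length_eq]
    refine le_iInf fun a => le_iInf fun b => le_iInf fun hs => ?_
    have hs' : s ⊆ Ioc a b := by
      intro x hx
      refine hs ⟨hx, fun hbot => ?_⟩
      exact absurd (hbot (x - 1)) (by linarith)
    refine (measure_mono hs').trans ?_
    rcases lt_or_ge a b with hab | hab
    · exact hIoc a b hab
    · simp [Ioc_eq_empty_of_le hab]
  refine Measure.le_iff.2 fun s _ => ?_
  rw [StieltjesFunction.measure]
  exact hout s

/-- A monotone function has a derivative almost everywhere, and the integral of the derivative is
at most the increment. -/
theorem exists_ae_hasDerivAt_of_monotone {F : ℝ → ℝ} (hF : Monotone F) :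
    ∃ r : ℝ → ℝ≥0∞, Measurable r ∧
      (∀ᵐ x, r x < ⊤ ∧ HasDerivAt F (r x).toReal x) ∧
      ∀ a b, a < b → ∫⁻ x in Ioo a b, r x ≤ ENNReal.ofReal (F b - F a) := by
  set g := hF.stieltjesFunction
  refine ⟨g.measure.rnDeriv volume, Measure.measurable_rnDeriv _ _, ?_, fun a b hab => ?_⟩
  · filter_upwards [hF.ae_hasDerivAt, Measure.rnDeriv_lt_top g.measure volume] with x h1 h2
    exact ⟨h2, h1⟩
  · refine (Measure.setLIntegral_rnDeriv_le _).trans ?_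
    rw [StieltjesFunction.measure_Ioo]
    refine ENNReal.ofReal_le_ofReal (sub_le_sub ?_ (hF.le_rightLim le_rfl))
    refine le_of_tendsto (g.mono.tendsto_leftLim b) ?_
    filter_upwards [self_mem_nhdsWithin] with y hy
    exact hF.rightLim_le hy

/-- The Radon-Nikodym derivative is the largest density of a dominated absolutely continuous
measure. -/
theorem ae_le_rnDeriv_of_withDensity_le {μ : Measure ℝ} [SigmaFinite μ] {k : ℝ → ℝ≥0∞}
    (hk : Measurable k) (h : volume.withDensity k ≤ μ) : k ≤ᵐ[volume] μ.rnDeriv volume := by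
  refine ae_le_of_forall_setLIntegral_le_of_sigmaFinite hk fun s hs _ => ?_
  obtain ⟨N, hN, h1, h2⟩ := μ.mutuallySingular_singularPart (volume : Measure ℝ)
  have h3 : (volume : Measure ℝ).withDensity k Nᶜ = 0 :=
    withDensity_absolutelyContinuous _ _ h2
  calc ∫⁻ x in s, k x = volume.withDensity k s := (withDensity_apply _ hs).symm
    _ ≤ volume.withDensity k (s ∩ N) := by
        rw [← measure_inter_add_sdiff s hN]
        have : volume.withDensity k (s \ N) = 0 :=
          measure_mono_null (fun x hx => hx.2) h3
        rw [this, add_zero]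
    _ ≤ μ (s ∩ N) := h _
    _ = ∫⁻ x in s ∩ N, μ.rnDeriv volume x := by
        conv_lhs => rw [Measure.haveLebesgueDecomposition_add μ volume]
        rw [Measure.add_apply, measure_mono_null inter_subset_right h1, zero_add,
          withDensity_apply _ (hs.inter hN)]
    _ ≤ ∫⁻ x in s, μ.rnDeriv volume x := lintegral_mono_set inter_subset_left

theorem rnDeriv_ae_le_of_le_add {μ s : Measure ℝ} {k : ℝ → ℝ≥0∞} (hs : s ⟂ₘ volume)
    (h : μ ≤ volume.withDensity k + s) : μ.rnDeriv volume ≤ᵐ[volume] k := by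
  refine ae_le_of_forall_setLIntegral_le_of_sigmaFinite (Measure.measurable_rnDeriv _ _)
    fun A hA _ => ?_
  obtain ⟨N, hN, h1, h2⟩ := hs
  calc ∫⁻ x in A, μ.rnDeriv volume x = volume.withDensity (μ.rnDeriv volume) A :=
        (withDensity_apply _ hA).symm
    _ ≤ volume.withDensity (μ.rnDeriv volume) (A ∩ N) := by
        rw [← measure_inter_add_sdiff A hN]
        have : volume.withDensity (μ.rnDeriv volume) (A \ N) = 0 :=
          measure_mono_null (fun x hx => hx.2) (withDensity_absolutelyContinuous _ _ h2)
        rw [this, add_zero]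
    _ ≤ μ (A ∩ N) := Measure.withDensity_rnDeriv_le _ _ _
    _ ≤ volume.withDensity k (A ∩ N) + s (A ∩ N) := h _
    _ = ∫⁻ x in A ∩ N, k x := by
        rw [measure_mono_null inter_subset_right h1, add_zero, withDensity_apply _ (hA.inter hN)]
    _ ≤ ∫⁻ x in A, k x := lintegral_mono_set inter_subset_left

theorem singularPart_mono {ν μ : Measure ℝ} [SigmaFinite μ] (h : ν ≤ μ) :
    ν.singularPart volume ≤ μ.singularPart volume := by
  refine Measure.le_iff.2 fun A hA => ?_
  obtain ⟨N, hN, h1, h2⟩ := ν.mutuallySingular_singularPart (volume : Measure ℝ)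
  calc ν.singularPart volume A ≤ ν.singularPart volume (A ∩ Nᶜ) := by
        rw [← measure_inter_add_sdiff A hN, measure_mono_null inter_subset_right h1, zero_add]
        exact le_rfl
    _ ≤ ν (A ∩ Nᶜ) := Measure.singularPart_le _ _ _
    _ ≤ μ (A ∩ Nᶜ) := h _
    _ = μ.singularPart volume (A ∩ Nᶜ) := by
        conv_lhs => rw [Measure.haveLebesgueDecomposition_add μ volume]
        have : volume.withDensity (μ.rnDeriv volume) (A ∩ Nᶜ) = 0 :=
          measure_mono_null inter_subset_right (withDensity_absolutelyContinuous _ _ h2)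
        rw [Measure.add_apply, this, add_zero]
    _ ≤ μ.singularPart volume A := measure_mono inter_subset_left

/-! ### The metric derivative of a superadditive interval function -/

/-- The lower right derivative of an interval function along the sequence `1 / (n + 1)`. -/
def intervalDeriv (D : ℝ → ℝ → ℝ≥0∞) (t : ℝ) : ℝ≥0∞ :=
  liminf (fun n : ℕ => ((n : ℝ≥0∞) + 1) * D t (t + 1 / (n + 1))) atTop

/-- Derivatives can be computed along the step sizes `1 / (n + 1)` used in `intervalDeriv`. -/
theorem tendsto_mul_sub_of_hasDerivAt {F : ℝ → ℝ} {c t : ℝ} (h : HasDerivAt F c t) :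
    Tendsto (fun n : ℕ => ENNReal.ofReal (((n : ℝ) + 1) * (F (t + 1 / (n + 1)) - F t))) atTop
      (𝓝 (ENNReal.ofReal c)) := by
  refine (ENNReal.continuous_ofReal.tendsto _).comp ?_
  have h1 : Tendsto (fun n : ℕ => (1 : ℝ) / (n + 1)) atTop (𝓝[≠] 0) :=
    tendsto_nhdsWithin_iff.2 ⟨tendsto_one_div_add_atTop_nhds_zero_nat,
      Eventually.of_forall fun n => (by positivity : (1 : ℝ) / (n + 1) ≠ 0)⟩
  refine ((hasDerivAt_iff_tendsto_slope_zero.1 h).comp h1).congr fun n => ?_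
  simp

variable {D : ℝ → ℝ → ℝ≥0∞}

/-- The derivative of a superadditive interval function is at most the derivative of the monotone
function `t ↦ D a t`, which integrates to at most the increment of the latter. -/
theorem setLIntegral_intervalDeriv_le (hfin : ∀ a b, D a b ≠ ⊤)
    (hadd : ∀ a b c, a ≤ b → b ≤ c → D a b + D b c ≤ D a c) {a b : ℝ} (hab : a ≤ b) :
    ∫⁻ t in Ioo a b, intervalDeriv D t ≤ D a b := by
  rcases hab.eq_or_lt with rfl | hab
  · simp
  -- Clipping at `a` makes the function monotone on the whole line.
  set F : ℝ → ℝ := fun t => (D a (max a t)).toReal with hFdef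
  have hinc : ∀ s t, a ≤ s → s ≤ t → (D s t).toReal ≤ F t - F s := fun s t hs hst => by
    have h := ENNReal.toReal_mono (hfin _ _) (hadd a s t hs hst)
    rw [ENNReal.toReal_add (hfin _ _) (hfin _ _)] at h
    simp only [hFdef, max_eq_right hs, max_eq_right (hs.trans hst)]
    linarith
  have hF : Monotone F := fun s t hst => by
    have h := hinc (max a s) (max a t) (le_max_left _ _) (max_le_max_left a hst)
    simp only [hFdef, max_eq_right (le_max_left a _)] at h ⊢
    linarith [ENNReal.toReal_nonneg (a := D (max a s) (max a t))]
  obtain ⟨r, -, hr, hr_int⟩ := exists_ae_hasDerivAt_of_monotone hF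
  have hle : ∫⁻ t in Ioo a b, intervalDeriv D t ≤ ∫⁻ t in Ioo a b, r t := by
    refine lintegral_mono_ae ?_
    filter_upwards [ae_restrict_of_ae hr, ae_restrict_mem measurableSet_Ioo] with t ht hmem
    have hlim := tendsto_mul_sub_of_hasDerivAt ht.2
    rw [ENNReal.ofReal_toReal ht.1.ne] at hlim
    rw [← hlim.liminf_eq]
    refine liminf_le_liminf (Eventually.of_forall fun n => ?_)
    have hpos : (0 : ℝ) < 1 / ((n : ℝ) + 1) := by positivity
    rw [ENNReal.ofReal_mul (by positivity), ENNReal.ofReal_add (by positivity) zero_le_one]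
    simp only [ENNReal.ofReal_natCast, ENNReal.ofReal_one]
    gcongr
    rw [ENNReal.le_ofReal_iff_toReal_le (hfin _ _)]
    · exact hinc _ _ hmem.1.le (by linarith)
    · exact sub_nonneg.2 (hF (by linarith))
  refine hle.trans ((hr_int a b hab).trans ?_)
  refine ENNReal.ofReal_le_of_le_toReal ?_
  have h0 : 0 ≤ F a := ENNReal.toReal_nonneg
  have hb : F b = (D a b).toReal := by simp only [hFdef, max_eq_right hab.le]
  linarith

/-- Lebesgue's differentiation theorem for locally finite densities with values in `[0, +∞]`. -/
theorem ae_hasDerivAt_integral_toReal {h : ℝ → ℝ≥0∞} (hh : Measurable h)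
    (hfinite : ∀ a b, a ≤ b → ∫⁻ t in Ioo a b, h t ≠ ⊤) :
    (∀ᵐ t, h t < ⊤ ∧ HasDerivAt (fun x => ∫ s in (0 : ℝ)..x, (h s).toReal) (h t).toReal t) ∧
      ∀ a b, a ≤ b → ENNReal.ofReal ((∫ s in (0 : ℝ)..b, (h s).toReal) -
        ∫ s in (0 : ℝ)..a, (h s).toReal) = ∫⁻ t in Ioo a b, h t := by
  have hloc : LocallyIntegrable (fun t => (h t).toReal) volume := fun x =>
    ⟨Ioo (x - 1) (x + 1), Ioo_mem_nhds (by linarith) (by linarith),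
      integrable_toReal_of_lintegral_ne_top hh.aemeasurable
        (hfinite _ _ (by linarith))⟩
  have htop : ∀ᵐ t, h t < ⊤ := by
    have h1 : ∀ n : ℕ, ∀ᵐ t, t ∈ Ioo (-(n : ℝ)) n → h t < ⊤ := fun n =>
      (ae_restrict_iff' measurableSet_Ioo).1
        (ae_lt_top hh (hfinite _ _ (neg_le_self (Nat.cast_nonneg n))))
    filter_upwards [ae_all_iff.2 h1] with t ht
    obtain ⟨n, hn⟩ := exists_nat_gt |t|
    exact ht n (abs_lt.1 hn)
  refine ⟨?_, fun a b hab => ?_⟩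
  · filter_upwards [_root_.LocallyIntegrable.ae_hasDerivAt_integral hloc, htop] with t ht htt
    exact ⟨htt, ht 0⟩
  · have hii : ∀ x y, IntervalIntegrable (fun t => (h t).toReal) volume x y := fun x y =>
      (hloc.integrableOn_isCompact isCompact_uIcc).intervalIntegrable
    rw [intervalIntegral.integral_interval_sub_left (hii _ _) (hii _ _),
      intervalIntegral.integral_of_le hab, integral_Ioc_eq_integral_Ioo,
      integral_toReal hh.aemeasurable (ae_restrict_of_ae htop),
      ENNReal.ofReal_toReal (hfinite _ _ hab)]

theorem ae_le_intervalDeriv (hfin : ∀ a b, D a b ≠ ⊤) {h : ℝ → ℝ≥0∞} (hh : Measurable h)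
    (hint : ∀ a b, a ≤ b → ∫⁻ t in Ioo a b, h t ≤ D a b) :
    ∀ᵐ t, h t ≤ intervalDeriv D t := by
  obtain ⟨hderiv, hK⟩ := ae_hasDerivAt_integral_toReal hh
    fun a b hab => ne_top_of_le_ne_top (hfin a b) (hint a b hab)
  filter_upwards [hderiv] with t ht
  have hlim := tendsto_mul_sub_of_hasDerivAt ht.2
  rw [ENNReal.ofReal_toReal ht.1.ne] at hlim
  rw [← hlim.liminf_eq]
  refine liminf_le_liminf (Eventually.of_forall fun n => ?_)
  have hpos : (0 : ℝ) < 1 / ((n : ℝ) + 1) := by positivity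
  rw [ENNReal.ofReal_mul (by positivity), ENNReal.ofReal_add (by positivity) zero_le_one]
  simp only [ENNReal.ofReal_natCast, ENNReal.ofReal_one]
  gcongr
  rw [hK _ _ (by linarith)]
  exact hint t (t + 1 / (n + 1)) (by linarith)

/-- The supremum of all measures dominated by `D` on open intervals has Lebesgue density
`intervalDeriv D`. -/
theorem rnDeriv_sSup_ae_eq (hfin : ∀ a b, D a b ≠ ⊤)
    (hadd : ∀ a b c, a ≤ b → b ≤ c → D a b + D b c ≤ D a c)
    (hmeas : Measurable (intervalDeriv D)) {F : ℝ → ℝ} (hF : Monotone F) {C : ℝ}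
    (hFC : ∀ t, |F t| ≤ C) (hDF : ∀ a b, a < b → D a b ≤ ENNReal.ofReal (F b - F a)) :
    (sSup {ν : Measure ℝ | ∀ a b : ℝ, a ≤ b → ν (Ioo a b) ≤ D a b}).rnDeriv volume =ᵐ[volume]
      intervalDeriv D := by
  set S := {ν : Measure ℝ | ∀ a b : ℝ, a ≤ b → ν (Ioo a b) ≤ D a b}
  set g := hF.stieltjesFunction
  have hgfin : IsFiniteMeasure g.measure := by
    refine g.isFiniteMeasure_of_forall_abs_le (C := C) fun t => abs_le.2 ⟨?_, ?_⟩
    · exact (abs_le.1 (hFC t)).1.trans (hF.le_rightLim le_rfl)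
    · exact (hF.rightLim_le (lt_add_one t)).trans (abs_le.1 (hFC _)).2
  have hle : ∀ ν ∈ S, ν ≤ g.measure := fun ν hν =>
    le_stieltjes_measure hF fun a b hab => (hν a b hab.le).trans (hDF a b hab)
  have hSg : sSup S ≤ g.measure := sSup_le hle
  have hSfin : IsFiniteMeasure (sSup S) := isFiniteMeasure_of_le g.measure hSg
  have hdecomp : sSup S ≤ volume.withDensity (intervalDeriv D) + g.measure.singularPart volume := by
    refine sSup_le fun ν hν => ?_
    have hνfin : IsFiniteMeasure ν := isFiniteMeasure_of_le g.measure (hle ν hν)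
    rw [Measure.haveLebesgueDecomposition_add ν volume, add_comm]
    refine add_le_add (withDensity_mono ?_) (singularPart_mono (hle ν hν))
    refine ae_le_intervalDeriv hfin (Measure.measurable_rnDeriv _ _) fun a b hab => ?_
    exact (Measure.setLIntegral_rnDeriv_le _).trans (hν a b hab)
  have h1 := rnDeriv_ae_le_of_le_add (g.measure.mutuallySingular_singularPart volume) hdecomp
  have h2 : volume.withDensity (intervalDeriv D) ≤ sSup S := by
    refine le_sSup fun a b hab => ?_
    rw [withDensity_apply _ measurableSet_Ioo]
    exact setLIntegral_intervalDeriv_le hfin hadd hab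
  filter_upwards [h1, ae_le_rnDeriv_of_withDensity_le hmeas h2] with t ht1 ht2
  exact le_antisymm ht1 ht2

end RealLine

/-! ### Finite rough spacetimes -/

section FiniteSpacetime

variable {M : Type*} {ℓ : M → M → EReal}

/-- Rough spacetimes in which `ℓ` is finite on causally related pairs. -/
structure IsFiniteSpacetime (ℓ : M → M → EReal) : Prop extends IsRoughSpacetime ℓ where
  finite : ∀ x y, Causal ℓ x y → ℓ x y ≠ ⊤

/-- The positive part `ℓ₊` of the time separation, with values in `[0, +∞]`. -/
def tsep (ℓ : M → M → EReal) (x y : M) : ℝ≥0∞ := (ℓ x y).toENNReal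

theorem tsep_pos_iff {x y : M} : 0 < tsep ℓ x y ↔ Chron ℓ x y := by
  rw [tsep, EReal.toENNReal_pos_iff]; rfl

theorem coe_tsep {x y : M} (h : Causal ℓ x y) : (tsep ℓ x y : EReal) = ℓ x y :=
  EReal.coe_toENNReal h

namespace IsFiniteSpacetime

theorem tsep_ne_top (h : IsFiniteSpacetime ℓ) (x y : M) : tsep ℓ x y ≠ ⊤ := by
  rw [tsep, Ne, EReal.toENNReal_eq_top_iff]
  intro hxy
  exact h.finite x y (by rw [Causal, hxy]; exact le_top) hxy

theorem causal_and_add_le (h : IsFiniteSpacetime ℓ) {x y z : M} (hxy : Causal ℓ x y)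
    (hyz : Causal ℓ y z) : Causal ℓ x z ∧ ℓ x y + ℓ y z ≤ ℓ x z := by
  have htri := h.revTriangle x y z
  have hyz_top := h.finite y z hyz
  have hyz_bot : ℓ y z ≠ ⊥ := fun h0 => by
    rw [Causal, h0] at hyz; exact absurd hyz (by simp)
  rw [subConv] at htri
  split_ifs at htri with hc
  · rcases hc with hc | hc
    · exact ⟨by rw [Causal, hc]; exact le_top, by rw [hc]; exact le_top⟩
    · exact absurd hc hyz_bot
  · have h1 : ℓ x y + ℓ y z ≤ ℓ x z := by
      have := EReal.add_le_of_le_sub htri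
      exact this
    exact ⟨le_trans (add_nonneg hxy hyz) h1, h1⟩

theorem causal_trans (h : IsFiniteSpacetime ℓ) {x y z : M} (hxy : Causal ℓ x y)
    (hyz : Causal ℓ y z) : Causal ℓ x z := (h.causal_and_add_le hxy hyz).1

/-- The reverse triangle inequality. -/
theorem tsep_add_le (h : IsFiniteSpacetime ℓ) {x y z : M} (hxy : Causal ℓ x y)
    (hyz : Causal ℓ y z) : tsep ℓ x y + tsep ℓ y z ≤ tsep ℓ x z := by
  have h1 := (h.causal_and_add_le hxy hyz)
  rw [← EReal.coe_ennreal_le_coe_ennreal_iff, EReal.coe_ennreal_add, coe_tsep hxy, coe_tsep hyz,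
    coe_tsep h1.1]
  exact h1.2

theorem tsep_self (h : IsFiniteSpacetime ℓ) (x : M) : tsep ℓ x x = 0 := by
  have h1 := h.tsep_add_le (h.diag x) (h.diag x)
  by_contra h0
  exact absurd h1 (not_le.2 (ENNReal.lt_add_right (h.tsep_ne_top x x) h0))

theorem chron_of_causal_of_chron (h : IsFiniteSpacetime ℓ) {x y z : M} (hxy : Causal ℓ x y)
    (hyz : Chron ℓ y z) : Chron ℓ x z := by
  rw [← tsep_pos_iff] at hyz ⊢
  exact hyz.trans_le (le_add_self.trans (h.tsep_add_le hxy (tsep_pos_iff.1 hyz).le))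

theorem chron_of_chron_of_causal (h : IsFiniteSpacetime ℓ) {x y z : M} (hxy : Chron ℓ x y)
    (hyz : Causal ℓ y z) : Chron ℓ x z := by
  rw [← tsep_pos_iff] at hxy ⊢
  exact hxy.trans_le (le_self_add.trans (h.tsep_add_le (tsep_pos_iff.1 hxy).le hyz))

end IsFiniteSpacetime

end FiniteSpacetime

/-! ### The causal speed -/

section Speed

variable {M : Type*} [MetricSpace M] {ℓ : M → M → EReal}

/-- The time separation of two points of a path. -/
def pathSep (γ : LCC ℓ) (a b : ℝ) : ℝ≥0∞ := tsep ℓ (γ.ext a) (γ.ext b)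

theorem pathSep_add_le (h : IsFiniteSpacetime ℓ) (γ : LCC ℓ) (a b c : ℝ) (hab : a ≤ b)
    (hbc : b ≤ c) : pathSep γ a b + pathSep γ b c ≤ pathSep γ a c :=
  h.tsep_add_le (γ.causal_ext hab) (γ.causal_ext hbc)

theorem LCC.ext_of_le_zero (γ : LCC ℓ) {t : ℝ} (ht : t ≤ 0) : γ.ext t = γ.path 0 := by
  rw [LCC.ext, projIcc_of_le_left _ ht]; rfl

theorem LCC.ext_of_one_le (γ : LCC ℓ) {t : ℝ} (ht : 1 ≤ t) : γ.ext t = γ.path 1 := by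
  rw [LCC.ext, projIcc_of_right_le _ ht]; rfl

theorem pathSep_mono (h : IsFiniteSpacetime ℓ) (γ : LCC ℓ) {a a' b b' : ℝ} (ha : a' ≤ a)
    (hab : a ≤ b) (hb : b ≤ b') : pathSep γ a b ≤ pathSep γ a' b' :=
  le_self_add.trans <| (pathSep_add_le h γ a b b' hab hb).trans <|
    le_add_self.trans (pathSep_add_le h γ a' a b' ha (hab.trans hb))

theorem measurable_tsep [SecondCountableTopology M] [MeasurableSpace M] [BorelSpace M]
    (hlsc : LowerSemicontinuous fun z : M × M => max (ℓ z.1 z.2) 0) :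
    Measurable fun z : M × M => tsep ℓ z.1 z.2 := by
  have : (fun z : M × M => tsep ℓ z.1 z.2) = fun z => (max (ℓ z.1 z.2) 0).toENNReal := by
    funext z
    rcases le_total (ℓ z.1 z.2) 0 with h | h
    · rw [max_eq_right h, tsep, EReal.toENNReal_of_nonpos h, EReal.toENNReal_zero]
    · rw [max_eq_left h, tsep]
  rw [this]
  exact measurable_ereal_toENNReal.comp hlsc.measurable

variable [MeasurableSpace M] [BorelSpace M] [SecondCountableTopology M]

/-- A version of the causal speed that is jointly measurable in the path and the time. -/
theorem measurable_uncurry_intervalDeriv_pathSep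
    (hlsc : LowerSemicontinuous fun z : M × M => max (ℓ z.1 z.2) 0) :
    Measurable fun z : LCC ℓ × ℝ => intervalDeriv (pathSep z.1) z.2 := by
  refine Measurable.liminf fun n => measurable_const.mul ?_
  refine (measurable_tsep hlsc).comp (measurable_uncurry_ext.prodMk ?_)
  exact measurable_uncurry_ext.comp (measurable_fst.prodMk (measurable_snd.add_const _))

/-- The density of the largest measure dominated by the time separation, in terms of which `speed`
is defined, is a lower derivative of the time separation. -/
theorem speed_ae_eq (h : IsFiniteSpacetime ℓ)
    (hlsc : LowerSemicontinuous fun z : M × M => max (ℓ z.1 z.2) 0) (γ : LCC ℓ) :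
    speed γ =ᵐ[volume] intervalDeriv (pathSep γ) := by
  have hcausal0 : ∀ t, Causal ℓ (γ.path 0) (γ.ext t) := fun t =>
    γ.causal _ _ unitInterval.nonneg'
  have hinc : ∀ a b, a ≤ b → (pathSep γ a b).toReal ≤
      (tsep ℓ (γ.path 0) (γ.ext b)).toReal - (tsep ℓ (γ.path 0) (γ.ext a)).toReal := by
    intro a b hab
    have h1 := ENNReal.toReal_mono (h.tsep_ne_top _ _)
      (h.tsep_add_le (hcausal0 a) (γ.causal_ext hab))
    rw [ENNReal.toReal_add (h.tsep_ne_top _ _) (h.tsep_ne_top _ _)] at h1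
    rw [pathSep]
    linarith
  refine rnDeriv_sSup_ae_eq (D := pathSep γ) (F := fun t => (tsep ℓ (γ.path 0) (γ.ext t)).toReal)
    (C := (tsep ℓ (γ.path 0) (γ.path 1)).toReal) (fun a b => h.tsep_ne_top _ _)
    (pathSep_add_le h γ) ?_ (fun a b hab => ?_) (fun t => ?_) (fun a b hab => ?_)
  · exact Measurable.of_uncurry_left (f := fun γ : LCC ℓ => intervalDeriv (pathSep γ))
      (measurable_uncurry_intervalDeriv_pathSep hlsc)
  · linarith [hinc a b hab, ENNReal.toReal_nonneg (a := pathSep γ a b)]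
  · rw [abs_of_nonneg ENNReal.toReal_nonneg]
    refine ENNReal.toReal_mono (h.tsep_ne_top _ _) ?_
    exact le_self_add.trans (h.tsep_add_le (hcausal0 t) (γ.causal _ _ unitInterval.le_one'))
  · rw [ENNReal.le_ofReal_iff_toReal_le (show pathSep γ a b ≠ ⊤ from h.tsep_ne_top _ _)]
    · exact hinc a b hab.le
    · exact ENNReal.toReal_nonneg.trans (hinc a b hab.le)

theorem setLIntegral_speed_le (h : IsFiniteSpacetime ℓ)
    (hlsc : LowerSemicontinuous fun z : M × M => max (ℓ z.1 z.2) 0) (γ : LCC ℓ) {a b : ℝ}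
    (hab : a ≤ b) : ∫⁻ t in Ioo a b, speed γ t ≤ pathSep γ a b := by
  rw [lintegral_congr_ae (ae_restrict_of_ae (speed_ae_eq h hlsc γ))]
  exact setLIntegral_intervalDeriv_le (fun a b => h.tsep_ne_top _ _) (pathSep_add_le h γ) hab

omit [MeasurableSpace M] [BorelSpace M] [SecondCountableTopology M] in
theorem measurable_speed (γ : LCC ℓ) : Measurable (speed γ) := Measure.measurable_rnDeriv _ _

/-- Maximality of the causal speed. -/
theorem ae_le_speed (h : IsFiniteSpacetime ℓ)
    (hlsc : LowerSemicontinuous fun z : M × M => max (ℓ z.1 z.2) 0) (γ : LCC ℓ) {k : ℝ → ℝ≥0∞}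
    (hk : Measurable k)
    (hint : ∀ a b, 0 ≤ a → a ≤ b → b ≤ 1 → ∫⁻ t in Ioo a b, k t ≤ pathSep γ a b) :
    ∀ᵐ t ∂volume.restrict (Ioo 0 1), k t ≤ speed γ t := by
  have h1 : ∀ᵐ t, (Ioo (0 : ℝ) 1).indicator k t ≤ intervalDeriv (pathSep γ) t := by
    refine ae_le_intervalDeriv (fun a b => h.tsep_ne_top _ _) (hk.indicator measurableSet_Ioo)
      fun a b hab => ?_
    rw [setLIntegral_indicator measurableSet_Ioo, Ioo_inter_Ioo]
    rcases le_total (max 0 a) (min 1 b) with h2 | h2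
    · exact (hint _ _ (le_max_left _ _) h2 (min_le_left _ _)).trans
        (pathSep_mono h γ (le_max_right _ _) h2 (min_le_right _ _))
    · change ∫⁻ t in Ioo (max 0 a) (min 1 b), k t ≤ _
      rw [Ioo_eq_empty (not_lt.2 h2)]
      simp
  rw [ae_restrict_iff' measurableSet_Ioo]
  filter_upwards [h1, speed_ae_eq h hlsc γ] with t ht1 ht2 hmem
  rwa [indicator_of_mem hmem, ← ht2] at ht1

/-- Along `ℓ`-geodesics the causal speed is constant. -/
theorem speed_eq_of_mem_TGeo (h : IsFiniteSpacetime ℓ)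
    (hlsc : LowerSemicontinuous fun z : M × M => max (ℓ z.1 z.2) 0) {γ : LCC ℓ} (hγ : γ ∈ TGeo ℓ) :
    ∀ᵐ t ∂volume.restrict (Ioo 0 1), speed γ t = tsep ℓ (γ.path 0) (γ.path 1) := by
  set L := tsep ℓ (γ.path 0) (γ.path 1)
  have h1 : ∀ᵐ t ∂volume.restrict (Ioo 0 1), L ≤ speed γ t := by
    refine ae_le_speed h hlsc γ measurable_const fun a b ha hab hb => ?_
    rcases hab.eq_or_lt with rfl | hab
    · simp
    have h2 := (hγ ⟨a, ha, hab.le.trans hb⟩ ⟨b, ha.trans hab.le, hb⟩ hab).2.1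
    rw [setLIntegral_const, Real.volume_Ioo, pathSep, LCC.ext, LCC.ext,
      projIcc_of_mem _ ⟨ha, hab.le.trans hb⟩, projIcc_of_mem _ ⟨ha.trans hab.le, hb⟩, tsep, h2,
      EReal.toENNReal_mul (by exact_mod_cast sub_nonneg.2 hab.le),
      EReal.toENNReal_of_ne_top (EReal.coe_ne_top _)]
    rw [mul_comm]
    rfl
  have h2 : ∫⁻ t in Ioo (0 : ℝ) 1, speed γ t ≤ ∫⁻ t in Ioo (0 : ℝ) 1, L := by
    refine (setLIntegral_speed_le h hlsc γ zero_le_one).trans ?_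
    rw [pathSep, γ.ext_of_le_zero le_rfl, γ.ext_of_one_le le_rfl]
    simp [L]
  have h3 := ae_eq_of_ae_le_of_lintegral_le h1 (by simpa using h.tsep_ne_top _ _)
    (measurable_speed γ).aemeasurable h2
  filter_upwards [h3] with t ht using ht.symm

omit [MeasurableSpace M] [BorelSpace M] [SecondCountableTopology M] in
theorem ext_restr (γ : LCC ℓ) {s t : I} (hst : s < t) {r : ℝ} (hr0 : 0 ≤ r) (hr1 : r ≤ 1) :
    (restr s t hst γ).ext r = γ.ext (s + (t - s) * r) := by
  rw [LCC.ext, LCC.ext, projIcc_of_mem zero_le_one ⟨hr0, hr1⟩]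
  have : lineParam s t ⟨r, hr0, hr1⟩ = projIcc 0 1 zero_le_one ((s : ℝ) + (t - s) * r) := by
    have h1 : ((lineParam s t ⟨r, hr0, hr1⟩ : I) : ℝ) = (s : ℝ) + (t - s) * r := by
      simp only [lineParam]; ring
    rw [← h1, projIcc_val]
  change γ.path (lineParam s t ⟨r, hr0, hr1⟩) = _
  rw [this]

/-- Restricting a path to `[s, t]` and rescaling it multiplies its causal speed at least by
`t - s`. -/
theorem mul_speed_le_speed_restr (h : IsFiniteSpacetime ℓ)
    (hlsc : LowerSemicontinuous fun z : M × M => max (ℓ z.1 z.2) 0) (γ : LCC ℓ) {s t : I}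
    (hst : s < t) : ∀ᵐ r ∂volume.restrict (Ioo (0 : ℝ) 1),
      ENNReal.ofReal (t - s) * speed γ (s + (t - s) * r) ≤ speed (restr s t hst γ) r := by
  have hst' : (0 : ℝ) < t - s := sub_pos.2 hst
  refine ae_le_speed h hlsc _ (measurable_const.mul ((measurable_speed γ).comp (by fun_prop)))
    fun a b ha hab hb => ?_
  rw [pathSep, ext_restr γ hst ha (hab.trans hb), ext_restr γ hst (ha.trans hab) hb]
  have hab' : (s : ℝ) + (t - s) * a ≤ s + (t - s) * b := by nlinarith
  refine le_trans (le_of_eq ?_) (setLIntegral_speed_le h hlsc γ hab')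
  have himage : (fun r : ℝ => (s : ℝ) + (t - s) * r) '' Ioo a b =
      Ioo ((s : ℝ) + (t - s) * a) (s + (t - s) * b) := by
    have h1 := image_affine_Ioo hst' s a b
    rw [add_comm ((t - s) * a : ℝ), add_comm ((t - s) * b : ℝ)] at h1
    rw [← h1]
    simp only [add_comm]
  rw [← himage, lintegral_image_eq_lintegral_abs_deriv_mul measurableSet_Ioo
    (f' := fun _ => (t : ℝ) - s)]
  · simp only [abs_of_pos hst']
  · intro r _
    have h1 := ((hasDerivAt_id r).const_mul ((t : ℝ) - s)).const_add (s : ℝ)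
    simpa using h1.hasDerivWithinAt
  · intro r _ r' _ hrr'
    simpa [hst'.ne'] using hrr'

end Speed

/-! ### Weak subslopes along almost every path -/

section WeakSubslope

/-- The increment `f(y) - f(x)` of a causal function between causally related points, where it is
nonnegative. It is `+∞` if `f(y) = +∞` or `f(x) = -∞`. -/
def increment {M : Type*} (f : M → EReal) (x y : M) : ℝ≥0∞ := (subConv (f y) (f x)).toENNReal

theorem increment_eq_top {M : Type*} {f : M → EReal} {x y : M} (h : f y = ⊤ ∨ f x = ⊥) :
    increment f x y = ⊤ := by
  simp [increment, subConv, h]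

theorem increment_eq_ofReal {M : Type*} {f : M → EReal} {x y : M} (hx : f x ≠ ⊥) (hx' : f x ≠ ⊤)
    (hy : f y ≠ ⊥) (hy' : f y ≠ ⊤) :
    increment f x y = ENNReal.ofReal ((f y).toReal - (f x).toReal) := by
  obtain ⟨a, ha⟩ : ∃ a : ℝ, f x = a := ⟨_, (EReal.coe_toReal hx' hx).symm⟩
  obtain ⟨b, hb⟩ : ∃ b : ℝ, f y = b := ⟨_, (EReal.coe_toReal hy' hy).symm⟩
  rw [increment, subConv, if_neg (by simp [hx, hy']), ha, hb, ← EReal.coe_sub,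
    EReal.toENNReal_of_ne_top (EReal.coe_ne_top _), EReal.toReal_coe, EReal.toReal_coe,
    EReal.toReal_coe]

variable {M : Type*} [MetricSpace M] {ℓ : M → M → EReal} [MeasurableSpace M] [BorelSpace M]
  [SecondCountableTopology M] {m : Measure M} {f : M → EReal}

/-- The action of `G` along a path between the times `s` and `t`. -/
def action (G : M → ℝ≥0∞) (s t : ℝ) (γ : LCC ℓ) : ℝ≥0∞ :=
  ∫⁻ r in Ioo s t, G (γ.ext r) * speed γ r

omit [SecondCountableTopology M] in
/-- A property that holds `m`-a.e. holds at almost every time of almost every path. -/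
theorem ae_ae_of_ae_map {π : Measure (LCC ℓ)} [SFinite π] {s t : ℝ}
    (hπ : ∀ r : I, s < r → r < t → π.map (eval r) ≪ m) (hs : 0 ≤ s) (ht : t ≤ 1) {P : M → Prop}
    (hP : ∀ᵐ x ∂m, P x) : ∀ᵐ γ ∂π, ∀ᵐ r ∂volume.restrict (Ioo s t), P (γ.ext r) := by
  set N := toMeasurable m {x | ¬ P x}
  have hN : MeasurableSet N := measurableSet_toMeasurable _ _
  have hN0 : m N = 0 := by rw [measure_toMeasurable]; exact hP
  have h1 : ∀ᵐ r ∂volume.restrict (Ioo s t), ∀ᵐ γ ∂π, γ.ext r ∉ N := by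
    filter_upwards [ae_restrict_mem measurableSet_Ioo] with r hr
    have h0 := hπ ⟨r, hs.trans hr.1.le, hr.2.le.trans ht⟩ hr.1 hr.2 hN0
    rw [Measure.map_apply (measurable_eval _) hN] at h0
    have : ∀ γ : LCC ℓ, γ.ext r = eval ⟨r, hs.trans hr.1.le, hr.2.le.trans ht⟩ γ := fun γ => by
      rw [LCC.ext, projIcc_of_mem]; rfl
    simp only [this]
    exact measure_eq_zero_iff_ae_notMem.1 h0
  have h2 := (Measure.ae_ae_comm (p := fun (γ : LCC ℓ) (r : ℝ) => γ.ext r ∉ N)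
    (measurable_uncurry_ext hN.compl)).2 h1
  filter_upwards [h2] with γ hγ
  filter_upwards [hγ] with r hr
  by_contra hcon
  exact hr (subset_toMeasurable m _ hcon)

theorem measurable_action (h : IsFiniteSpacetime ℓ)
    (hlsc : LowerSemicontinuous fun z : M × M => max (ℓ z.1 z.2) 0) {G : M → ℝ≥0∞}
    (hG : Measurable G) (s t : ℝ) : Measurable (action (ℓ := ℓ) G s t) := by
  have h1 : action (ℓ := ℓ) G s t =
      fun γ => ∫⁻ r in Ioo s t, G (γ.ext r) * intervalDeriv (pathSep γ) r := by
    funext γ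
    refine lintegral_congr_ae ?_
    filter_upwards [ae_restrict_of_ae (speed_ae_eq h hlsc γ)] with r hr
    rw [hr]
  rw [h1]
  exact Measurable.lintegral_prod_right' (f := fun z : LCC ℓ × ℝ =>
    G (z.1.ext z.2) * intervalDeriv (pathSep z.1) z.2)
    ((hG.comp measurable_uncurry_ext).mul (measurable_uncurry_intervalDeriv_pathSep hlsc))

omit [SecondCountableTopology M] in
theorem action_ae_eq {π : Measure (LCC ℓ)} [SFinite π] {s t : ℝ}
    (hπ : ∀ r : I, s < r → r < t → π.map (eval r) ≪ m) (hs : 0 ≤ s) (ht : t ≤ 1)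
    {G G' : M → ℝ≥0∞} (hG : G =ᵐ[m] G') : action G s t =ᵐ[π] action G' s t := by
  filter_upwards [ae_ae_of_ae_map hπ hs ht hG] with γ hγ
  refine lintegral_congr_ae ?_
  filter_upwards [hγ] with r hr
  rw [hr]

omit [BorelSpace M] [SecondCountableTopology M] in
theorem IsTestPlan.absolutelyContinuous {π : Measure (LCC ℓ)} (hπ : IsTestPlan m π) (r : I) :
    π.map (eval r) ≪ m := by
  obtain ⟨-, C, -, hC⟩ := hπ
  exact (Measure.absolutelyContinuous_of_le (hC r)).trans Measure.smul_absolutelyContinuous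

omit [BorelSpace M] [SecondCountableTopology M] in
theorem isWeakSubslope_iff {G : M → ℝ≥0∞} : IsWeakSubslope ℓ m f G ↔ AEMeasurable G m ∧
    ∀ π : Measure (LCC ℓ), IsTestPlan m π →
      ∫⁻ γ, action G 0 1 γ ∂π ≤ ∫⁻ γ, increment f (γ.path 0) (γ.path 1) ∂π := by
  simp only [IsWeakSubslope, lintegral_path_mul_speed]
  rfl

omit [SecondCountableTopology M] in
theorem IsWeakSubslope.congr {G G' : M → ℝ≥0∞} (hG : IsWeakSubslope ℓ m f G)
    (hGG' : G =ᵐ[m] G') : IsWeakSubslope ℓ m f G' := by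
  rw [isWeakSubslope_iff] at hG ⊢
  refine ⟨hG.1.congr hGG', fun π hπ => ?_⟩
  have := hπ.1
  rw [← lintegral_congr_ae (action_ae_eq (fun r _ _ => hπ.absolutelyContinuous r) le_rfl le_rfl
    hGG')]
  exact hG.2 π hπ

/-- The defining inequality of weak subslopes localises to measurable sets of paths and to
subintervals, because plans can be restricted, normalised and reparametrised. -/
theorem IsWeakSubslope.setLIntegral_action_le (h : IsFiniteSpacetime ℓ)
    (hlsc : LowerSemicontinuous fun z : M × M => max (ℓ z.1 z.2) 0) {G : M → ℝ≥0∞}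
    (hG : IsWeakSubslope ℓ m f G) {π : Measure (LCC ℓ)} [IsFiniteMeasure π] {s t : I}
    (hst : s < t) {C : ℝ≥0} (hC : ∀ r : I, s ≤ r → r ≤ t → π.map (eval r) ≤ C • m)
    (A : Set (LCC ℓ)) :
    ∫⁻ γ in A, action G s t γ ∂π ≤ ∫⁻ γ in A, increment f (γ.path s) (γ.path t) ∂π := by
  rcases eq_or_ne (π A) 0 with hA0 | hA0
  · rw [setLIntegral_measure_zero _ _ hA0]; exact zero_le
  have hAtop : π A ≠ ⊤ := measure_ne_top _ _
  set c : ℝ≥0∞ := (π A)⁻¹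
  have hc0 : c ≠ 0 := by simp [c, hAtop]
  have hctop : c ≠ ⊤ := by simp [c, hA0]
  have hrestr := measurable_restr (ℓ := ℓ) s t hst
  set π' : Measure (LCC ℓ) := (c • π.restrict A).map (restr s t hst) with hπ'
  have hplan : IsTestPlan m π' := by
    -- The summand `1` only serves to make the constant positive.
    refine ⟨⟨?_⟩, c.toNNReal * C + 1, by positivity, fun r => ?_⟩
    · rw [Measure.map_apply hrestr MeasurableSet.univ]
      simp [c, ENNReal.inv_mul_cancel hA0 hAtop]
    · have h1 : (eval r : LCC ℓ → M) ∘ restr s t hst = eval (lineParam s t r) := rfl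
      have hst' : (s : ℝ) < t := hst
      have hls : s ≤ lineParam s t r := by
        change (s : ℝ) ≤ (1 - (r : ℝ)) * s + r * t
        nlinarith [r.2.1]
      have hlt : lineParam s t r ≤ t := by
        change (1 - (r : ℝ)) * s + r * t ≤ (t : ℝ)
        nlinarith [r.2.2]
      rw [hπ', Measure.map_map (measurable_eval _) hrestr, h1, Measure.map_smul]
      have h2 : (π.restrict A).map (eval (lineParam s t r)) ≤ C • m :=
        (Measure.map_mono Measure.restrict_le_self (measurable_eval _)).trans (hC _ hls hlt)
      refine Measure.le_iff.2 fun B hB => ?_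
      have h3 := h2 B
      simp only [Measure.smul_apply, smul_eq_mul, ENNReal.smul_def] at h3 ⊢
      calc c * _ ≤ c * (C * m B) := by gcongr
        _ ≤ _ := by
          rw [← mul_assoc]
          gcongr
          push_cast
          rw [ENNReal.coe_toNNReal hctop]
          exact le_self_add
  have hint := (isWeakSubslope_iff.1 hG).2 π' hplan
  have hright : ∫⁻ γ, increment f (γ.path 0) (γ.path 1) ∂π' ≤
      c * ∫⁻ γ in A, increment f (γ.path s) (γ.path t) ∂π := by
    refine (lintegral_map_le _ _).trans (le_of_eq ?_)
    rw [lintegral_smul_measure]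
    have h0 : lineParam s t 0 = s := by ext; simp [lineParam]
    have h1 : lineParam s t 1 = t := by ext; simp [lineParam]
    simp only [restr, h0, h1]
    rfl
  have := hplan.1
  have hst' : (0 : ℝ) < t - s := sub_pos.2 hst
  have hleft : c * ∫⁻ γ in A, action G s t γ ∂π ≤ ∫⁻ γ, action G 0 1 γ ∂π' := by
    have hmk := (isWeakSubslope_iff.1 hG).1
    rw [lintegral_congr_ae (action_ae_eq (fun r _ _ => hplan.absolutelyContinuous r) le_rfl le_rfl
      hmk.ae_eq_mk), lintegral_map (measurable_action h hlsc hmk.measurable_mk 0 1) hrestr,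
      lintegral_smul_measure, smul_eq_mul]
    refine mul_le_mul' le_rfl ?_
    have hac : ∀ r : I, (s : ℝ) < r → (r : ℝ) < t → (π.restrict A).map (eval r) ≪ m :=
      fun r hsr hrt => (Measure.absolutelyContinuous_of_le
        ((Measure.map_mono Measure.restrict_le_self (measurable_eval _)).trans
          (hC r hsr.le hrt.le))).trans Measure.smul_absolutelyContinuous
    rw [lintegral_congr_ae (action_ae_eq hac s.2.1 t.2.2 hmk.ae_eq_mk)]
    refine lintegral_mono fun γ => ?_
    set G' := hmk.mk G
    have himage : (fun r : ℝ => (s : ℝ) + (t - s) * r) '' Ioo 0 1 = Ioo (s : ℝ) t := by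
      have h1 := image_affine_Ioo hst' s 0 1
      simp only [mul_zero, zero_add, mul_one, sub_add_cancel] at h1
      rw [← h1]
      simp only [add_comm]
    rw [action, ← himage, lintegral_image_eq_lintegral_abs_deriv_mul measurableSet_Ioo
      (f' := fun _ => (t : ℝ) - s)]
    · refine lintegral_mono_ae ?_
      filter_upwards [mul_speed_le_speed_restr h hlsc γ hst, ae_restrict_mem measurableSet_Ioo]
        with r hr hmem
      rw [abs_of_pos hst', mul_left_comm, ext_restr γ hst hmem.1.le hmem.2.le]
      gcongr
    · intro r _
      have h1 := ((hasDerivAt_id r).const_mul ((t : ℝ) - s)).const_add (s : ℝ)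
      simpa using h1.hasDerivWithinAt
    · intro r _ r' _ hrr'
      simpa [hst'.ne'] using hrr'
  exact (ENNReal.mul_le_mul_iff_right hc0 hctop).1 (hleft.trans (hint.trans hright))

/-- Along almost every path, a weak subslope bounds the increments of `f` from below. -/
theorem IsWeakSubslope.ae_action_le (h : IsFiniteSpacetime ℓ)
    (hlsc : LowerSemicontinuous fun z : M × M => max (ℓ z.1 z.2) 0) {G : M → ℝ≥0∞}
    (hG : IsWeakSubslope ℓ m f G) {π : Measure (LCC ℓ)} [IsFiniteMeasure π] {s t : I}
    (hst : s < t) {C : ℝ≥0} (hC : ∀ r : I, s ≤ r → r ≤ t → π.map (eval r) ≤ C • m) :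
    ∀ᵐ γ ∂π, action G s t γ ≤ increment f (γ.path s) (γ.path t) := by
  have hmk := (isWeakSubslope_iff.1 hG).1
  have hac : ∀ r : I, (s : ℝ) < r → (r : ℝ) < t → π.map (eval r) ≪ m :=
    fun r hsr hrt => (Measure.absolutelyContinuous_of_le
      (hC r hsr.le hrt.le)).trans Measure.smul_absolutelyContinuous
  refine ae_le_of_forall_setLIntegral_le_of_sigmaFinite₀ ?_
    fun A _ _ => hG.setLIntegral_action_le h hlsc hst hC A
  exact (measurable_action h hlsc hmk.measurable_mk s t).aemeasurable.congr
    (action_ae_eq hac s.2.1 t.2.2 hmk.ae_eq_mk).symm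

end WeakSubslope

/-! ### Existence of the maximal weak subslope -/

theorem withDensity_sup_le {α : Type*} [MeasurableSpace α] {μ ν : Measure α} {h₁ h₂ : α → ℝ≥0∞}
    (hm₁ : Measurable h₁) (hm₂ : Measurable h₂) (hle₁ : μ.withDensity h₁ ≤ ν)
    (hle₂ : μ.withDensity h₂ ≤ ν) : μ.withDensity (h₁ ⊔ h₂) ≤ ν := by
  refine Measure.le_iff.2 fun s hs => ?_
  set B := {x | h₂ x ≤ h₁ x}
  have hB : MeasurableSet B := measurableSet_le hm₂ hm₁
  rw [withDensity_apply _ hs, ← lintegral_inter_add_sdiff _ s hB, ← measure_inter_add_sdiff s hB]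
  refine add_le_add ?_ ?_
  · refine le_trans (le_of_eq ?_) (hle₁ _)
    rw [withDensity_apply _ (hs.inter hB)]
    exact setLIntegral_congr_fun (hs.inter hB) fun x hx => sup_eq_left.2 hx.2
  · refine le_trans (le_of_eq ?_) (hle₂ _)
    rw [withDensity_apply _ (hs.diff hB)]
    exact setLIntegral_congr_fun (hs.diff hB) fun x hx => sup_eq_right.2 (not_le.1 hx.2).le

theorem withDensity_iSup_le {α : Type*} [MeasurableSpace α] {μ ν : Measure α} {h : ℕ → α → ℝ≥0∞}
    (hm : ∀ n, Measurable (h n)) (hle : ∀ n, μ.withDensity (h n) ≤ ν) :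
    μ.withDensity (⨆ n, h n) ≤ ν := by
  have key : ∀ n, Measurable (partialSups h n) ∧ μ.withDensity (partialSups h n) ≤ ν := by
    intro n
    induction n with
    | zero => simpa using ⟨hm 0, hle 0⟩
    | succ n ih =>
      rw [partialSups_add_one]
      exact ⟨ih.1.sup (hm _), withDensity_sup_le ih.1 (hm _) ih.2 (hle _)⟩
  refine Measure.le_iff.2 fun s hs => ?_
  rw [← iSup_partialSups_eq h, withDensity_apply _ hs]
  simp only [iSup_apply]
  rw [lintegral_iSup (fun n => (key n).1) fun i j hij => (partialSups_monotone h) hij]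
  refine iSup_le fun n => ?_
  rw [← withDensity_apply _ hs]
  exact (key n).2 s

/-- Inequalities between actions and increments over rational time intervals bound the action
measure by the Stieltjes measure of `t ↦ f(γ_t)`. -/
theorem withDensity_le_stieltjes_of_setLIntegral_le {F : ℝ → ℝ} (hF : Monotone F)
    {k : ℝ → ℝ≥0∞}
    (h : ∀ c d : ℚ, 0 < (c : ℝ) → (c : ℝ) < d → (d : ℝ) < 1 →
      ∫⁻ r in Ioo (c : ℝ) d, k r ≤ ENNReal.ofReal (F d - F c)) :
    (volume.restrict (Ioo (0 : ℝ) 1)).withDensity k ≤ hF.stieltjesFunction.measure := by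
  refine le_stieltjes_measure hF fun a b hab => ?_
  let ι := {p : ℚ × ℚ // max 0 a < (p.1 : ℝ) ∧ (p.2 : ℝ) < min 1 b}
  have hunion : Ioo a b ∩ Ioo 0 1 = ⋃ p : ι, Ioo (p.1.1 : ℝ) p.1.2 := by
    ext x
    simp only [mem_inter_iff, mem_Ioo, mem_iUnion]
    constructor
    · rintro ⟨⟨h1, h2⟩, h3, h4⟩
      obtain ⟨c, hc1, hc2⟩ := exists_rat_btwn (max_lt h3 h1)
      obtain ⟨d, hd1, hd2⟩ := exists_rat_btwn (lt_min h4 h2)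
      exact ⟨⟨(c, d), hc1, hd2⟩, hc2, hd1⟩
    · rintro ⟨⟨⟨c, d⟩, hc, hd⟩, h1, h2⟩
      have hc' := max_lt_iff.1 hc
      have hd' := lt_min_iff.1 hd
      exact ⟨⟨hc'.2.trans h1, h2.trans hd'.2⟩, hc'.1.trans h1, h2.trans hd'.1⟩
  have hdir : Directed (· ⊆ ·) fun p : ι => Ioo (p.1.1 : ℝ) p.1.2 := by
    rintro ⟨⟨c, d⟩, hc, hd⟩ ⟨⟨c', d'⟩, hc', hd'⟩
    refine ⟨⟨(min c c', max d d'), ?_, ?_⟩, ?_, ?_⟩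
    · push_cast; exact lt_min hc hc'
    · push_cast; exact max_lt hd hd'
    · refine Ioo_subset_Ioo ?_ ?_ <;> push_cast
      exacts [min_le_left _ _, le_max_left _ _]
    · refine Ioo_subset_Ioo ?_ ?_ <;> push_cast
      exacts [min_le_right _ _, le_max_right _ _]
  rw [← restrict_withDensity measurableSet_Ioo, Measure.restrict_apply measurableSet_Ioo, hunion,
    hdir.measure_iUnion]
  refine iSup_le ?_
  rintro ⟨⟨c, d⟩, hc, hd⟩
  have hc' := max_lt_iff.1 hc
  have hd' := lt_min_iff.1 hd
  rw [withDensity_apply _ measurableSet_Ioo]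
  change ∫⁻ r in Ioo (c : ℝ) d, k r ≤ _
  rcases lt_or_ge (c : ℝ) d with hcd | hcd
  · refine (h c d hc'.1 hcd hd'.1).trans (ENNReal.ofReal_le_ofReal ?_)
    exact sub_le_sub (hF hd'.2.le) (hF hc'.2.le)
  · rw [Ioo_eq_empty (not_lt.2 hcd)]; simp

section MaximalSubslope

variable {M : Type*} [MetricSpace M] {ℓ : M → M → EReal} [MeasurableSpace M] [BorelSpace M]
  [SecondCountableTopology M] {m : Measure M} {f : M → EReal}

omit [MeasurableSpace M] [BorelSpace M] [SecondCountableTopology M] in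
/-- For a causal function with finite values at the endpoints of a path, the values along the path
are finite and monotone. -/
theorem exists_monotone_of_causal (hf : ∀ x y, Causal ℓ x y → f x ≤ f y) (γ : LCC ℓ)
    (h0 : f (γ.path 0) ≠ ⊥) (h1 : f (γ.path 1) ≠ ⊤) :
    Monotone (fun t => (f (γ.ext t)).toReal) ∧ ∀ s t, increment f (γ.ext s) (γ.ext t) =
      ENNReal.ofReal ((f (γ.ext t)).toReal - (f (γ.ext s)).toReal) := by
  have hbot : ∀ t, f (γ.ext t) ≠ ⊥ := fun t hbot => h0 <| le_bot_iff.1 <|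
    (hf _ _ (γ.causal _ _ unitInterval.nonneg')).trans_eq hbot
  have htop : ∀ t, f (γ.ext t) ≠ ⊤ := fun t htop => h1 <| top_le_iff.1 <|
    htop.symm.le.trans (hf _ _ (γ.causal _ _ unitInterval.le_one'))
  refine ⟨fun s t hst => ?_, fun s t => ?_⟩
  · exact EReal.toReal_le_toReal (hf _ _ (γ.causal_ext hst)) (hbot s) (htop t)
  · exact increment_eq_ofReal (hbot s) (htop s) (hbot t) (htop t)

/-- Weak subslopes are closed under countable suprema: along almost every path all of the action
measures are dominated by the same Stieltjes measure, hence so is their supremum. -/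
theorem isWeakSubslope_iSup (h : IsFiniteSpacetime ℓ)
    (hlsc : LowerSemicontinuous fun z : M × M => max (ℓ z.1 z.2) 0)
    (hf : ∀ x y, Causal ℓ x y → f x ≤ f y) {G : ℕ → M → ℝ≥0∞}
    (hG : ∀ n, IsWeakSubslope ℓ m f (G n)) : IsWeakSubslope ℓ m f (⨆ n, G n) := by
  wlog hmeas : ∀ n, Measurable (G n) generalizing G
  · have h1 : ∀ n, G n =ᵐ[m] (hG n).1.mk := fun n => (hG n).1.ae_eq_mk
    refine (this (G := fun n => (hG n).1.mk) (fun n => (hG n).congr (h1 n))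
      fun n => (hG n).1.measurable_mk).congr ?_
    filter_upwards [ae_all_iff.2 h1] with x hx
    simp only [iSup_apply, hx]
  have hsup_meas : Measurable (⨆ n, G n) := by
    simpa only [← iSup_apply] using Measurable.iSup hmeas
  refine isWeakSubslope_iff.2 ⟨hsup_meas.aemeasurable, fun π hπ => ?_⟩
  have := hπ.1
  obtain ⟨-, C, -, hC⟩ := hπ
  refine lintegral_mono_ae ?_
  have hae : ∀ n : ℕ, ∀ p : {p : ℚ × ℚ // 0 < (p.1 : ℝ) ∧ (p.1 : ℝ) < p.2 ∧ (p.2 : ℝ) < 1},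
      ∀ᵐ γ ∂π, action (G n) p.1.1 p.1.2 γ ≤ increment f (γ.ext p.1.1) (γ.ext p.1.2) := by
    rintro n ⟨⟨c, d⟩, hc, hcd, hd⟩
    have h1 := (hG n).ae_action_le h hlsc (π := π) (s := ⟨c, hc.le, (hcd.trans hd).le⟩)
      (t := ⟨d, (hc.trans hcd).le, hd.le⟩) hcd (fun r _ _ => hC r)
    filter_upwards [h1] with γ hγ
    rwa [← γ.ext_coe, ← γ.ext_coe] at hγ
  filter_upwards [ae_all_iff.2 fun n => ae_all_iff.2 (hae n)] with γ hγ
  by_cases hcase : f (γ.path 1) = ⊤ ∨ f (γ.path 0) = ⊥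
  · rw [increment_eq_top hcase]; exact le_top
  obtain ⟨h1, h0⟩ := not_or.1 hcase
  obtain ⟨hF, hinc⟩ := exists_monotone_of_causal hf γ h0 h1
  have hdens : (volume.restrict (Ioo (0 : ℝ) 1)).withDensity
      (⨆ n, fun r => G n (γ.ext r) * speed γ r) ≤ hF.stieltjesFunction.measure := by
    refine withDensity_iSup_le
      (fun n => ((hmeas n).comp (measurable_ext γ)).mul (measurable_speed γ)) fun n => ?_
    refine withDensity_le_stieltjes_of_setLIntegral_le hF fun c d hc hcd hd => ?_
    rw [← hinc]
    exact hγ n ⟨(c, d), hc, hcd, hd⟩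
  calc action (⨆ n, G n) 0 1 γ
      = (volume.restrict (Ioo (0 : ℝ) 1)).withDensity
          (⨆ n, fun r => G n (γ.ext r) * speed γ r) (Ioo 0 1) := by
        rw [withDensity_apply _ measurableSet_Ioo, Measure.restrict_restrict measurableSet_Ioo,
          inter_self, action]
        simp only [iSup_apply, ENNReal.iSup_mul]
    _ ≤ hF.stieltjesFunction.measure (Ioo 0 1) := hdens _
    _ ≤ ENNReal.ofReal ((f (γ.ext 1)).toReal - (f (γ.ext 0)).toReal) := by
        rw [StieltjesFunction.measure_Ioo]
        refine ENNReal.ofReal_le_ofReal (sub_le_sub ?_ (hF.le_rightLim le_rfl))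
        refine le_of_tendsto (hF.stieltjesFunction.mono.tendsto_leftLim 1) ?_
        filter_upwards [self_mem_nhdsWithin] with y hy
        exact hF.rightLim_le hy
    _ = increment f (γ.path 0) (γ.path 1) := by
        rw [← hinc, γ.ext_of_le_zero le_rfl, γ.ext_of_one_le le_rfl]

theorem IsWeakSubslope.sup (h : IsFiniteSpacetime ℓ)
    (hlsc : LowerSemicontinuous fun z : M × M => max (ℓ z.1 z.2) 0)
    (hf : ∀ x y, Causal ℓ x y → f x ≤ f y) {G G' : M → ℝ≥0∞} (hG : IsWeakSubslope ℓ m f G)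
    (hG' : IsWeakSubslope ℓ m f G') : IsWeakSubslope ℓ m f (G ⊔ G') := by
  have h1 : G ⊔ G' = ⨆ n : ℕ, if n = 0 then G else G' := by
    refine le_antisymm (sup_le ?_ ?_) (iSup_le fun n => ?_)
    · exact le_iSup_of_le 0 (by simp)
    · exact le_iSup_of_le 1 (by simp)
    · split_ifs
      exacts [le_sup_left, le_sup_right]
  rw [h1]
  refine isWeakSubslope_iSup h hlsc hf fun n => ?_
  split_ifs
  exacts [hG, hG']

/-- The maximal weak subslope exists: it minimises a strictly decreasing finite functional among
the weak subslopes. -/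
theorem exists_isMaximalWeakSubslope [SFinite m] (h : IsFiniteSpacetime ℓ)
    (hlsc : LowerSemicontinuous fun z : M × M => max (ℓ z.1 z.2) 0)
    (hf : ∀ x y, Causal ℓ x y → f x ≤ f y) : ∃ G, IsMaximalWeakSubslope ℓ m f G := by
  -- The measure `m.toFinite` is finite and has the same null sets as `m`.
  let J : (M → ℝ≥0∞) → ℝ≥0∞ := fun G => ∫⁻ x, (1 + G x)⁻¹ ∂m.toFinite
  have hJ_anti : ∀ {G G' : M → ℝ≥0∞}, G ≤ G' → J G' ≤ J G := fun hle =>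
    lintegral_mono fun x => ENNReal.inv_le_inv.2 (add_le_add le_rfl (hle x))
  have hJ_fin : ∀ G, J G ≠ ⊤ := fun G => by
    refine ne_top_of_le_ne_top (measure_ne_top m.toFinite univ) ?_
    rw [← lintegral_one]
    exact lintegral_mono fun x => by simp
  have hne : (J '' {G | IsWeakSubslope ℓ m f G}).Nonempty :=
    ⟨_, 0, isWeakSubslope_iff.2 ⟨aemeasurable_const, fun π _ => by simp [action]⟩, rfl⟩
  obtain ⟨u, -, hu_lim, hu_mem⟩ := exists_seq_tendsto_sInf hne (OrderBot.bddBelow _)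
  choose G hG hGu using hu_mem
  have hsup := isWeakSubslope_iSup h hlsc hf hG
  refine ⟨⨆ n, G n, hsup, fun G' hG' => ?_⟩
  have hsup' : IsWeakSubslope ℓ m f ((⨆ n, G n) ⊔ G') :=
    hsup.sup h hlsc hf hG'
  have hJle : J (⨆ n, G n) ≤ sInf (J '' {G | IsWeakSubslope ℓ m f G}) := by
    refine ge_of_tendsto' hu_lim fun n => ?_
    rw [← hGu n]
    exact hJ_anti (le_iSup G n)
  have hJle' : J (⨆ n, G n) ≤ J ((⨆ n, G n) ⊔ G') := hJle.trans (sInf_le ⟨_, hsup', rfl⟩)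
  have hmeas : ∀ {H : M → ℝ≥0∞}, IsWeakSubslope ℓ m f H →
      AEMeasurable (fun x => (1 + H x)⁻¹) m.toFinite := fun hH =>
    (aemeasurable_const.add (hH.1.mono_ac (toFinite_absolutelyContinuous m))).inv
  have hae := ae_eq_of_ae_le_of_lintegral_le (μ := m.toFinite)
    (f := fun x => (1 + ((⨆ n, G n) ⊔ G') x)⁻¹) (g := fun x => (1 + (⨆ n, G n) x)⁻¹)
    (Eventually.of_forall fun x =>
      ENNReal.inv_le_inv.2 (add_le_add le_rfl (le_sup_left : (⨆ n, G n) x ≤ _)))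
    (hJ_fin _) (hmeas hsup) hJle'
  filter_upwards [(absolutelyContinuous_toFinite m).ae_le hae] with x hx
  have h1 := inv_injective hx
  have h2 : ((⨆ n, G n) ⊔ G') x = (⨆ n, G n) x := by
    have := (ENNReal.add_right_inj ENNReal.one_ne_top).1 h1
    exact this
  rw [← h2]
  exact le_sup_right

theorem isMaximalWeakSubslope_maxWeakSubslope [SFinite m] (h : IsFiniteSpacetime ℓ)
    (hlsc : LowerSemicontinuous fun z : M × M => max (ℓ z.1 z.2) 0)
    (hf : ∀ x y, Causal ℓ x y → f x ≤ f y) :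
    IsMaximalWeakSubslope ℓ m f (maxWeakSubslope ℓ m f) :=
  Classical.epsilon_spec (exists_isMaximalWeakSubslope h hlsc hf)

end MaximalSubslope

/-! ### The backward slope -/

section BackwardSlope

theorem toENNReal_subConv_mono {a a' b b' : EReal} (ha : a ≤ a') (hb : b' ≤ b) :
    (subConv a b).toENNReal ≤ (subConv a' b').toENNReal := by
  by_cases h : a' = ⊤ ∨ b' = ⊥
  · simp [subConv, h]
  · obtain ⟨h1, h2⟩ := not_or.1 h
    have h3 : a ≠ ⊤ := fun h0 => h1 (top_le_iff.1 (h0.symm.le.trans ha))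
    have h4 : b ≠ ⊥ := fun h0 => h2 (le_bot_iff.1 (hb.trans h0.le))
    rw [subConv, subConv, if_neg h, if_neg (not_or.2 ⟨h3, h4⟩)]
    exact EReal.toENNReal_le_toENNReal (EReal.sub_le_sub ha hb)

theorem toENNReal_subConv_lt_iff {a b : EReal} {c : ℝ≥0∞} : (subConv a b).toENNReal < c ↔
    ∃ u v : ℚ, a < ((u : ℝ) : EReal) ∧ ((v : ℝ) : EReal) < b ∧ ENNReal.ofReal (u - v) < c := by
  constructor
  · intro h
    have hc : 0 < c := zero_le.trans_lt h
    have hab : a ≠ ⊤ ∧ b ≠ ⊥ := by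
      rw [← not_or]
      intro h0
      simp [subConv, h0] at h
    induction b with
    | bot => exact absurd rfl hab.2
    | top =>
      obtain ⟨u, hu, -⟩ := EReal.lt_iff_exists_rat_btwn.1 (lt_top_iff_ne_top.2 hab.1)
      exact ⟨u, u, hu, EReal.coe_lt_top _, by simpa using hc⟩
    | coe b =>
      induction a with
      | top => exact absurd rfl hab.1
      | bot =>
        obtain ⟨v, -, hv⟩ := EReal.lt_iff_exists_rat_btwn.1 (EReal.bot_lt_coe b)
        exact ⟨v, v, EReal.bot_lt_coe _, hv, by simpa using hc⟩
      | coe a =>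
        rw [subConv, if_neg (by simp), ← EReal.coe_sub,
          EReal.toENNReal_of_ne_top (EReal.coe_ne_top _), EReal.toReal_coe] at h
        have hlim : Tendsto (fun ε : ℝ => ENNReal.ofReal ((a + ε) - (b - ε))) (𝓝[>] 0)
            (𝓝 (ENNReal.ofReal (a - b))) := by
          have : Continuous fun ε : ℝ => ENNReal.ofReal ((a + ε) - (b - ε)) :=
            ENNReal.continuous_ofReal.comp (by fun_prop)
          simpa using (this.tendsto 0).mono_left nhdsWithin_le_nhds
        obtain ⟨ε, hε, hε0⟩ := ((hlim.eventually (gt_mem_nhds h)).and self_mem_nhdsWithin).exists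
        have hε0 : 0 < ε := hε0
        obtain ⟨u, hu1, hu2⟩ := exists_rat_btwn (lt_add_of_pos_right a hε0)
        obtain ⟨v, hv1, hv2⟩ := exists_rat_btwn (sub_lt_self b hε0)
        refine ⟨u, v, by exact_mod_cast hu1, by exact_mod_cast hv2, lt_of_le_of_lt ?_ hε⟩
        exact ENNReal.ofReal_le_ofReal (by linarith)
  · rintro ⟨u, v, hu, hv, huv⟩
    refine (toENNReal_subConv_mono hu.le hv.le).trans_lt ?_
    rwa [subConv, if_neg (by simp), ← EReal.coe_sub,
      EReal.toENNReal_of_ne_top (EReal.coe_ne_top _), EReal.toReal_coe]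

variable {M : Type*} {ℓ : M → M → EReal} {f : M → EReal}

theorem isOpen_IPlus [TopologicalSpace M] (hM : IsMetricSpacetime ℓ) (x : M) :
    IsOpen (IPlus ℓ x) := by
  have h := hM.topology_eq
  subst h
  exact TopologicalSpace.isOpen_generateFrom_of_mem ⟨x, Or.inl rfl⟩

theorem isOpen_IMinus [TopologicalSpace M] (hM : IsMetricSpacetime ℓ) (x : M) :
    IsOpen (IMinus ℓ x) := by
  have h := hM.topology_eq
  subst h
  exact TopologicalSpace.isOpen_generateFrom_of_mem ⟨x, Or.inr rfl⟩

theorem isOpen_upperRep_lt [TopologicalSpace M] (hM : IsMetricSpacetime ℓ) (c : EReal) :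
    IsOpen {x | upperRep ℓ f x < c} := by
  have : {x | upperRep ℓ f x < c} = ⋃ y ∈ {y | f y < c}, IMinus ℓ y := by
    ext x
    simp only [upperRep, mem_ofPred_eq, iInf_lt_iff, mem_iUnion]
    exact ⟨fun ⟨y, h1, h2⟩ => ⟨y, h2, h1⟩, fun ⟨y, h1, h2⟩ => ⟨y, h2, h1⟩⟩
  rw [this]
  exact isOpen_biUnion fun y _ => isOpen_IMinus hM y

theorem isOpen_lt_lowerRep [TopologicalSpace M] (hM : IsMetricSpacetime ℓ) (c : EReal) :
    IsOpen {x | c < lowerRep ℓ f x} := by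
  have : {x | c < lowerRep ℓ f x} = ⋃ y ∈ {y | c < f y}, IPlus ℓ y := by
    ext x
    simp only [lowerRep, mem_ofPred_eq, lt_iSup_iff, mem_iUnion]
    exact ⟨fun ⟨y, h1, h2⟩ => ⟨y, h2, h1⟩, fun ⟨y, h1, h2⟩ => ⟨y, h2, h1⟩⟩
  rw [this]
  exact isOpen_biUnion fun y _ => isOpen_IPlus hM y

/-- The infimum of the difference quotients in the definition of the backward slope, over a fixed
set `U`. -/
def slopeInf (ℓ : M → M → EReal) (f : M → EReal) (U : Set M) (x : M) : ℝ≥0∞ :=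
  ⨅ z ∈ U ∩ JMinus ℓ x,
    slopeDiv (subConv (upperRep ℓ f x) (lowerRep ℓ f z)).toENNReal (tsep ℓ z x)

theorem backwardSlope_eq [TopologicalSpace M] (x : M) :
    backwardSlope ℓ f x = ⨆ U ∈ 𝓝 x, slopeInf ℓ f U x := rfl

theorem slopeInf_anti {U V : Set M} (h : U ⊆ V) (x : M) : slopeInf ℓ f V x ≤ slopeInf ℓ f U x :=
  biInf_mono fun _ hz => ⟨h hz.1, hz.2⟩

theorem slopeDiv_lt_iff {a b c : ℝ≥0∞} (hb : b ≠ ⊤) : slopeDiv a b < c ↔ 0 < b ∧ a < c * b := by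
  unfold slopeDiv
  split_ifs with h
  · simp [h]
  · rw [ENNReal.div_lt_iff (Or.inl h) (Or.inl hb)]
    simp [pos_iff_ne_zero, h]

theorem isOpen_lt_tsep [TopologicalSpace M]
    (hlsc : LowerSemicontinuous fun z : M × M => max (ℓ z.1 z.2) 0) (c : ℝ≥0∞) :
    IsOpen {z : M × M | c < tsep ℓ z.1 z.2} := by
  have : {z : M × M | c < tsep ℓ z.1 z.2} =
      {z : M × M | (c : EReal) < max (ℓ z.1 z.2) 0} := by
    ext z
    simp only [mem_ofPred_eq]
    rw [← EReal.coe_ennreal_lt_coe_ennreal_iff, tsep, EReal.coe_toENNReal_eq_max, max_comm]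
  rw [this]
  exact hlsc.isOpen_preimage _

/-- For open `U`, a strict upper bound on `slopeInf` is an open condition: the upper and lower
representatives and `ℓ₊` are semicontinuous in the right directions, and projections are open. -/
theorem isOpen_slopeInf_lt [TopologicalSpace M] (hM : IsMetricSpacetime ℓ)
    (h : IsFiniteSpacetime ℓ) (hlsc : LowerSemicontinuous fun z : M × M => max (ℓ z.1 z.2) 0)
    {U : Set M} (hU : IsOpen U) (c : ℝ≥0∞) : IsOpen {x | slopeInf ℓ f U x < c} := by
  rcases eq_or_ne c 0 with rfl | hc
  · simp
  let O : Set (M × M) := ⋃ (u : ℚ) (v : ℚ), {z | z.1 ∈ U} ∩ {z | 0 < tsep ℓ z.1 z.2} ∩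
    {z | upperRep ℓ f z.2 < ((u : ℝ) : EReal)} ∩ {z | ((v : ℝ) : EReal) < lowerRep ℓ f z.1} ∩
    {z | ENNReal.ofReal (u - v) / c < tsep ℓ z.1 z.2}
  have hO : IsOpen O := by
    refine isOpen_iUnion fun u => isOpen_iUnion fun v => ?_
    refine ((((hU.preimage continuous_fst).inter (isOpen_lt_tsep hlsc _)).inter
      ((isOpen_upperRep_lt hM _).preimage continuous_snd)).inter
      ((isOpen_lt_lowerRep hM _).preimage continuous_fst)).inter (isOpen_lt_tsep hlsc _)
  have : {x | slopeInf ℓ f U x < c} = Prod.snd '' O := by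
    ext x
    simp only [slopeInf, mem_ofPred_eq, iInf_lt_iff, mem_image, Prod.exists, exists_eq_right]
    constructor
    · rintro ⟨z, hz, hlt⟩
      obtain ⟨hpos, hlt⟩ := (slopeDiv_lt_iff (h.tsep_ne_top z x)).1 hlt
      obtain ⟨u, v, hu, hv, huv⟩ := toENNReal_subConv_lt_iff.1 hlt
      refine ⟨z, mem_iUnion.2 ⟨u, mem_iUnion.2 ⟨v, ⟨⟨⟨hz.1, hpos⟩, hu⟩, hv⟩, ?_⟩⟩⟩
      exact (ENNReal.div_lt_iff (Or.inl hc) (Or.inr ENNReal.ofReal_ne_top)).2 (by rwa [mul_comm])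
    · rintro ⟨z, hz⟩
      obtain ⟨u, hz⟩ := mem_iUnion.1 hz
      obtain ⟨v, ⟨⟨⟨hzU, hpos⟩, hu⟩, hv⟩, huv⟩ := mem_iUnion.1 hz
      refine ⟨z, ⟨hzU, (tsep_pos_iff.1 hpos).le⟩, (slopeDiv_lt_iff (h.tsep_ne_top z x)).2
        ⟨hpos, toENNReal_subConv_lt_iff.2 ⟨u, v, hu, hv, ?_⟩⟩⟩
      rw [mul_comm]
      exact (ENNReal.div_lt_iff (Or.inl hc) (Or.inr ENNReal.ofReal_ne_top)).1 huv
  rw [this]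
  exact isOpenMap_snd _ hO

theorem measurable_backwardSlope [TopologicalSpace M] [MeasurableSpace M] [BorelSpace M]
    [SecondCountableTopology M] (hM : IsMetricSpacetime ℓ) (h : IsFiniteSpacetime ℓ)
    (hlsc : LowerSemicontinuous fun z : M × M => max (ℓ z.1 z.2) 0) :
    Measurable (backwardSlope ℓ f) := by
  set B := TopologicalSpace.countableBasis M
  have hB := TopologicalSpace.isBasis_countableBasis M
  have : backwardSlope ℓ f = fun x => ⨆ U ∈ B, U.indicator (slopeInf ℓ f U) x := by
    funext x
    rw [backwardSlope_eq]
    refine le_antisymm (iSup₂_le fun U hU => ?_) (iSup₂_le fun U hU => ?_)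
    · obtain ⟨V, hV, hxV, hVU⟩ := hB.mem_nhds_iff.1 hU
      refine le_iSup₂_of_le V hV ?_
      rw [indicator_of_mem hxV]
      exact slopeInf_anti hVU x
    · by_cases hx : x ∈ U
      · rw [indicator_of_mem hx]
        exact le_iSup₂_of_le U ((hB.isOpen hU).mem_nhds hx) le_rfl
      · rw [indicator_of_notMem hx]
        exact zero_le
  rw [this]
  refine Measurable.biSup B (TopologicalSpace.countable_countableBasis M) fun U hU => ?_
  refine Measurable.indicator (measurable_of_Iio fun c => ?_) (hB.isOpen hU).measurableSet
  exact (isOpen_slopeInf_lt hM h hlsc (hB.isOpen hU) c).measurableSet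

end BackwardSlope

section BackwardSlopePath

variable {M : Type*} [MetricSpace M] {ℓ : M → M → EReal} {f : M → EReal}

theorem tendsto_ext_left (γ : LCC ℓ) {t : ℝ} (h0 : 0 < t) (h1 : t ≤ 1) :
    Tendsto γ.ext (𝓝[<] t) (𝓝 (γ.ext t)) := by
  refine (γ.left_cont (projIcc 0 1 zero_le_one t) ?_).comp ?_
  · rw [projIcc_of_mem _ ⟨h0.le, h1⟩]
    exact h0
  · refine tendsto_nhdsWithin_iff.2
      ⟨(continuous_projIcc.tendsto t).mono_left nhdsWithin_le_nhds, ?_⟩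
    filter_upwards [Ioo_mem_nhdsLT h0] with s hs
    rw [projIcc_of_mem _ ⟨h0.le, h1⟩, projIcc_of_mem _ ⟨hs.1.le, hs.2.le.trans h1⟩]
    exact hs.2

theorem tendsto_slope_of_hasDerivAt {F : ℝ → ℝ} {c t : ℝ} (h : HasDerivAt F c t) (a b : ℝ) :
    Tendsto (fun y : ℝ => (F (t + a * y) - F (t + b * y)) / y) (𝓝[>] 0) (𝓝 ((a - b) * c)) := by
  have key : ∀ a : ℝ, HasDerivAt (fun y : ℝ => F (t + a * y)) (c * a) 0 := fun a => by
    have h1 : HasDerivAt (fun y : ℝ => t + a * y) a 0 := by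
      simpa using ((hasDerivAt_id (0 : ℝ)).const_mul a).const_add t
    have h2 : HasDerivAt F c (t + a * 0) := by simpa using h
    exact h2.comp (0 : ℝ) h1
  have h3 := ((key a).sub (key b)).tendsto_slope_zero_right
  refine Tendsto.congr (fun y => ?_) (by rwa [show (a - b) * c = c * a - c * b by ring])
  simp only [Pi.sub_apply, zero_add, mul_zero, sub_self, sub_zero, smul_eq_mul]
  rw [div_eq_inv_mul]

/-- At a time where both `f(γ)` and the integrated causal speed are differentiable, the latter with
positive derivative, the backward slope is controlled by the quotient of the derivatives. The points
`γ_{t - h}` compete in the backward slope; the upper and lower representatives are handled by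
looking slightly further to both sides, at times `t + ε h` and `t - (1 + ε) h`. -/
theorem slopeInf_mul_le {γ : LCC ℓ} {t : ℝ} (h0 : 0 < t) (h1 : t ≤ 1)
    {F K : ℝ → ℝ} {r k : ℝ}
    (hF : HasDerivAt F r t) (hK : HasDerivAt K k t) (hk : 0 < k)
    (hinc : ∀ s t, increment f (γ.ext s) (γ.ext t) = ENNReal.ofReal (F t - F s))
    (hKle : ∀ a b, a ≤ b → ENNReal.ofReal (K b - K a) ≤ pathSep γ a b)
    {U : Set M} (hU : U ∈ 𝓝 (γ.ext t)) :
    slopeInf ℓ f U (γ.ext t) * ENNReal.ofReal k ≤ ENNReal.ofReal r := by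
  have hchron : ∀ a b, a ≤ b → 0 < K b - K a → Chron ℓ (γ.ext a) (γ.ext b) := fun a b hab hpos =>
    tsep_pos_iff.1 ((ENNReal.ofReal_pos.2 hpos).trans_le (hKle a b hab))
  have key : ∀ ε : ℝ, 0 < ε →
      slopeInf ℓ f U (γ.ext t) ≤ ENNReal.ofReal ((1 + 2 * ε) * r / k) := by
    intro ε hε
    have hFlim := tendsto_slope_of_hasDerivAt hF ε (-(1 + ε))
    have hKlim := tendsto_slope_of_hasDerivAt hK 0 (-1)
    have hK1 := tendsto_slope_of_hasDerivAt hK ε 0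
    have hK2 := tendsto_slope_of_hasDerivAt hK (-1) (-(1 + ε))
    have hlim := (ENNReal.continuous_ofReal.tendsto _).comp (hFlim.div hKlim (by
      simpa using hk.ne'))
    rw [show (ε - -(1 + ε)) * r / ((0 - -1) * k) = (1 + 2 * ε) * r / k by ring] at hlim
    refine ge_of_tendsto hlim ?_
    have htend : Tendsto (fun y : ℝ => t - y) (𝓝[>] 0) (𝓝[<] t) := by
      refine tendsto_nhdsWithin_iff.2 ⟨?_, ?_⟩
      · have : Continuous fun y : ℝ => t - y := by fun_prop
        simpa using (this.tendsto 0).mono_left nhdsWithin_le_nhds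
      · filter_upwards [self_mem_nhdsWithin] with y hy
        have : 0 < y := hy
        exact sub_lt_self t this
    filter_upwards [self_mem_nhdsWithin, (tendsto_ext_left γ h0 h1).comp htend hU,
      hKlim.eventually (lt_mem_nhds (show 0 < (0 - -1) * k by simpa using hk)),
      hK1.eventually (lt_mem_nhds (show 0 < (ε - 0) * k by simpa using mul_pos hε hk)),
      hK2.eventually (lt_mem_nhds (show 0 < (-1 - -(1 + ε)) * k by
        have := mul_pos hε hk
        linarith))] with y hy hyU hy0 hy1 hy2
    have hy' : 0 < y := hy
    have e0 : t + 0 * y = t := by ring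
    have e1 : t + -1 * y = t - y := by ring
    rw [e0, e1] at hy0
    rw [e0] at hy1
    rw [e1] at hy2
    have hy0 := (div_pos_iff_of_pos_right hy').1 hy0
    have hy1 := (div_pos_iff_of_pos_right hy').1 hy1
    have hy2 := (div_pos_iff_of_pos_right hy').1 hy2
    have hεy := mul_pos hε hy'
    have hup : upperRep ℓ f (γ.ext t) ≤ f (γ.ext (t + ε * y)) :=
      iInf₂_le _ (hchron _ _ (by linarith) hy1)
    have hlow : f (γ.ext (t + -(1 + ε) * y)) ≤ lowerRep ℓ f (γ.ext (t - y)) :=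
      le_iSup₂_of_le (f := fun x (_ : x ∈ IMinus ℓ (γ.ext (t - y))) => f x) _
        (hchron _ _ (by linarith) hy2) le_rfl
    have hpos : 0 < tsep ℓ (γ.ext (t - y)) (γ.ext t) :=
      tsep_pos_iff.2 (hchron _ _ (by linarith) hy0)
    calc slopeInf ℓ f U (γ.ext t)
        ≤ slopeDiv (subConv (upperRep ℓ f (γ.ext t)) (lowerRep ℓ f (γ.ext (t - y)))).toENNReal
            (tsep ℓ (γ.ext (t - y)) (γ.ext t)) :=
          iInf₂_le _ ⟨hyU, γ.causal_ext (by linarith)⟩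
      _ ≤ ENNReal.ofReal (F (t + ε * y) - F (t + -(1 + ε) * y)) /
            ENNReal.ofReal (K t - K (t - y)) := by
          rw [slopeDiv, if_neg hpos.ne', ← hinc]
          exact ENNReal.div_le_div (toENNReal_subConv_mono hup hlow) (hKle _ _ (by linarith))
      _ = _ := by
          rw [← ENNReal.ofReal_div_of_pos hy0]
          simp only [Function.comp_apply, Pi.div_apply]
          rw [e0, e1, div_div_div_cancel_right₀ hy'.ne']
  have hlim : Tendsto (fun ε : ℝ => ENNReal.ofReal ((1 + 2 * ε) * r / k)) (𝓝[>] 0)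
      (𝓝 (ENNReal.ofReal (r / k))) := by
    have : Continuous fun ε : ℝ => ENNReal.ofReal ((1 + 2 * ε) * r / k) :=
      ENNReal.continuous_ofReal.comp (by fun_prop)
    simpa using (this.tendsto 0).mono_left nhdsWithin_le_nhds
  have hle : slopeInf ℓ f U (γ.ext t) ≤ ENNReal.ofReal (r / k) :=
    ge_of_tendsto hlim (by filter_upwards [self_mem_nhdsWithin] with ε hε using key ε hε)
  calc slopeInf ℓ f U (γ.ext t) * ENNReal.ofReal k
      ≤ ENNReal.ofReal (r / k) * ENNReal.ofReal k := by gcongr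
    _ = ENNReal.ofReal r := by
      rw [← ENNReal.ofReal_mul' hk.le, div_mul_cancel₀ _ hk.ne']

variable [MeasurableSpace M] [BorelSpace M] [SecondCountableTopology M] {m : Measure M}

/-- The backward slope is a subslope along every left-continuous causal path. -/
theorem action_backwardSlope_le (h : IsFiniteSpacetime ℓ)
    (hlsc : LowerSemicontinuous fun z : M × M => max (ℓ z.1 z.2) 0)
    (hf : ∀ x y, Causal ℓ x y → f x ≤ f y) (γ : LCC ℓ) :
    action (backwardSlope ℓ f) 0 1 γ ≤ increment f (γ.path 0) (γ.path 1) := by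
  by_cases hcase : f (γ.path 1) = ⊤ ∨ f (γ.path 0) = ⊥
  · rw [increment_eq_top hcase]; exact le_top
  obtain ⟨hf1, hf0⟩ := not_or.1 hcase
  obtain ⟨hF, hinc⟩ := exists_monotone_of_causal hf γ hf0 hf1
  obtain ⟨r, -, hr, hrint⟩ := exists_ae_hasDerivAt_of_monotone hF
  obtain ⟨hk, hK⟩ := ae_hasDerivAt_integral_toReal (measurable_speed γ) fun a b hab =>
    ne_top_of_le_ne_top (h.tsep_ne_top _ _) (setLIntegral_speed_le h hlsc γ hab)
  have hle : action (backwardSlope ℓ f) 0 1 γ ≤ ∫⁻ t in Ioo 0 1, r t := by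
    refine lintegral_mono_ae ?_
    filter_upwards [ae_restrict_of_ae hr, ae_restrict_of_ae hk, ae_restrict_mem measurableSet_Ioo]
      with t hrt hkt ht
    rcases eq_or_ne (speed γ t) 0 with hs | hs
    · rw [hs, mul_zero]; exact zero_le
    rw [backwardSlope_eq, ENNReal.iSup_mul]
    refine iSup_le fun U => ?_
    rw [ENNReal.iSup_mul]
    refine iSup_le fun hU => ?_
    have h1 := slopeInf_mul_le ht.1 ht.2.le hrt.2 hkt.2 (ENNReal.toReal_pos hs hkt.1.ne) hinc
      (fun a b hab => (hK a b hab).trans_le (setLIntegral_speed_le h hlsc γ hab)) hU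
    rwa [ENNReal.ofReal_toReal hkt.1.ne, ENNReal.ofReal_toReal hrt.1.ne] at h1
  refine hle.trans ((hrint 0 1 one_pos).trans ?_)
  rw [← hinc, γ.ext_of_le_zero le_rfl, γ.ext_of_one_le le_rfl]

theorem isWeakSubslope_backwardSlope (hM : IsMetricSpacetime ℓ) (h : IsFiniteSpacetime ℓ)
    (hlsc : LowerSemicontinuous fun z : M × M => max (ℓ z.1 z.2) 0)
    (hf : ∀ x y, Causal ℓ x y → f x ≤ f y) : IsWeakSubslope ℓ m f (backwardSlope ℓ f) :=
  isWeakSubslope_iff.2 ⟨(measurable_backwardSlope hM h hlsc).aemeasurable,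
    fun _ _ => lintegral_mono (action_backwardSlope_le h hlsc hf)⟩

end BackwardSlopePath

/-! ### Consequences of `ℓ^q/q`-concavity -/

section Concavity

/-- Mean value bounds for the increasing concave function `s ↦ s ^ q / q`. -/
theorem rpow_div_sub_bounds {q u v : ℝ} (hq₀ : q ≠ 0) (hq₁ : q < 1) (hu : 0 < u) (huv : u ≤ v) :
    (v - u) * v ^ (q - 1) ≤ q⁻¹ * v ^ q - q⁻¹ * u ^ q ∧
      q⁻¹ * v ^ q - q⁻¹ * u ^ q ≤ (v - u) * u ^ (q - 1) := by
  rcases huv.eq_or_lt with rfl | huv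
  · simp
  have hderiv : ∀ x ∈ Icc u v, HasDerivAt (fun s : ℝ => q⁻¹ * s ^ q) (x ^ (q - 1)) x := by
    intro x hx
    have h1 := (Real.hasDerivAt_rpow_const (p := q) (Or.inl (hu.trans_le hx.1).ne')).const_mul q⁻¹
    rwa [← mul_assoc, inv_mul_cancel₀ hq₀, one_mul] at h1
  obtain ⟨c, hc, hc'⟩ := exists_hasDerivAt_eq_slope (fun s : ℝ => q⁻¹ * s ^ q) _ huv
    (fun x hx => (hderiv x hx).continuousAt.continuousWithinAt)
    (fun x hx => hderiv x (Ioo_subset_Icc_self hx))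
  have hvu : 0 < v - u := sub_pos.2 huv
  rw [eq_div_iff hvu.ne'] at hc'
  rw [← hc', mul_comm _ (v - u)]
  have hc0 : 0 < c := hu.trans hc.1
  constructor
  · exact mul_le_mul_of_nonneg_left
      (Real.rpow_le_rpow_of_nonpos hc0 hc.2.le (by linarith)) hvu.le
  · exact mul_le_mul_of_nonneg_left
      (Real.rpow_le_rpow_of_nonpos hu hc.1.le (by linarith)) hvu.le

variable {M : Type*} {ℓ : M → M → EReal} {f : M → EReal} {q : ℝ}

theorem lpow_eq (x y : M) : lpow ℓ q x y = tsep ℓ x y ^ q := rfl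

theorem lpowDiv_eq {x y : M} {a : ℝ} (ha : 0 < a) (h : tsep ℓ x y = ENNReal.ofReal a) :
    lpowDiv ℓ q x y = ((q⁻¹ * a ^ q : ℝ) : EReal) := by
  rw [lpowDiv, lpow_eq, h, ENNReal.ofReal_rpow_of_pos ha, EReal.coe_ennreal_ofReal,
    max_eq_left (Real.rpow_nonneg ha.le _), EReal.coe_mul]

theorem lpowDiv_le_of_tsep_le {x x' y y' : M} (h : tsep ℓ x y ≤ tsep ℓ x' y') :
    lpowDiv ℓ q x y ≤ lpowDiv ℓ q x' y' := by
  unfold lpowDiv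
  rw [lpow_eq, lpow_eq]
  rcases le_or_gt 0 q with hq | hq
  · refine mul_le_mul_of_nonneg_left ?_ (by exact_mod_cast inv_nonneg.2 hq)
    exact EReal.coe_ennreal_le_coe_ennreal_iff.2 (ENNReal.rpow_le_rpow h hq)
  · have h1 : ∀ b : EReal, ((q⁻¹ : ℝ) : EReal) * b = -(((-q⁻¹ : ℝ) : EReal) * b) := fun b => by
      rw [EReal.coe_neg, EReal.neg_mul, neg_neg]
    rw [h1, h1, EReal.neg_le_neg_iff]
    refine mul_le_mul_of_nonneg_left ?_ (by exact_mod_cast (neg_pos.2 (inv_lt_zero.2 hq)).le)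
    refine EReal.coe_ennreal_le_coe_ennreal_iff.2 ?_
    rw [← neg_neg q, ENNReal.rpow_neg, ENNReal.rpow_neg _ (-q), ENNReal.inv_le_inv]
    exact ENNReal.rpow_le_rpow h (by linarith)

theorem subConv_mono_right (a : EReal) {b b' : EReal} (h : b' ≤ b) :
    subConv a b ≤ subConv a b' := by
  by_cases h' : a = ⊤ ∨ b' = ⊥
  · simp [subConv, h']
  · obtain ⟨h1, h2⟩ := not_or.1 h'
    have h3 : b ≠ ⊥ := fun h0 => h2 (le_bot_iff.1 (h.trans h0.le))
    rw [subConv, subConv, if_neg h', if_neg (not_or.2 ⟨h1, h3⟩)]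
    exact EReal.sub_le_sub le_rfl h

/-- `ℓ^q/q`-concave functions are causal. -/
theorem IsLqConcave.causal (h : IsFiniteSpacetime ℓ) (hf : IsLqConcave ℓ q f) (x y : M)
    (hxy : Causal ℓ x y) : f x ≤ f y := by
  obtain ⟨ψ, hψ⟩ := hf
  rw [hψ x, hψ y]
  refine le_iInf₂ fun z hz => iInf₂_le_of_le z (h.causal_trans hxy hz) ?_
  exact subConv_mono_right _
    (lpowDiv_le_of_tsep_le (le_add_self.trans (h.tsep_add_le hxy hz)))

/-- At a pair of the superdifferential, the defining supremum of the `ℓ^q/q`-transform bounds the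
increments of `f` by the increments of `ℓ(·, y)^q/q`. -/
theorem sub_le_of_mem_superdifferential {x y w : M}
    (hxy : (x, y) ∈ superdifferential ℓ q f) {a : ℝ} (ha : 0 < a)
    (hL : tsep ℓ x y = ENNReal.ofReal a) (hfx : f x ≠ ⊤) (hfx' : f x ≠ ⊥) (hwy : Causal ℓ w y)
    {b : ℝ} (hb : 0 < b) (hb' : tsep ℓ w y = ENNReal.ofReal b) :
    f w ≠ ⊤ ∧ (f w ≠ ⊥ → (f w).toReal - (f x).toReal ≤ q⁻¹ * a ^ q - q⁻¹ * b ^ q) := by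
  obtain ⟨-, heq, htop, -⟩ := hxy
  have hle : addConv (f w) (lpowDiv ℓ q w y) ≤ lqTransform ℓ q f y :=
    le_iSup₂_of_le (f := fun x (_ : x ∈ JMinus ℓ y) => addConv (f x) (lpowDiv ℓ q x y)) w hwy le_rfl
  simp only at heq htop
  have hw : f w ≠ ⊤ := fun h0 => by
    rw [h0, addConv, if_pos rfl] at hle
    exact htop (top_le_iff.1 hle)
  refine ⟨hw, fun hw' => ?_⟩
  rw [heq, addConv, addConv, if_neg hw, if_neg hfx, lpowDiv_eq ha hL, lpowDiv_eq hb hb',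
    ← EReal.coe_toReal hw hw', ← EReal.coe_toReal hfx hfx', ← EReal.coe_add, ← EReal.coe_add,
    EReal.coe_le_coe_iff] at hle
  linarith

/-- Near `x`, points of the causal past of `x` have small time separation from `x`. If `x` has a
chronological past, this is upper semicontinuity of `ℓ` on an emerald; otherwise the separation
vanishes identically. -/
theorem eventually_tsep_le [TopologicalSpace M] [MeasurableSpace M] [BorelSpace M] {m : Measure M}
    (hadm : IsAdmissible ℓ m q) (h : IsFiniteSpacetime ℓ) (x : M) {δ : ℝ} (hδ : 0 < δ) :
    ∀ᶠ z in 𝓝 x, Causal ℓ z x → tsep ℓ z x ≤ ENNReal.ofReal δ := by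
  by_cases hne : ∃ w, Chron ℓ w x
  · obtain ⟨w, hw⟩ := hne
    set E : Set M := (⋃ x' ∈ ({w} : Set M), JPlus ℓ x') ∩ ⋃ y ∈ ({x} : Set M), JMinus ℓ y
    have hE : IsEmerald ℓ E := ⟨{w}, {x}, isCompact_singleton, isCompact_singleton, rfl⟩
    have hmem : ∀ z, Chron ℓ w z → Causal ℓ z x → z ∈ E := fun z hz hzx => by
      simp only [E, mem_singleton_iff, iUnion_iUnion_eq_left, mem_inter_iff]
      exact ⟨le_of_lt hz, hzx⟩
    have hxE : x ∈ E := hmem x hw (h.diag x)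
    have hxx : ℓ x x < (δ : EReal) := by
      rw [← coe_tsep (h.diag x), h.tsep_self x, EReal.coe_ennreal_zero]
      exact_mod_cast hδ
    have husc := hadm.upperSemicontinuousOn_emerald E hE (x, x) ⟨hxE, hxE⟩ δ hxx
    rw [eventually_nhdsWithin_iff] at husc
    have hpair : Tendsto (fun z => (z, x)) (𝓝 x) (𝓝 (x, x)) :=
      (Continuous.prodMk_left x).tendsto x
    filter_upwards [hpair.eventually husc,
      (isOpen_IPlus hadm.toIsMetricSpacetime w).mem_nhds hw] with z hz hwz hzx
    have h1 := (hz ⟨hmem z hwz hzx, hxE⟩).le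
    rw [← EReal.coe_ennreal_le_coe_ennreal_iff, coe_tsep hzx, EReal.coe_ennreal_ofReal,
      max_eq_left hδ.le]
    exact h1
  · refine Eventually.of_forall fun z _ => ?_
    have : tsep ℓ z x = 0 := by
      by_contra h0
      exact hne ⟨z, tsep_pos_iff.1 (pos_iff_ne_zero.2 h0)⟩
    rw [this]
    exact zero_le

/-- The lower bound on the backward slope at points of the superdifferential. -/
theorem rpow_le_backwardSlope [TopologicalSpace M] [MeasurableSpace M] [BorelSpace M]
    {m : Measure M} (hadm : IsAdmissible ℓ m q) (h : IsFiniteSpacetime ℓ)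
    (hf : ∀ x y, Causal ℓ x y → f x ≤ f y) (hq₀ : q ≠ 0) (hq₁ : q < 1) {x y : M}
    (hxy : (x, y) ∈ superdifferential ℓ q f) (hL0 : 0 < tsep ℓ x y) (hfx : f x ≠ ⊤)
    (hfx' : f x ≠ ⊥) : tsep ℓ x y ^ (q - 1) ≤ backwardSlope ℓ f x := by
  set a := (tsep ℓ x y).toReal
  have ha : 0 < a := ENNReal.toReal_pos hL0.ne' (h.tsep_ne_top x y)
  have hL : tsep ℓ x y = ENNReal.ofReal a := (ENNReal.ofReal_toReal (h.tsep_ne_top x y)).symm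
  have key : ∀ δ : ℝ, 0 < δ → ENNReal.ofReal ((a + δ) ^ (q - 1)) ≤ backwardSlope ℓ f x := by
    intro δ hδ
    rw [backwardSlope_eq]
    refine le_iSup₂_of_le _ (eventually_tsep_le hadm h x hδ) (le_iInf₂ ?_)
    rintro z ⟨hzU, hzx⟩
    replace hzU : Causal ℓ z x → tsep ℓ z x ≤ ENNReal.ofReal δ := hzU
    replace hzx : Causal ℓ z x := hzx
    unfold slopeDiv
    split_ifs with hz0
    · exact le_top
    set b := (tsep ℓ z x).toReal
    have hb : 0 < b := ENNReal.toReal_pos hz0 (h.tsep_ne_top z x)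
    have hbt : tsep ℓ z x = ENNReal.ofReal b := (ENNReal.ofReal_toReal (h.tsep_ne_top z x)).symm
    have hbδ : b ≤ δ := by
      have := hzU hzx
      rwa [hbt, ENNReal.ofReal_le_ofReal_iff hδ.le] at this
    rw [ENNReal.le_div_iff_mul_le (Or.inl hz0) (Or.inl (h.tsep_ne_top z x)), hbt,
      ← ENNReal.ofReal_mul (by positivity)]
    have hup : f x ≤ upperRep ℓ f x := le_iInf₂ fun w hw => hf _ _ (le_of_lt hw)
    have hlow : lowerRep ℓ f z ≤ f z := iSup₂_le fun w hw => hf _ _ (le_of_lt hw)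
    refine le_trans ?_ (toENNReal_subConv_mono hup hlow)
    change _ ≤ increment f z x
    by_cases hfz : f z = ⊥
    · rw [increment_eq_top (Or.inr hfz)]; exact le_top
    have hzy : Causal ℓ z y := h.causal_trans hzx hxy.1
    have htri := h.tsep_add_le hzx hxy.1
    set v := (tsep ℓ z y).toReal
    have hvt : tsep ℓ z y = ENNReal.ofReal v := (ENNReal.ofReal_toReal (h.tsep_ne_top z y)).symm
    have hv : b + a ≤ v := by
      have h1 := ENNReal.toReal_mono (h.tsep_ne_top z y) htri
      rwa [ENNReal.toReal_add (h.tsep_ne_top _ _) (h.tsep_ne_top _ _)] at h1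
    obtain ⟨hfz', hineq⟩ := sub_le_of_mem_superdifferential hxy ha hL hfx hfx' hzy
      (by linarith : 0 < v) hvt
    have hineq := hineq hfz
    rw [increment_eq_ofReal hfz hfz' hfx' hfx]
    refine ENNReal.ofReal_le_ofReal ?_
    have h1 := (rpow_div_sub_bounds hq₀ hq₁ ha (by linarith : a ≤ b + a)).1
    have h2 := (rpow_div_sub_bounds hq₀ hq₁ (by linarith : 0 < b + a) hv).1
    have h3 : 0 ≤ (v - (b + a)) * v ^ (q - 1) :=
      mul_nonneg (by linarith) (Real.rpow_nonneg (by linarith) _)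
    have h4 : (a + δ) ^ (q - 1) ≤ (b + a) ^ (q - 1) :=
      Real.rpow_le_rpow_of_nonpos (by linarith) (by linarith) (by linarith)
    have h5 := mul_le_mul_of_nonneg_right h4 hb.le
    rw [add_sub_cancel_right] at h1
    linarith
  have hlim : Tendsto (fun δ : ℝ => ENNReal.ofReal ((a + δ) ^ (q - 1))) (𝓝[>] 0)
      (𝓝 (tsep ℓ x y ^ (q - 1))) := by
    rw [hL, ENNReal.ofReal_rpow_of_pos ha]
    refine (ENNReal.continuous_ofReal.tendsto _).comp ?_
    have h1 : ContinuousAt (fun δ : ℝ => (a + δ) ^ (q - 1)) 0 :=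
      ContinuousAt.rpow_const (by fun_prop) (Or.inl (by simpa using ha.ne'))
    have h2 := h1.tendsto.mono_left (nhdsWithin_le_nhds (s := Ioi 0))
    simpa using h2
  exact le_of_tendsto hlim (by filter_upwards [self_mem_nhdsWithin] with δ hδ using key δ hδ)

/-- Along a geodesic whose endpoints lie in the superdifferential, the increments of `f` are bounded
from above by those of `-ℓ(·, γ₁) ^ q / q`. -/
theorem increment_le_of_mem_TGeo {M : Type*} [MetricSpace M] {ℓ : M → M → EReal} {f : M → EReal}
    (h : IsFiniteSpacetime ℓ)
    (hf : ∀ x y, Causal ℓ x y → f x ≤ f y) (hq₀ : q ≠ 0) (hq₁ : q < 1) {γ : LCC ℓ}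
    (hγ : γ ∈ TGeo ℓ) (hsuper : (γ.path 0, γ.path 1) ∈ superdifferential ℓ q f)
    (hf0 : f (γ.path 0) ≠ ⊤) (hf0' : f (γ.path 0) ≠ ⊥) {t : I} (ht1 : t < 1) :
    increment f (γ.path 0) (γ.path t) ≤
      ENNReal.ofReal (t * (1 - t) ^ (q - 1)) * tsep ℓ (γ.path 0) (γ.path 1) ^ q := by
  set a := (tsep ℓ (γ.path 0) (γ.path 1)).toReal
  have hL0 : 0 < tsep ℓ (γ.path 0) (γ.path 1) := tsep_pos_iff.2 (hγ 0 1 one_pos).1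
  have ha : 0 < a := ENNReal.toReal_pos hL0.ne' (h.tsep_ne_top _ _)
  have hL : tsep ℓ (γ.path 0) (γ.path 1) = ENNReal.ofReal a :=
    (ENNReal.ofReal_toReal (h.tsep_ne_top _ _)).symm
  have ht1' : (0 : ℝ) < 1 - t := sub_pos.2 ht1
  have hsep : tsep ℓ (γ.path t) (γ.path 1) = ENNReal.ofReal ((1 - t) * a) := by
    rw [tsep, (hγ t 1 ht1).2.1, EReal.toENNReal_mul (by exact_mod_cast ht1'.le),
      EReal.toENNReal_of_ne_top (EReal.coe_ne_top _), ENNReal.ofReal_mul ht1'.le, ← hL]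
    rfl
  have hbpos : 0 < (1 - t) * a := mul_pos ht1' ha
  obtain ⟨h1, h2⟩ := sub_le_of_mem_superdifferential hsuper ha hL hf0 hf0'
    (γ.causal t 1 unitInterval.le_one') hbpos hsep
  have hle := hf _ _ (γ.causal 0 t unitInterval.nonneg')
  have h3 : f (γ.path t) ≠ ⊥ := fun h0 => hf0' (le_bot_iff.1 (hle.trans h0.le))
  rw [increment_eq_ofReal hf0' hf0 h3 h1, hL, ENNReal.ofReal_rpow_of_pos ha,
    ← ENNReal.ofReal_mul (mul_nonneg t.2.1 (Real.rpow_nonneg ht1'.le _))]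
  refine ENNReal.ofReal_le_ofReal ((h2 h3).trans ?_)
  have hta : (1 - (t : ℝ)) * a ≤ a := by nlinarith [t.2.1]
  refine (rpow_div_sub_bounds hq₀ hq₁ hbpos hta).2.trans (le_of_eq ?_)
  rw [Real.mul_rpow ht1'.le ha.le, Real.rpow_sub_one ha.ne' q]
  field_simp
  ring

end Concavity

/-! ### Right-continuity at the initial time -/

section InitialTime

/-- In a second countable space, every subbase contains a countable subbase. -/
theorem exists_countable_subset_generateFrom {X : Type*} [t : TopologicalSpace X]
    [SecondCountableTopology X] {S : Set (Set X)} (hS : t = TopologicalSpace.generateFrom S) :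
    ∃ S' ⊆ S, S'.Countable ∧ t = TopologicalSpace.generateFrom S' := by
  have hb := TopologicalSpace.isTopologicalBasis_of_subbasis hS
  obtain ⟨B, hB, hBc, hBb⟩ := hb.exists_countable
  have hB' : ∀ b ∈ B, ∃ F : Set (Set X), (F.Finite ∧ F ⊆ S) ∧ ⋂₀ F = b := fun b hb => hB hb
  choose! F hF hFB using hB'
  refine ⟨⋃ b ∈ B, F b, iUnion₂_subset fun b hb => (hF b hb).2,
    hBc.biUnion fun b hb => (hF b hb).1.countable, le_antisymm ?_ ?_⟩
  · refine le_generateFrom fun V hV => ?_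
    obtain ⟨b, hb, hVb⟩ := mem_iUnion₂.1 hV
    rw [hS]
    exact TopologicalSpace.isOpen_generateFrom_of_mem ((hF b hb).2 hVb)
  · rw [hBb.eq_generateFrom]
    refine le_generateFrom fun b hb => ?_
    rw [← hFB b hb]
    exact @Set.Finite.isOpen_sInter X (TopologicalSpace.generateFrom _) _ (hF b hb).1 fun V hV =>
      TopologicalSpace.isOpen_generateFrom_of_mem (mem_iUnion₂.2 ⟨b, hb, hV⟩)

instance neBot_nhdsGT_zero_unitInterval : (𝓝[>] (0 : I)).NeBot :=
  nhdsGT_neBot_of_exists_gt ⟨1, one_pos⟩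

variable {M : Type*} [MetricSpace M] {ℓ : M → M → EReal} [MeasurableSpace M] [BorelSpace M]
  [SecondCountableTopology M] {m : Measure M} {f : M → EReal}

/-- Narrow convergence of the marginals at the initial time makes almost every path
right-continuous there: the open sets `I⁺(x)` are preserved along the path, and the open sets
`I⁻(x)` are not left immediately, by the portmanteau theorem. -/
theorem ae_tendsto_path_zero (hM : IsMetricSpacetime ℓ) (h : IsFiniteSpacetime ℓ)
    {π : Measure (LCC ℓ)} (hπ : IsInitialTestPlan m π) :
    ∀ᵐ γ ∂π, Tendsto γ.path (𝓝[>] 0) (𝓝 (γ.path 0)) := by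
  have := hπ.1
  have hnarrow := hπ.2.2
  obtain ⟨S, hS, hSc, hSgen⟩ := exists_countable_subset_generateFrom hM.topology_eq
  let μ : I → ProbabilityMeasure M := fun t =>
    ⟨π.map (eval t), Measure.isProbabilityMeasure_map (measurable_eval t).aemeasurable⟩
  have hμ : Tendsto μ (𝓝[>] 0) (𝓝 (μ 0)) :=
    ProbabilityMeasure.tendsto_iff_forall_integral_tendsto.2 hnarrow
  let τ : ℕ → I := fun n => ⟨1 / (n + 1), by positivity,
    (div_le_one (by positivity)).2 (by linarith [Nat.cast_nonneg (α := ℝ) n])⟩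
  have hτpos : ∀ n, 0 < τ n := fun n => by
    change (0 : ℝ) < 1 / (n + 1)
    positivity
  have hτlim : Tendsto τ atTop (𝓝 0) := by
    rw [tendsto_subtype_rng]
    exact tendsto_one_div_add_atTop_nhds_zero_nat
  have hpast : ∀ x, ∀ᵐ γ ∂π, γ.path 0 ∈ IMinus ℓ x → ∀ᶠ t in 𝓝[>] 0, γ.path t ∈ IMinus ℓ x := by
    intro x
    have hopen := isOpen_IMinus hM x
    set A : Set (LCC ℓ) := ⋃ n, eval (τ n) ⁻¹' IMinus ℓ x
    have hA : MeasurableSet A :=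
      MeasurableSet.iUnion fun n => measurable_eval _ hopen.measurableSet
    have hAsub : A ⊆ eval 0 ⁻¹' IMinus ℓ x := by
      refine iUnion_subset fun n γ hγ => ?_
      exact h.chron_of_causal_of_chron (γ.causal 0 (τ n) unitInterval.nonneg') hγ
    -- Pasts are left at most once, so the marginals at positive times only see `A`.
    have hle : π (eval 0 ⁻¹' IMinus ℓ x) ≤ π A := by
      have h1 := ProbabilityMeasure.le_liminf_measure_open_of_tendsto hμ hopen
      simp only [μ, ProbabilityMeasure.coe_mk] at h1
      rw [Measure.map_apply (measurable_eval _) hopen.measurableSet] at h1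
      refine h1.trans (liminf_le_of_le ?_ fun b hb => ?_)
      · exact ⟨0, by simp⟩
      · obtain ⟨t, ht, ht0⟩ := (hb.and self_mem_nhdsWithin).exists
        refine ht.trans ?_
        rw [Measure.map_apply (measurable_eval _) hopen.measurableSet]
        refine measure_mono fun γ hγ => ?_
        obtain ⟨n, hn⟩ := (hτlim.eventually (gt_mem_nhds ht0)).exists
        exact mem_iUnion.2 ⟨n, h.chron_of_causal_of_chron (γ.causal _ _ hn.le) hγ⟩
    have hae := ae_eq_of_subset_of_measure_ge hAsub hle hA.nullMeasurableSet (measure_ne_top _ _)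
    filter_upwards [hae.mem_iff] with γ hγ hγ0
    obtain ⟨n, hn⟩ := mem_iUnion.1 (hγ.2 hγ0)
    filter_upwards [Ioo_mem_nhdsGT (hτpos n)] with t ht
    exact h.chron_of_causal_of_chron (γ.causal _ _ ht.2.le) hn
  have hall : ∀ᵐ γ ∂π, ∀ V ∈ S, γ.path 0 ∈ V → ∀ᶠ t in 𝓝[>] 0, γ.path t ∈ V := by
    refine (ae_ball_iff hSc).2 fun V hV => ?_
    obtain ⟨x, rfl | rfl⟩ := hS hV
    · refine Eventually.of_forall fun γ hγ => Eventually.of_forall fun t => ?_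
      exact h.chron_of_chron_of_causal hγ (γ.causal 0 t unitInterval.nonneg')
    · exact hpast x
  filter_upwards [hall] with γ hγ
  have hnhds : 𝓝 (γ.path 0) = @nhds M (TopologicalSpace.generateFrom S) (γ.path 0) := by
    rw [← hSgen]
  rw [hnhds]
  exact TopologicalSpace.tendsto_nhds_generateFrom_iff.2 fun V hV hγV => hγ V hV hγV

/-! ### Lower semicontinuity of integrals along paths at the initial time -/

/-- Lower semicontinuity at the initial time of integrals along paths: an integrand is replaced by a
lower semicontinuous majorant with almost the same integral, to which Fatou's lemma applies; the
error is controlled by the bound on the compression. -/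
theorem eventually_lt_setLIntegral_ext [IsLocallyFiniteMeasure m] {π : Measure (LCC ℓ)}
    (hcont : ∀ᵐ γ ∂π, Tendsto γ.path (𝓝[>] 0) (𝓝 (γ.path 0))) {T : I} (hT : 0 < T)
    {C : ℝ≥0} (hC : ∀ r : I, r ≤ T → π.map (eval r) ≤ C • m) {g : M → ℝ≥0∞} (hg : Measurable g)
    (hgint : ∫⁻ x, g x ∂m ≠ ⊤) {w : LCC ℓ → ℝ≥0∞} (hw : Measurable w) {A : Set (LCC ℓ)}
    (hA : MeasurableSet A) {R : ℝ≥0} (hwR : ∀ γ ∈ A, w γ ≤ R) {c : ℝ≥0∞}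
    (hc : c < ∫⁻ γ in A, g (γ.path 0) * w γ ∂π) :
    ∀ᶠ r in 𝓝[>] (0 : I), c < ∫⁻ γ in A, g (γ.path r) * w γ ∂π := by
  have hε : ∃ ε : ℝ≥0∞, ε ≠ 0 ∧ c + R * (C * ε) < ∫⁻ γ in A, g (γ.path 0) * w γ ∂π := by
    have h1 : Tendsto (fun ε : ℝ≥0∞ => c + R * (C * ε)) (𝓝[>] 0) (𝓝 (c + R * (C * 0))) := by
      refine tendsto_const_nhds.add (ENNReal.Tendsto.const_mul (ENNReal.Tendsto.const_mul
        (tendsto_id.mono_left nhdsWithin_le_nhds) (Or.inr ENNReal.coe_ne_top))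
        (Or.inr ENNReal.coe_ne_top))
    rw [mul_zero, mul_zero, add_zero] at h1
    obtain ⟨ε, h2, h3⟩ := ((h1.eventually (gt_mem_nhds hc)).and self_mem_nhdsWithin).exists
    exact ⟨ε, (ne_of_gt h3 : ε ≠ 0), h2⟩
  obtain ⟨ε, hε0, hcε⟩ := hε
  obtain ⟨φ, hgφ, hφ, hφint⟩ := exists_le_lowerSemicontinuous_lintegral_ge m g hg hε0
  have herr : ∫⁻ x, (φ x - g x) ∂m ≤ ε := by
    rw [lintegral_sub hg hgint (Eventually.of_forall hgφ)]
    exact tsub_le_iff_left.2 hφint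
  have hfatou : ∫⁻ γ in A, g (γ.path 0) * w γ ∂π ≤
      liminf (fun r : I => ∫⁻ γ in A, φ (γ.path r) * w γ ∂π) (𝓝[>] 0) := by
    refine le_trans (lintegral_mono_ae ?_) (lintegral_liminf_le fun r =>
      (hφ.measurable.comp (measurable_path_apply r)).mul hw)
    filter_upwards [ae_restrict_of_ae hcont, ae_restrict_mem hA] with γ hγ hγA
    have h1 : φ (γ.path 0) ≤ liminf (fun r => φ (γ.path r)) (𝓝[>] 0) :=
      ((lowerSemicontinuousAt_iff_le_liminf.1 (hφ _)).trans
        (liminf_le_liminf_of_le hγ))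
    calc g (γ.path 0) * w γ ≤ liminf (fun r => φ (γ.path r)) (𝓝[>] 0) * w γ :=
          mul_le_mul' ((hgφ _).trans h1) le_rfl
      _ ≤ liminf (fun r => φ (γ.path r) * w γ) (𝓝[>] 0) := by
          have h2 := ENNReal.le_liminf_mul (f := 𝓝[>] (0 : I)) (u := fun r => φ (γ.path r))
            (v := fun _ => w γ)
          rwa [liminf_const] at h2
  filter_upwards [eventually_lt_of_lt_liminf (hcε.trans_le hfatou), Ioo_mem_nhdsGT hT] with r hr hrT
  have hsplit : ∫⁻ γ in A, φ (γ.path r) * w γ ∂π ≤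
      (∫⁻ γ in A, g (γ.path r) * w γ ∂π) + R * (C * ε) := by
    calc ∫⁻ γ in A, φ (γ.path r) * w γ ∂π
        ≤ ∫⁻ γ in A, (g (γ.path r) * w γ + R * (φ (γ.path r) - g (γ.path r))) ∂π := by
          refine setLIntegral_mono' hA fun γ hγ => ?_
          calc φ (γ.path r) * w γ = (g (γ.path r) + (φ (γ.path r) - g (γ.path r))) * w γ := by
                rw [add_tsub_cancel_of_le (hgφ _)]
            _ ≤ _ := by
                rw [add_mul, mul_comm (φ (γ.path r) - g (γ.path r))]
                gcongr
                exact hwR γ hγ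
      _ = (∫⁻ γ in A, g (γ.path r) * w γ ∂π) +
            R * ∫⁻ γ in A, (φ (γ.path r) - g (γ.path r)) ∂π := by
          have h1 : Measurable fun γ : LCC ℓ => g (γ.path r) * w γ :=
            (hg.comp (measurable_path_apply r)).mul hw
          rw [lintegral_add_left h1, lintegral_const_mul' _ _ ENNReal.coe_ne_top]
      _ ≤ _ := by
          gcongr
          calc ∫⁻ γ in A, (φ (γ.path r) - g (γ.path r)) ∂π
              ≤ ∫⁻ γ, (φ (γ.path r) - g (γ.path r)) ∂π := setLIntegral_le_lintegral _ _
            _ = ∫⁻ x, (φ x - g x) ∂(π.map (eval r)) :=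
                (lintegral_map (hφ.measurable.sub hg) (measurable_eval r)).symm
            _ ≤ ∫⁻ x, (φ x - g x) ∂(C • m) := lintegral_mono' (hC r hrT.2.le) le_rfl
            _ = C * ∫⁻ x, (φ x - g x) ∂m := by rw [lintegral_smul_measure]; rfl
            _ ≤ C * ε := by gcongr
  have h2 := hr.trans_le hsplit
  have hfin : (R : ℝ≥0∞) * (C * ε) ≠ ⊤ := fun htop => by
    rw [htop, add_top] at hcε
    exact not_top_lt hcε
  exact lt_of_add_lt_add_right h2

end InitialTime

/-! ### The upper bound on weak subslopes, and representation of the gradient -/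

section Representation

variable {M : Type*} [MetricSpace M] {ℓ : M → M → EReal} [MeasurableSpace M] [BorelSpace M]
  [SecondCountableTopology M] {m : Measure M} {f : M → EReal} {q : ℝ}

/-- The compression bound of an initial test plan, on an initial time interval. -/
theorem IsInitialTestPlan.exists_map_eval_le {π : Measure (LCC ℓ)} (hπ : IsInitialTestPlan m π) :
    ∃ T : I, 0 < T ∧ ∃ C : ℝ≥0, ∀ r : I, r ≤ T → π.map (eval r) ≤ C • m := by
  obtain ⟨-, ⟨T, hT, -, C, -, hC⟩, -⟩ := hπ
  have hT' : (0 : ℝ) < T := hT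
  refine ⟨T, hT, C, fun r hr => ?_⟩
  have hr' : (r : ℝ) ≤ T := hr
  have h1 := hC ⟨r / T, div_nonneg r.2.1 hT'.le, (div_le_one hT').2 hr'⟩
  rw [Measure.map_map (measurable_eval _) (measurable_restr _ _ _)] at h1
  convert h1 using 2
  funext γ
  simp only [eval, Function.comp_apply, restr]
  congr 1
  ext
  simp only [lineParam, Icc.coe_zero, mul_zero, zero_add]
  rw [div_mul_cancel₀ _ hT'.ne']

theorem measurable_tsep_endpoints
    (hlsc : LowerSemicontinuous fun z : M × M => max (ℓ z.1 z.2) 0) :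
    Measurable fun γ : LCC ℓ => tsep ℓ (γ.path 0) (γ.path 1) :=
  (measurable_tsep hlsc).comp ((measurable_path_apply 0).prodMk (measurable_path_apply 1))

/-- The integrated form of the upper bound on weak subslopes. The localised inequality for weak
subslopes on `[0, t]` is divided by `t`, and `t` tends to `0`. -/
theorem setLIntegral_mul_tsep_le [IsLocallyFiniteMeasure m] (h : IsFiniteSpacetime ℓ)
    (hlsc : LowerSemicontinuous fun z : M × M => max (ℓ z.1 z.2) 0)
    (hf : ∀ x y, Causal ℓ x y → f x ≤ f y) (hq₀ : q ≠ 0) (hq₁ : q < 1)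
    {π : Measure (LCC ℓ)} [IsFiniteMeasure π]
    (hcont : ∀ᵐ γ ∂π, Tendsto γ.path (𝓝[>] 0) (𝓝 (γ.path 0))) {T : I} (hT : 0 < T)
    {C : ℝ≥0} (hC : ∀ r : I, r ≤ T → π.map (eval r) ≤ C • m)
    (hgeo : ∀ᵐ γ ∂π, γ ∈ TGeo ℓ)
    (hsuper : ∀ᵐ γ : LCC ℓ ∂π, (γ.path 0, γ.path 1) ∈ superdifferential ℓ q f)
    (hfin : ∀ᵐ γ : LCC ℓ ∂π, f (γ.path 0) ≠ ⊤ ∧ f (γ.path 0) ≠ ⊥)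
    {G g : M → ℝ≥0∞} (hG : IsWeakSubslope ℓ m f G) (hg : Measurable g) (hgG : g ≤ G)
    (hgint : ∫⁻ x, g x ∂m ≠ ⊤) {A : Set (LCC ℓ)} (hA : MeasurableSet A) {R : ℝ≥0}
    (hAR : ∀ γ ∈ A, tsep ℓ (γ.path 0) (γ.path 1) ≤ R) :
    ∫⁻ γ in A, g (γ.path 0) * tsep ℓ (γ.path 0) (γ.path 1) ∂π ≤
      ∫⁻ γ in A, tsep ℓ (γ.path 0) (γ.path 1) ^ q ∂π := by
  have hw := measurable_tsep_endpoints (ℓ := ℓ) hlsc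
  set X := ∫⁻ γ in A, tsep ℓ (γ.path 0) (γ.path 1) ^ q ∂π
  refine le_of_forall_lt_imp_le_of_dense fun c hc => ?_
  have hev := eventually_lt_setLIntegral_ext hcont hT hC hg hgint hw hA hAR hc
  obtain ⟨t₀, ht₀, ht₀sub⟩ := (mem_nhdsGT_iff_exists_Ioo_subset' (one_pos : (0 : I) < 1)).1 hev
  have ht₀ : 0 < t₀ := ht₀
  have key : ∀ t : I, t ∈ Ioo 0 (min t₀ T) → c ≤ ENNReal.ofReal ((1 - (t : ℝ)) ^ (q - 1)) * X := by
    rintro t ⟨ht0, ht⟩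
    obtain ⟨htt₀, htT⟩ := lt_min_iff.1 ht
    have ht1 : t < 1 := htT.trans_le unitInterval.le_one'
    have ht0' : (0 : ℝ) < t := ht0
    have ht1' : (t : ℝ) < 1 := ht1
    have hlow : c * ENNReal.ofReal t ≤ ∫⁻ γ in A, action G 0 t γ ∂π := by
      calc c * ENNReal.ofReal t = ∫⁻ _ in Ioo (0 : ℝ) t, c := by simp
        _ ≤ ∫⁻ r in Ioo (0 : ℝ) t, ∫⁻ γ in A,
              g (γ.ext r) * tsep ℓ (γ.path 0) (γ.path 1) ∂π := by
            refine setLIntegral_mono' measurableSet_Ioo fun r hr => ?_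
            have hr1 : r ∈ Icc (0 : ℝ) 1 := ⟨hr.1.le, (hr.2.trans ht1').le⟩
            have h1 : c < _ := ht₀sub (show (⟨r, hr1⟩ : I) ∈ Ioo 0 t₀ from
              ⟨hr.1, lt_trans (b := t) hr.2 htt₀⟩)
            simp only [LCC.ext, projIcc_of_mem zero_le_one hr1]
            exact h1.le
        _ = ∫⁻ γ in A, (∫⁻ r in Ioo (0 : ℝ) t,
              g (γ.ext r) * tsep ℓ (γ.path 0) (γ.path 1)) ∂π := by
            refine lintegral_lintegral_swap (Measurable.aemeasurable ?_)
            exact (hg.comp (measurable_uncurry_ext.comp measurable_swap)).mul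
              (hw.comp measurable_snd)
        _ ≤ ∫⁻ γ in A, action G 0 t γ ∂π := by
            refine lintegral_mono_ae ?_
            filter_upwards [ae_restrict_of_ae hgeo] with γ hγ
            refine lintegral_mono_ae ?_
            filter_upwards [ae_restrict_of_ae_restrict_of_subset (Ioo_subset_Ioo_right ht1'.le)
              (speed_eq_of_mem_TGeo h hlsc hγ)] with r hr
            rw [hr]
            exact mul_le_mul' (hgG _) le_rfl
    have hup : ∫⁻ γ in A, action G 0 t γ ∂π ≤
        ENNReal.ofReal t * (ENNReal.ofReal ((1 - (t : ℝ)) ^ (q - 1)) * X) := by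
      have h1 := hG.setLIntegral_action_le h hlsc ht0 (fun r _ hr => hC r (hr.trans htT.le)) A
      refine h1.trans ?_
      rw [← mul_assoc, ← ENNReal.ofReal_mul ht0'.le,
        ← lintegral_const_mul' _ _ ENNReal.ofReal_ne_top]
      refine lintegral_mono_ae ?_
      filter_upwards [ae_restrict_of_ae hgeo, ae_restrict_of_ae hsuper, ae_restrict_of_ae hfin]
        with γ h1 h2 h3
      exact increment_le_of_mem_TGeo h hf hq₀ hq₁ h1 h2 h3.1 h3.2 ht1
    have h2 := hlow.trans hup
    rw [mul_comm c] at h2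
    exact (ENNReal.mul_le_mul_iff_right (by simpa using ht0') ENNReal.ofReal_ne_top).1 h2
  have hlim : Tendsto (fun t : I => ENNReal.ofReal ((1 - (t : ℝ)) ^ (q - 1)) * X) (𝓝[>] 0)
      (𝓝 X) := by
    have h1 : ContinuousAt (fun t : I => (1 - (t : ℝ)) ^ (q - 1)) 0 :=
      ContinuousAt.rpow_const (by fun_prop) (Or.inl (by simp))
    have h2 := (ENNReal.continuous_ofReal.tendsto _).comp
      (h1.tendsto.mono_left (nhdsWithin_le_nhds (s := Ioi 0)))
    have h3 := ENNReal.Tendsto.mul_const (b := X) h2 (Or.inl (by simp))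
    simpa using h3
  exact ge_of_tendsto hlim (by
    filter_upwards [Ioo_mem_nhdsGT (lt_min ht₀ hT)] with t ht using key t ht)

/-- The upper bound on weak subslopes at the initial points of geodesics whose endpoints lie in the
superdifferential. -/
theorem ae_mul_tsep_le [IsLocallyFiniteMeasure m] (hM : IsMetricSpacetime ℓ)
    (h : IsFiniteSpacetime ℓ)
    (hlsc : LowerSemicontinuous fun z : M × M => max (ℓ z.1 z.2) 0)
    (hf : ∀ x y, Causal ℓ x y → f x ≤ f y) (hq₀ : q ≠ 0) (hq₁ : q < 1)
    {π : Measure (LCC ℓ)} (hπ : IsInitialTestPlan m π) (hgeo : ∀ᵐ γ ∂π, γ ∈ TGeo ℓ)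
    (hsuper : ∀ᵐ γ : LCC ℓ ∂π, (γ.path 0, γ.path 1) ∈ superdifferential ℓ q f)
    (hfin : ∀ᵐ γ : LCC ℓ ∂π, f (γ.path 0) ≠ ⊤ ∧ f (γ.path 0) ≠ ⊥)
    {G : M → ℝ≥0∞} (hG : IsWeakSubslope ℓ m f G) :
    ∀ᵐ γ : LCC ℓ ∂π, G (γ.path 0) * tsep ℓ (γ.path 0) (γ.path 1) ≤
      tsep ℓ (γ.path 0) (γ.path 1) ^ q := by
  have := hπ.1
  obtain ⟨T, hT, C, hC⟩ := hπ.exists_map_eval_le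
  have hw := measurable_tsep_endpoints (ℓ := ℓ) hlsc
  have hcont := ae_tendsto_path_zero hM h hπ
  set G' := hG.1.mk G
  have hG' : IsWeakSubslope ℓ m f G' := hG.congr hG.1.ae_eq_mk
  have hG'meas : Measurable G' := hG.1.measurable_mk
  have hGG' : ∀ᵐ γ : LCC ℓ ∂π, G (γ.path 0) = G' (γ.path 0) := by
    have h1 : ∀ᵐ x ∂(π.map (eval 0)), G x = G' x :=
      ((Measure.absolutelyContinuous_of_le (hC 0 hT.le)).trans
        Measure.smul_absolutelyContinuous).ae_le hG.1.ae_eq_mk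
    exact ae_of_ae_map (measurable_eval 0).aemeasurable h1
  -- Truncations of the subslope with finite integral.
  let g : ℕ → M → ℝ≥0∞ := fun n => (spanningSets m n).indicator fun x => min (G' x) n
  have hg : ∀ n, Measurable (g n) := fun n =>
    (hG'meas.min measurable_const).indicator (measurableSet_spanningSets m n)
  have hgG : ∀ n, g n ≤ G' := fun n x =>
    (indicator_le_self' (fun _ _ => zero_le) x).trans (min_le_left _ _)
  have hgint : ∀ n, ∫⁻ x, g n x ∂m ≠ ⊤ := fun n => by
    rw [lintegral_indicator (measurableSet_spanningSets m n)]
    refine ne_top_of_le_ne_top (ENNReal.mul_ne_top (ENNReal.natCast_ne_top n)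
      (measure_spanningSets_lt_top m n).ne) ?_
    rw [← setLIntegral_const]
    exact lintegral_mono fun x => min_le_right _ _
  have hbound : ∀ n R : ℕ, ∀ᵐ γ : LCC ℓ ∂π, tsep ℓ (γ.path 0) (γ.path 1) ≤ R →
      g n (γ.path 0) * tsep ℓ (γ.path 0) (γ.path 1) ≤ tsep ℓ (γ.path 0) (γ.path 1) ^ q := by
    intro n R
    have hS : MeasurableSet {γ : LCC ℓ | tsep ℓ (γ.path 0) (γ.path 1) ≤ R} :=
      measurableSet_le hw measurable_const
    refine (ae_restrict_iff' hS).1 ?_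
    refine ae_le_of_forall_setLIntegral_le_of_sigmaFinite
      (((hg n).comp (measurable_path_apply 0)).mul hw) fun A hA _ => ?_
    rw [Measure.restrict_restrict hA]
    exact setLIntegral_mul_tsep_le h hlsc hf hq₀ hq₁ hcont hT hC hgeo hsuper hfin hG' (hg n)
      (hgG n) (hgint n) (hA.inter hS) (R := R) fun γ hγ => by exact_mod_cast hγ.2
  filter_upwards [ae_all_iff.2 fun n => ae_all_iff.2 (hbound n), hGG'] with γ hγ hγG
  rw [hγG]
  obtain ⟨R, hR⟩ := exists_nat_gt (tsep ℓ (γ.path 0) (γ.path 1)).toNNReal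
  have hR' : tsep ℓ (γ.path 0) (γ.path 1) ≤ R := by
    rw [← ENNReal.coe_toNNReal (h.tsep_ne_top (γ.path 0) (γ.path 1))]
    exact_mod_cast hR.le
  have hlim : Tendsto (fun n : ℕ => min (G' (γ.path 0)) n * tsep ℓ (γ.path 0) (γ.path 1)) atTop
      (𝓝 (G' (γ.path 0) * tsep ℓ (γ.path 0) (γ.path 1))) := by
    refine ENNReal.Tendsto.mul_const ?_ (Or.inr (h.tsep_ne_top _ _))
    simpa using (tendsto_const_nhds (x := G' (γ.path 0))).min ENNReal.tendsto_nat_nhds_top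
  refine le_of_tendsto hlim ?_
  filter_upwards [eventually_ge_atTop (spanningSetsIndex m (γ.path 0))] with n hn
  have h1 := hγ n R hR'
  simp only [g] at h1
  rwa [indicator_of_mem (monotone_spanningSets m hn (mem_spanningSetsIndex m _))] at h1

/-- The scaled action of a plan on geodesics does not depend on the time. -/
theorem scaledAction_eq (h : IsFiniteSpacetime ℓ)
    (hlsc : LowerSemicontinuous fun z : M × M => max (ℓ z.1 z.2) 0) {π : Measure (LCC ℓ)}
    (hgeo : ∀ᵐ γ ∂π, γ ∈ TGeo ℓ) {b : ℝ} (hb : 0 ≤ b)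
    (hΛ : ∫⁻ γ : LCC ℓ, tsep ℓ (γ.path 0) (γ.path 1) ^ q ∂π = ENNReal.ofReal b) {t : I}
    (ht : 0 < t) : scaledAction π q t = ((q⁻¹ * b : ℝ) : EReal) := by
  have ht' : (0 : ℝ) < t := ht
  have h1 : ∫⁻ γ, ∫⁻ r in Ioo (0 : ℝ) t, speed γ r ^ q ∂volume ∂π = ENNReal.ofReal (t * b) := by
    rw [ENNReal.ofReal_mul ht'.le, ← hΛ, ← lintegral_const_mul' _ _ ENNReal.ofReal_ne_top]
    refine lintegral_congr_ae ?_
    filter_upwards [hgeo] with γ hγ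
    rw [lintegral_congr_ae (g := fun _ => tsep ℓ (γ.path 0) (γ.path 1) ^ q)]
    · rw [setLIntegral_const, Real.volume_Ioo, sub_zero, mul_comm]
    · filter_upwards [ae_restrict_of_ae_restrict_of_subset (Ioo_subset_Ioo_right t.2.2)
        (speed_eq_of_mem_TGeo h hlsc hγ)] with r hr
      rw [hr]
  rw [scaledAction, h1, EReal.coe_ennreal_ofReal, max_eq_left (mul_nonneg ht'.le hb),
    ← EReal.coe_mul, mul_inv]
  congr 1
  field_simp

omit [MeasurableSpace M] [BorelSpace M] [SecondCountableTopology M] in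
theorem differenceQuotient_le (h : IsFiniteSpacetime ℓ)
    (hf : ∀ x y, Causal ℓ x y → f x ≤ f y) (hq₀ : q ≠ 0) (hq₁ : q < 1)
    {π : Measure (LCC ℓ)} (hgeo : ∀ᵐ γ ∂π, γ ∈ TGeo ℓ)
    (hsuper : ∀ᵐ γ : LCC ℓ ∂π, (γ.path 0, γ.path 1) ∈ superdifferential ℓ q f)
    (hfin : ∀ᵐ γ : LCC ℓ ∂π, f (γ.path 0) ≠ ⊤ ∧ f (γ.path 0) ≠ ⊥) {b : ℝ} (hb : 0 ≤ b)
    (hΛ : ∫⁻ γ : LCC ℓ, tsep ℓ (γ.path 0) (γ.path 1) ^ q ∂π = ENNReal.ofReal b) {t : I}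
    (ht : 0 < t) (ht1 : t < 1) :
    differenceQuotient π f t ≤ (((1 - (t : ℝ)) ^ (q - 1) * b : ℝ) : EReal) := by
  have ht' : (0 : ℝ) < t := ht
  have ht1' : (0 : ℝ) < 1 - t := sub_pos.2 ht1
  have hpow : 0 ≤ (1 - (t : ℝ)) ^ (q - 1) := Real.rpow_nonneg ht1'.le _
  have h1 : ∫⁻ γ, increment f (γ.path 0) (γ.path t) / ENNReal.ofReal t ∂π ≤
      ENNReal.ofReal ((1 - (t : ℝ)) ^ (q - 1) * b) := by
    rw [ENNReal.ofReal_mul hpow, ← hΛ, ← lintegral_const_mul' _ _ ENNReal.ofReal_ne_top]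
    refine lintegral_mono_ae ?_
    filter_upwards [hgeo, hsuper, hfin] with γ h1 h2 h3
    refine ENNReal.div_le_of_le_mul ?_
    refine (increment_le_of_mem_TGeo h hf hq₀ hq₁ h1 h2 h3.1 h3.2 ht1).trans (le_of_eq ?_)
    rw [ENNReal.ofReal_mul ht'.le]
    ring
  have h2 := EReal.coe_ennreal_le_coe_ennreal_iff.2 h1
  rwa [EReal.coe_ennreal_ofReal, max_eq_left (mul_nonneg hpow hb)] at h2

end Representation

end LorentzSobolev

end

theorem theorem5p28 {M : Type*} [MetricSpace M] [MeasurableSpace M] [BorelSpace M]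
    (ℓ : M → M → EReal) (m : Measure M) (p q : ℝ)
    (hq₀ : q ≠ 0) (hq₁ : q < 1) (hpq : p⁻¹ + q⁻¹ = 1)
    (hadm : IsAdmissible ℓ m q)
    (hlsc : LowerSemicontinuous fun z : M × M => max (ℓ z.1 z.2) 0)
    (f : M → EReal) (hfm : NullMeasurable f m) (hf : IsLqConcave ℓ q f)
    (π : Measure (LCC ℓ)) (hπ : IsInitialTestPlan m π)
    (hgeo : ∀ᵐ γ ∂π, γ ∈ TGeo ℓ)
    (hsuper : ∀ᵐ z ∂(π.map fun γ : LCC ℓ => (γ.path 0, γ.path 1)), z ∈ superdifferential ℓ q f)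
    (E : Set M) (hE : NullMeasurableSet E m) (hstay : StaysInitiallyIn π E)
    (hint : ((q⁻¹ : ℝ) : EReal) *
      ((∫⁻ γ : LCC ℓ, lpow ℓ q (γ.path 0) (γ.path 1) ∂π : ENNReal) : EReal) < ⊤)
    (hdf : ∫⁻ x in E, maxWeakSubslope ℓ m f x ^ p ∂m < ⊤)
    (hfin : ∀ᵐ γ : LCC ℓ ∂π, (f (γ.path 0) ≠ ⊤ ∧ f (γ.path 0) ≠ ⊥) ∧
      0 < ℓ (γ.path 0) (γ.path 1) ∧ ℓ (γ.path 0) (γ.path 1) < ⊤) :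
    RepresentsInitialGradient m p q f E π ∧
      ∀ᵐ γ : LCC ℓ ∂π,
        backwardSlope ℓ f (γ.path 0) = maxWeakSubslope ℓ m f (γ.path 0) ∧
        maxWeakSubslope ℓ m f (γ.path 0) = (ℓ (γ.path 0) (γ.path 1)).toENNReal ^ (q - 1) := by
  have := hadm.polish
  have := hadm.radon
  have := hπ.1
  have hM := hadm.toIsMetricSpacetime
  have h : IsFiniteSpacetime ℓ := ⟨hM.toIsRoughSpacetime, hadm.finite_of_causal⟩
  have hcausal := hf.causal h
  have hfin' : ∀ᵐ γ : LCC ℓ ∂π, f (γ.path 0) ≠ ⊤ ∧ f (γ.path 0) ≠ ⊥ := hfin.mono fun _ h => h.1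
  have hsuper' : ∀ᵐ γ : LCC ℓ ∂π, (γ.path 0, γ.path 1) ∈ superdifferential ℓ q f :=
    ae_of_ae_map ((measurable_path_apply 0).prodMk (measurable_path_apply 1)).aemeasurable hsuper
  obtain ⟨T, hT, C, hC⟩ := hπ.exists_map_eval_le
  have hmax := isMaximalWeakSubslope_maxWeakSubslope (m := m) h hlsc hcausal
  set G := maxWeakSubslope ℓ m f
  have hac : π.map (eval 0) ≪ m := (Measure.absolutelyContinuous_of_le (hC 0 hT.le)).trans
    Measure.smul_absolutelyContinuous
  have hslope : ∀ᵐ γ : LCC ℓ ∂π, backwardSlope ℓ f (γ.path 0) ≤ G (γ.path 0) :=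
    ae_of_ae_map (measurable_eval 0).aemeasurable
      (hac.ae_le (hmax.2 _ (isWeakSubslope_backwardSlope hM h hlsc hcausal)))
  have hmain : ∀ᵐ γ : LCC ℓ ∂π, backwardSlope ℓ f (γ.path 0) = G (γ.path 0) ∧
      G (γ.path 0) = tsep ℓ (γ.path 0) (γ.path 1) ^ (q - 1) := by
    filter_upwards [hslope, hsuper', hfin,
      ae_mul_tsep_le hM h hlsc hcausal hq₀ hq₁ hπ hgeo hsuper' hfin' hmax.1] with γ h1 h2 h3 h4
    have hpos : 0 < tsep ℓ (γ.path 0) (γ.path 1) := tsep_pos_iff.2 h3.2.1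
    have htop := h.tsep_ne_top (γ.path 0) (γ.path 1)
    have h5 := rpow_le_backwardSlope hadm h hcausal hq₀ hq₁ h2 hpos h3.1.1 h3.1.2
    have h6 : G (γ.path 0) ≤ tsep ℓ (γ.path 0) (γ.path 1) ^ (q - 1) := by
      rw [ENNReal.rpow_sub _ _ hpos.ne' htop, ENNReal.rpow_one,
        ENNReal.le_div_iff_mul_le (Or.inl hpos.ne') (Or.inl htop)]
      exact h4
    exact ⟨le_antisymm h1 (h6.trans h5), le_antisymm h6 (h5.trans h1)⟩
  refine ⟨?_, hmain⟩
  have hqinv : q⁻¹ ≠ 1 := fun h0 => hq₁.ne (inv_eq_one.1 h0)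
  have hp0 : p ≠ 0 := fun h0 => hqinv (by rw [h0, inv_zero, zero_add] at hpq; exact hpq)
  have hpq' : (q - 1) * p = q := by
    field_simp at hpq
    linarith
  -- The energy of the plan is the integral of `|df| ^ p` over its initial points, hence finite.
  have henergy : ∫⁻ γ : LCC ℓ, G (γ.path 0) ^ p ∂π =
      ∫⁻ γ : LCC ℓ, tsep ℓ (γ.path 0) (γ.path 1) ^ q ∂π := by
    refine lintegral_congr_ae ?_
    filter_upwards [hmain] with γ hγ
    rw [hγ.2, ← ENNReal.rpow_mul, hpq']
  have hfinite : ∫⁻ γ : LCC ℓ, G (γ.path 0) ^ p ∂π ≠ ⊤ := by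
    obtain ⟨T', hT', hT'E⟩ := hstay
    have hGp : AEMeasurable (fun x => G x ^ p) (π.map (eval 0)) :=
      (hmax.1.1.pow_const p).mono_ac hac
    have h1 : ∫⁻ γ : LCC ℓ, G (γ.path 0) ^ p ∂π = ∫⁻ x, G x ^ p ∂(π.map (eval 0)) :=
      (lintegral_map' hGp (measurable_eval 0).aemeasurable).symm
    rw [h1, ← Measure.restrict_eq_self_of_ae_mem (hT'E 0 hT'.le)]
    have h2 : (π.map (eval 0)).restrict E ≤ (C • m).restrict E :=
      Measure.restrict_mono_measure (hC 0 hT.le) E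
    refine ne_top_of_le_ne_top ?_ (lintegral_mono' h2 le_rfl)
    rw [Measure.restrict_smul, lintegral_smul_measure]
    exact ENNReal.mul_ne_top ENNReal.coe_ne_top hdf.ne
  set b := (∫⁻ γ : LCC ℓ, G (γ.path 0) ^ p ∂π).toReal
  have hb : 0 ≤ b := ENNReal.toReal_nonneg
  have hbG : ∫⁻ γ : LCC ℓ, G (γ.path 0) ^ p ∂π = ENNReal.ofReal b :=
    (ENNReal.ofReal_toReal hfinite).symm
  have hbΛ := henergy.symm.trans hbG
  have hliminf : liminf (scaledAction π q) (𝓝[>] 0) = ((q⁻¹ * b : ℝ) : EReal) := by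
    refine Tendsto.liminf_eq (tendsto_const_nhds.congr' ?_)
    filter_upwards [self_mem_nhdsWithin] with t ht
    exact (scaledAction_eq h hlsc hgeo hb hbΛ ht).symm
  refine ⟨hstay, hdf, ?_, ?_⟩
  · rw [hliminf]
    exact EReal.coe_lt_top _
  · rw [hliminf, hbG, EReal.coe_ennreal_ofReal, max_eq_left hb, ← EReal.coe_mul, ← EReal.coe_add,
      ← add_mul, hpq, one_mul]
    have hlim : Tendsto (fun t : I => (((1 - (t : ℝ)) ^ (q - 1) * b : ℝ) : EReal)) (𝓝[>] 0)
        (𝓝 (b : EReal)) := by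
      have h1 : ContinuousAt (fun t : I => (1 - (t : ℝ)) ^ (q - 1) * b) 0 :=
        (ContinuousAt.rpow_const (by fun_prop) (Or.inl (by simp))).mul_const b
      have h2 := (continuous_coe_real_ereal.tendsto _).comp
        (h1.tendsto.mono_left (nhdsWithin_le_nhds (s := Ioi 0)))
      have h3 : (1 - ((0 : I) : ℝ)) ^ (q - 1) * b = b := by simp
      rwa [h3] at h2
    rw [← hlim.limsup_eq]
    refine limsup_le_limsup ?_
    filter_upwards [Ioo_mem_nhdsGT (one_pos : (0 : I) < 1)] with t ht
    exact differenceQuotient_le h hcausal hq₀ hq₁ hgeo hsuper' hfin' hb hbΛ ht.1 ht.2
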